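/- **Setting.** Fix $\gamma^*\in(0,1)$ and let $n=n(d)$ satisfy $\log n=o(d)$ (sparse data, $n=2^{o(d)}$) and $\log d=o(\log n)$ (so that $d^{O(1)}=n^{o(1)}$). Put $\mu=\sqrt{1-n^{-2/d}}$. The data set $\mathcal D\subset\mathcal S^{d-1}$ consists of $n$ points: a planted point $p^*$, and $n-1$ further points that are independent and uniformly distributed on the unit sphere. The query $q\in\mathcal S^{d-1}$ satisfies $\langle p^*,q\rangle\ge\gamma^*$ (in particular, $\langle p^*,q\rangle=\gamma^*$ is allowed). In the $\alpha$-near neighbor graph on $\mathcal D$ two distinct points $p,p'$ are adjacent iff $\langle p,p'\rangle\ge\alpha$; the bucket $\mathcal B(p)$ is the set of neighbors of $p$, stored as a binary search tree. The algorithms, with time counted in elementary operations of a real RAM (an inner product takes $2d$ of them) and space in memory cells (each holding a real number, an index or a pointer), are: * **One tour of Query($q$).** Draw $p$ uniformly from $\mathcal D$. While $\langle p,q\rangle<\gamma^*$: go through all $p'$ in the bucket that $p$ has at the beginning of the pass, and whenever $\langle p',q\rangle\ge\langle p,q\rangle+\frac1d$ for the current $p$, replace $p$ by $p'$; if a pass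 makes no replacement, the tour fails (no restart). When $\langle p,q\rangle\ge\gamma^*$, return $p$. * **Insert($p$).** Compare $p$ with every $p'\in\mathcal D$; if $\langle p,p'\rangle\ge\alpha$, add $p'$ to $\mathcal B(p)$ and $p$ to $\mathcal B(p')$. * **Delete($p$).** Remove $p$ from $\mathcal B(p')$ for every $p'\in\mathcal B(p)$, and discard $\mathcal B(p)$. The data structure is built by inserting the points of $\mathcal D$ one after the other. **Theorem (Complexities for succeeding in one iteration).** There is a sequence $\varepsilon_0(d)>0$ with $\varepsilon_0(d)\to0$, depending only on $\gamma^*$ and $n(\cdot)$, such that for every sequence $\varepsilon(d)\to0$ with $\varepsilon(d)\ge\varepsilon_0(d)$ for all large $d$ the following holds for $$\alpha=\Big[\sqrt{\tfrac{(\gamma^*)^2}{1+(\gamma^*)^2}}-\varepsilon(d)\Big]\cdot\mu .$$ With probability tending to $1$ as $d\to\infty$, over the data set and the random starting point, and uniformly in $p^*$, $q$ and the position of $p^*$ in the insertion order, all of the following hold simultaneously: 1. the data structure holds the $\alpha$-near neighbor graph of $\mathcal D$, and a single tour of Query($q$) returns $p^*$, in time $n^{\frac{1}{1+(\gamma^*)^2}+o(1)}$;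 2. the data structure takes space $n^{\frac{2+(\gamma^*)^2}{1+(\gamma^*)^2}+o(1)}$; 3. for every $p\in\mathcal S^{d-1}$, Insert($p$) yields the $\alpha$-near neighbor graph of $\mathcal D$ with $p$ added, in time $n^{1+o(1)}$; 4. for every $p\in\mathcal D$, Delete($p$) yields the $\alpha$-near neighbor graph of $\mathcal D$ with $p$ removed, in time $n^{\frac{1}{1+(\gamma^*)^2}+o(1)}$. Here a cost being $n^{e+o(1)}$ includes both bounds: for each $\delta>0$, for all $d$ that are large enough, the listed properties hold with all costs between $n^{e-\delta}$ and $n^{e+\delta}$, with probability at least $1-\delta$. -/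

import Mathlib

open MeasureTheory Filter Topology Asymptotics

noncomputable section

namespace NNG

/-! ## Counting elementary steps -/

/-- A computation together with the number of elementary operations it performs.
The machine is a real RAM: one arithmetic operation or comparison on reals or indices, one array
access, and following one pointer cost one step each. -/
structure Timed (β : Type) where
  val : β
  cost : ℕ

instance : Monad Timed where
  pure b := ⟨b, 0⟩
  bind m f := ⟨(f m.val).val, m.cost + (f m.val).cost⟩

/-- Spend `k` elementary operations. -/
def tick (k : ℕ) : Timed Unit := ⟨(), k⟩

/-! ## Geometry -/

/-- `ℝ^d` with the Euclidean norm. -/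
abbrev Vec (d : ℕ) := EuclideanSpace ℝ (Fin d)

/-- The Euclidean unit sphere in `ℝ^d`. -/
abbrev Sph (d : ℕ) := Metric.sphere (0 : Vec d) 1

/-- The uniform distribution on the unit sphere: normalised surface measure. -/
def sphereUniform (d : ℕ) : Measure (Sph d) :=
  ((volume : Measure (Vec d)).toSphere Set.univ)⁻¹ • (volume : Measure (Vec d)).toSphere

/-- The `α`-near neighbor graph of a family of points: distinct members are adjacent iff their
inner product is at least `α`. -/
def nearGraph {V : Type} {d : ℕ} (α : ℝ) (x : V → Vec d) : SimpleGraph V where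
  Adj i j := i ≠ j ∧ α ≤ inner ℝ (x i) (x j)
  symm := ⟨fun i j h => ⟨h.1.symm, by rw [real_inner_comm]; exact h.2⟩⟩
  loopless := ⟨fun _ h => h.1 rfl⟩

/-- The inner product, computed coordinate by coordinate with one multiplication and one addition
for each coordinate. -/
def dot {d : ℕ} (u v : Vec d) : Timed ℝ :=
  (List.finRange d).foldlM (fun s i => do tick 2; pure (s + u i * v i)) 0

/-! ## Search trees holding sets of natural numbers -/

/-- A binary search tree for natural number keys. The key `k` is stored at the node that is
reached from the root by reading the binary digits of `k`, least significant first
(digit `0` is left, digit `1` is right). -/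
inductive Tree
  | nil
  | node (key : Option ℕ) (left right : Tree)

namespace Tree

def key : Tree → Option ℕ
  | nil => none
  | node o _ _ => o

def left : Tree → Tree
  | nil => nil
  | node _ l _ => l

def right : Tree → Tree
  | nil => nil
  | node _ _ r => r

/-- Store `k` at the end of the given path, one step per node on the path. -/
def insertAt (k : ℕ) : List Bool → Tree → Timed Tree
  | [], t => do
      tick 1
      pure (node (some k) t.left t.right)
  | false :: bs, t => do
      tick 1
      let l ← insertAt k bs t.left
      pure (node t.key l t.right)
  | true :: bs, t => do
      tick 1
      let r ← insertAt k bs t.right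
      pure (node t.key t.left r)

/-- Assemble a node, dropping it if it holds no key and has no children. -/
def prune : Option ℕ → Tree → Tree → Tree
  | none, nil, nil => nil
  | o, l, r => node o l r

/-- Remove the key at the end of the given path, and the nodes that become useless. -/
def eraseAt : List Bool → Tree → Timed Tree
  | _, nil => do
      tick 1
      pure nil
  | [], node _ l r => do
      tick 1
      pure (prune none l r)
  | false :: bs, node o l r => do
      tick 1
      let l' ← eraseAt bs l
      pure (prune o l' r)
  | true :: bs, node o l r => do
      tick 1
      let r' ← eraseAt bs r
      pure (prune o l r')

def insert (k : ℕ) (t : Tree) : Timed Tree := insertAt k k.bits t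

def erase (k : ℕ) (t : Tree) : Timed Tree := eraseAt k.bits t

/-- Traverse the tree, putting all its keys in front of the list `acc`. -/
def collect : Tree → List ℕ → Timed (List ℕ)
  | nil, acc => do
      tick 1
      pure acc
  | node o l r, acc => do
      tick 1
      let acc₁ ← collect r acc
      let acc₂ ← collect l acc₁
      pure (o.elim acc₂ (· :: acc₂))

/-- The keys stored in the tree. -/
def keys (t : Tree) : List ℕ := (t.collect []).val

/-- Memory cells taken by the tree: a key and two pointers for each node. -/
def cells : Tree → ℕ
  | nil => 0
  | node _ l r => 3 + l.cells + r.cells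

end Tree

/-! ## The data structure and its updates -/

/-- The data structure. A data point is referred to by its index. `ids` holds the indices of
the points of the current data set, `pt i` is the point with index `i`, `bkt i` is its bucket
(the indices of its neighbors), and `next` is the index for the next point to be inserted. -/
structure Index (d : ℕ) where
  next : ℕ
  ids : Tree
  pt : ℕ → Vec d
  bkt : ℕ → Tree

namespace Index

variable {d : ℕ}

/-- The data structure for the empty data set. -/
def empty (d : ℕ) : Index d := ⟨0, .nil, fun _ => 0, fun _ => .nil⟩

/-- Insertion of the point `p`: compare `p` with every point of the data set, and for each one with
inner product at least `α` add the two points to each other's buckets. -/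
def insert (α : ℝ) (p : Vec d) (S : Index d) : Timed (Index d) := do
  let i := S.next
  tick (d + 2)
  let D ← S.ids.collect []
  let B ← D.foldlM (fun (B : ℕ → Tree) j => do
      let s ← dot p (S.pt j)
      tick 1
      if α ≤ s then
        let bi ← (B i).insert j
        let bj ← (B j).insert i
        tick 2
        pure (Function.update (Function.update B i bi) j bj)
      else
        pure B) (Function.update S.bkt i .nil)
  let ids ← S.ids.insert i
  pure ⟨i + 1, ids, Function.update S.pt i p, B⟩

/-- Deletion of the point with index `i`: remove it from the buckets of all its neighbors, then
drop its own bucket and the point itself. -/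
def delete (i : ℕ) (S : Index d) : Timed (Index d) := do
  let N ← (S.bkt i).collect []
  let B ← N.foldlM (fun (B : ℕ → Tree) j => do
      let bj ← (B j).erase i
      tick 1
      pure (Function.update B j bj)) S.bkt
  let ids ← S.ids.erase i
  tick 1
  pure ⟨S.next, ids, S.pt, Function.update B i .nil⟩

/-- The data structure for the points `x 0, …, x (n - 1)`, obtained by inserting them in turn. -/
def build (α : ℝ) {n : ℕ} (x : Fin n → Vec d) : Index d :=
  (List.ofFn x).foldl (fun S p => (insert α p S).val) (empty d)

/-- The space taken by the data structure, in memory cells (a cell holds a real number, an index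
or a pointer): for each point its `d` coordinates, the root of its bucket, and the nodes of the
bucket; in addition the tree of indices with its root, and `next`. -/
def space (S : Index d) : ℕ :=
  2 + S.ids.cells + (S.ids.keys.map fun i => d + 1 + (S.bkt i).cells).sum

/-- `S` stores the `α`-near neighbor graph of the data set consisting of the points
`x i`, `i ∈ s`. -/
structure Stores (S : Index d) (α : ℝ) (s : Finset ℕ) (x : ℕ → Vec d) : Prop where
  ids : ∀ i, i ∈ S.ids.keys ↔ i ∈ s
  pt : ∀ i ∈ s, S.pt i = x i
  bkt : ∀ i ∈ s, ∀ j, j ∈ (S.bkt i).keys ↔ j ∈ s ∧ (nearGraph α x).Adj i j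

/-! ## Queries -/

/-- The current estimate during a query: its index, its inner product with the query, and the
flag telling whether the estimate has been improved. -/
structure Cursor where
  id : ℕ
  ip : ℝ
  progress : Bool

/-- Body of the inner loop: move to `j` if this improves the inner product with `q` by at least
`1 / d` over the current estimate. -/
def inspect (S : Index d) (q : Vec d) (c : Cursor) (j : ℕ) : Timed Cursor := do
  let s ← dot (S.pt j) q
  tick 2
  if c.ip + 1 / (d : ℝ) ≤ s then pure ⟨j, s, true⟩ else pure c

/-- One pass of the outer loop: go through the whole bucket of the point with index `i`, where `s`
is the inner product of that point with `q`. -/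
def sweep (S : Index d) (q : Vec d) (i : ℕ) (s : ℝ) : Timed Cursor := do
  let N ← (S.bkt i).collect []
  N.foldlM (inspect S q) ⟨i, s, false⟩

/-- `Walk S q γ i s out k`: the greedy walk for the query `q` with target inner product `γ`, from
the point with index `i` and inner product `s` with `q`, terminates after `k` elementary
operations. The result `out` is `some j` if the walk returns the point with index `j`, and `none` if
it gets stuck, that is, at the moment when the query algorithm would have to start over. -/
inductive Walk (S : Index d) (q : Vec d) (γ : ℝ) : ℕ → ℝ → Option ℕ → ℕ → Prop
  | found {i : ℕ} {s : ℝ} (h : γ ≤ s) : Walk S q γ i s (some i) 1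
  | stuck {i : ℕ} {s : ℝ} (h : s < γ) (hp : (sweep S q i s).val.progress = false) :
      Walk S q γ i s none (2 + (sweep S q i s).cost)
  | move {i : ℕ} {s : ℝ} {out : Option ℕ} {k : ℕ} (h : s < γ)
      (hp : (sweep S q i s).val.progress = true)
      (hw : Walk S q γ (sweep S q i s).val.id (sweep S q i s).val.ip out k) :
      Walk S q γ i s out (2 + (sweep S q i s).cost + k)

/-- A single tour of the query algorithm, started at the (randomly drawn) point with index `i`:
draw the point, compute its inner product with `q`, and walk. No restart takes place. -/
def Tour (S : Index d) (q : Vec d) (γ : ℝ) (i : ℕ) (out : Option ℕ) (k : ℕ) : Prop :=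
  ∃ k', Walk S q γ i (dot (S.pt i) q).val out k' ∧ k = 1 + (dot (S.pt i) q).cost + k'

end Index

/-! ## Random instances -/

/-- Random data set of `n` points on the sphere and random starting index: the point with index
`iStar` is the planted point `pStar`, all others are uniform on the sphere, the starting
index is uniform, and everything is independent. -/
def instanceMeasure (d n : ℕ) (iStar : Fin n) (pStar : Sph d) :
    Measure ((Fin n → Sph d) × Fin n) :=
  (Measure.pi fun i => if i = iStar then Measure.dirac pStar else sphereUniform d).prod
    (ProbabilityTheory.uniformOn Set.univ)

/-- The points of a data set as an array indexed by `ℕ`, with zero entries from `n` on. -/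
def toArray {d n : ℕ} (x : Fin n → Sph d) (i : ℕ) : Vec d :=
  if h : i < n then (x ⟨i, h⟩ : Vec d) else 0

/-- The typical largest inner product `μ = √(1 - n^(-2/d))` of a query with `n` uniform points. -/
def mu (d n : ℕ) : ℝ := √(1 - (n : ℝ) ^ (-2 / (d : ℝ)))

/-- `k` is `n ^ e` up to a factor `n ^ δ` in either direction. -/
def IsPow (n : ℕ) (e δ : ℝ) (k : ℕ) : Prop :=
  (n : ℝ) ^ (e - δ) ≤ k ∧ (k : ℝ) ≤ (n : ℝ) ^ (e + δ)

/-- The outcome wanted for the data set `x`, start `i₀`, planted index `iStar`, query `q`, target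
inner product `γ` and graph parameter `α`, with exponents up to `δ`. -/
structure Good {d n : ℕ} (α γ δ : ℝ) (q : Sph d) (iStar : Fin n)
    (x : Fin n → Sph d) (i₀ : Fin n) (S : Index d) : Prop where
  /-- The data structure holds the `α`-near neighbor graph of the data. -/
  stores : S.Stores α (Finset.range n) (toArray x)
  /-- A single tour from `i₀` returns the planted point, within the claimed query time. -/
  query : ∃ k, S.Tour (q : Vec d) γ i₀ (some iStar) k ∧ IsPow n (1 / (1 + γ ^ 2)) δ k
  /-- Space. -/
  space : IsPow n ((2 + γ ^ 2) / (1 + γ ^ 2)) δ S.space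
  /-- Insertion of an arbitrary further point. -/
  insert : ∀ y : Sph d,
    (S.insert α (y : Vec d)).val.Stores α (Finset.range (n + 1))
      (Function.update (toArray x) n (y : Vec d)) ∧
    IsPow n 1 δ (S.insert α (y : Vec d)).cost
  /-- Deletion of an arbitrary point of the data set. -/
  delete : ∀ i : Fin n,
    (S.delete i).val.Stores α ((Finset.range n).erase i) (toArray x) ∧
    IsPow n (1 / (1 + γ ^ 2)) δ (S.delete i).cost

end NNG

end

/-! Put L = log n, a₀ = γ/√(1+γ²) and σ = 1/√(1+γ²), so that a₀² + σ² = 1 and γσ = a₀. A cap of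
height √ρ·μ has measure n^(-ρ+o(1)), and two caps of heights aμ and bμ with nearly orthogonal
centres share measure at least n^(-(a²+b²)-o(1)). For α = (a₀-ε)μ, Chernoff bounds and a union bound
put all degrees at n^(1-a₀²+o(1)) = n^(1/(1+γ²)+o(1)) (`measure_exists_deg`). Indices have at most d
binary digits, so a tree path takes at most d+1 steps, and every cost is a degree, or n, or n times
a degree, up to a factor d^O(1) = n^o(1).

A tour typically needs at most two passes. Since log n = o(d), only the planted point has inner
product at least γ/2 with q. Put τ = σμ; the start satisfies |⟨x,q⟩| < τ. The caps of height α about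
the start and τ + 1/d about q share measure at least n^(-(1-a₀ε))/4, where the gain a₀ε comes from
the slack in α; hence the start has a neighbor beyond τ (`le_step_measure`, `measure_no_step`).
Unless the planted point is met at once, the first pass thus ends at some v with ⟨v,q⟩ > τ. The
component of v along q contributes at least γτ = a₀μ to ⟨v,p*⟩. The orthogonal component has no
preferred direction around q, so it is unlikely to contribute less than -εμ, as d(εμ)² ≥ ε²L → ∞.
Hence ⟨v,p*⟩ ≥ α (`measure_stopPoint_le`), and the second pass finds p*.

The delicate point is that v depends on the whole data set through a greedy pass. With the planted
point ignored, v (`firstStop`) is a function of inner products among the ordinary points and q; so a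
rotation of these points about q carries v along and preserves their law. This needs the order of a
pass to depend only on the set of keys (`Tree.Holds.keys_eq`). Averaging over rotations then
replaces conditioning (`measure_le_of_forall_direction`).

The deterministic half is collected in `good_of`, the probabilistic half in
`instanceMeasure_not_good_le`. -/

noncomputable section

namespace NNG

/-! ### Values and costs of timed computations. -/

namespace Timed

@[simp] theorem val_bind {β γ : Type} (m : Timed β) (f : β → Timed γ) :
    (m >>= f).val = (f m.val).val := rfl

@[simp] theorem cost_bind {β γ : Type} (m : Timed β) (f : β → Timed γ) :
    (m >>= f).cost = m.cost + (f m.val).cost := rfl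

@[simp] theorem val_pure {β : Type} (b : β) : (pure b : Timed β).val = b := rfl

@[simp] theorem cost_pure {β : Type} (b : β) : (pure b : Timed β).cost = 0 := rfl

@[simp] theorem cost_tick (k : ℕ) : (tick k).cost = k := rfl

theorem val_foldlM {β γ : Type} (f : β → γ → Timed β) (l : List γ) (b : β) :
    (l.foldlM f b).val = l.foldl (fun b a => (f b a).val) b := by
  induction l generalizing b with
  | nil => rfl
  | cons a l ih => simp [List.foldlM_cons, ih]

theorem cost_foldlM_le {β γ : Type} (f : β → γ → Timed β) (l : List γ) (C : ℕ)
    (h : ∀ b, ∀ a ∈ l, (f b a).cost ≤ C) (b : β) : (l.foldlM f b).cost ≤ l.length * C := by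
  induction l generalizing b with
  | nil => simp
  | cons a l ih =>
    have h1 := h b a (by simp)
    have h2 := ih (fun b a ha => h b a (by simp [ha])) (f b a).val
    simp only [List.foldlM_cons, cost_bind, List.length_cons, Nat.succ_mul]
    omega

theorem le_cost_foldlM {β γ : Type} (f : β → γ → Timed β) (l : List γ) (C : ℕ)
    (h : ∀ b, ∀ a ∈ l, C ≤ (f b a).cost) (b : β) : l.length * C ≤ (l.foldlM f b).cost := by
  induction l generalizing b with
  | nil => simp
  | cons a l ih =>
    have h1 := h b a (by simp)
    have h2 := ih (fun b a ha => h b a (by simp [ha])) (f b a).val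
    simp only [List.foldlM_cons, cost_bind, List.length_cons, Nat.succ_mul]
    omega

end Timed

open Timed

theorem dot_val {d : ℕ} (u v : Vec d) : (dot u v).val = inner ℝ u v := by
  have key : ∀ (l : List (Fin d)) (s : ℝ),
      l.foldl (fun s i => s + u i * v i) s = s + (l.map fun i => u i * v i).sum := by
    intro l
    induction l with
    | nil => simp
    | cons a l ih => intro s; simp [ih, add_assoc]
  rw [dot, val_foldlM]
  simp only [val_bind, val_pure]
  rw [key, zero_add, ← List.ofFn_eq_map, List.sum_ofFn, PiLp.inner_apply]
  simp [mul_comm]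

theorem dot_cost {d : ℕ} (u v : Vec d) : (dot u v).cost = 2 * d := by
  have h1 : (dot u v).cost ≤ (List.finRange d).length * 2 :=
    cost_foldlM_le _ _ 2 (fun b a _ => by simp) 0
  have h2 : (List.finRange d).length * 2 ≤ (dot u v).cost :=
    le_cost_foldlM _ _ 2 (fun b a _ => by simp) 0
  simp only [List.length_finRange] at h1 h2
  omega

/-! ### Search trees: contents, size, cost, and the order of their keys. -/

namespace Tree

/-- The key stored at the end of a path. -/
def get : List Bool → Tree → Option ℕ
  | [], t => t.key
  | false :: bs, t => get bs t.left
  | true :: bs, t => get bs t.right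

def height : Tree → ℕ
  | nil => 0
  | node _ l r => max l.height r.height + 1

/-- Every leaf holds a key. -/
def Tight : Tree → Prop
  | nil => True
  | node o l r => (o ≠ none ∨ l ≠ nil ∨ r ≠ nil) ∧ l.Tight ∧ r.Tight

/-- All bit strings of length less than the given bound, in lexicographic order. -/
def paths : ℕ → List (List Bool)
  | 0 => []
  | D + 1 => [] :: ((paths D).map (false :: ·) ++ (paths D).map (true :: ·))

@[simp] theorem get_nil (bs : List Bool) : get bs nil = none := by
  induction bs with
  | nil => rfl
  | cons b bs ih => cases b <;> exact ih

theorem collect_val (t : Tree) (acc : List ℕ) : (t.collect acc).val = t.keys ++ acc := by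
  have key : ∀ (t : Tree) (acc : List ℕ), (t.collect acc).val = (t.collect []).val ++ acc := by
    intro t
    induction t with
    | nil => intro acc; rfl
    | node o l r hl hr =>
      intro acc
      simp only [collect, val_bind, val_pure]
      rw [hl, hr acc, hl (r.collect []).val]
      cases o <;> simp
  exact key t acc

theorem keys_node (o : Option ℕ) (l r : Tree) :
    (node o l r).keys = o.toList ++ (l.keys ++ r.keys) := by
  rw [keys, collect]
  simp only [val_bind, val_pure, collect_val]
  cases o <;> simp

@[simp] theorem keys_nil : nil.keys = [] := rfl

/-- A preorder traversal visits the nodes in lexicographic order of their paths. So `keys` is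
determined by `get` alone, not by the shape of the tree. -/
theorem keys_eq_filterMap {D : ℕ} {t : Tree} (h : t.height ≤ D) :
    t.keys = (paths D).filterMap (get · t) := by
  induction D generalizing t with
  | zero => cases t with
    | nil => simp
    | node o l r => simp [height] at h
  | succ D ih => cases t with
    | nil => simp
    | node o l r =>
      simp only [height, Nat.add_le_add_iff_right, max_le_iff] at h
      rw [keys_node, ih h.1, ih h.2, paths, List.filterMap_cons, List.filterMap_append,
        List.filterMap_map, List.filterMap_map]
      cases o <;> rfl

/-- A binary tree with k nodes has k + 1 empty subtrees; each node and each empty subtree costs one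
step, and each node takes three cells. -/
theorem collect_cost (t : Tree) (acc : List ℕ) : 3 * (t.collect acc).cost = 2 * t.cells + 3 := by
  induction t generalizing acc with
  | nil => rfl
  | node o l r hl hr =>
    have h1 := hr acc
    have h2 := hl (r.collect acc).val
    simp only [collect, cost_bind, cost_tick, cost_pure, cells]
    omega

theorem keys_length_pos {t : Tree} (ht : t.Tight) (h : t ≠ nil) : 0 < t.keys.length := by
  induction t with
  | nil => exact absurd rfl h
  | node o l r hl hr =>
    rw [keys_node, List.length_append, List.length_append]
    rcases ht with ⟨h1 | h1 | h1, h2, h3⟩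
    · cases o <;> simp at h1 ⊢
    · have := hl h2 h1; omega
    · have := hr h3 h1; omega

/-- In a tight tree every node lies on the path to some key, so there are at most `height` nodes per
key. -/
theorem cells_le {t : Tree} (ht : t.Tight) : t.cells ≤ 3 * (t.keys.length * t.height) := by
  induction t with
  | nil => simp [cells]
  | node o l r hl hr =>
    have hne : 0 < (node o l r).keys.length := keys_length_pos ht (by simp)
    obtain ⟨-, h2, h3⟩ := ht
    have h4 := hl h2
    have h5 := hr h3
    rw [keys_node, List.length_append, List.length_append] at hne ⊢
    simp only [cells, height]
    have h6 : l.keys.length * l.height ≤ l.keys.length * max l.height r.height :=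
      Nat.mul_le_mul_left _ (le_max_left _ _)
    have h7 : r.keys.length * r.height ≤ r.keys.length * max l.height r.height :=
      Nat.mul_le_mul_left _ (le_max_right _ _)
    have h8 : 0 ≤ o.toList.length * max l.height r.height := Nat.zero_le _
    nlinarith

theorem le_cells (t : Tree) : 3 * t.keys.length ≤ t.cells := by
  induction t with
  | nil => simp
  | node o l r hl hr =>
    rw [keys_node, List.length_append, List.length_append]
    have : o.toList.length ≤ 1 := by cases o <;> simp
    simp only [cells]
    omega

theorem insertAt_cost (k : ℕ) (bs : List Bool) (t : Tree) :
    (insertAt k bs t).cost = bs.length + 1 := by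
  induction bs generalizing t with
  | nil => rfl
  | cons b bs ih =>
    cases b <;> simp [insertAt, ih] <;> omega

theorem eraseAt_cost_le (bs : List Bool) (t : Tree) : (eraseAt bs t).cost ≤ bs.length + 1 := by
  induction bs generalizing t with
  | nil => cases t <;> simp [eraseAt]
  | cons b bs ih =>
    cases t with
    | nil => cases b <;> simp [eraseAt]
    | node o l r =>
      have h1 := ih l
      have h2 := ih r
      cases b <;> simp [eraseAt] <;> omega

theorem get_insertAt (k : ℕ) (bs bs' : List Bool) (t : Tree) :
    get bs' (insertAt k bs t).val = if bs' = bs then some k else get bs' t := by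
  induction bs generalizing t bs' with
  | nil =>
    cases bs' with
    | nil => rfl
    | cons b bs' => cases b <;> rfl
  | cons b bs ih =>
    cases b <;> cases bs' with
    | nil => rfl
    | cons b' bs' => cases b' <;> simp [insertAt, get, left, right, ih]

theorem get_prune (o : Option ℕ) (l r : Tree) (bs : List Bool) :
    get bs (prune o l r) = get bs (node o l r) := by
  cases o with
  | some _ => rfl
  | none => cases l with
    | node _ _ _ => rfl
    | nil => cases r with
      | node _ _ _ => rfl
      | nil => cases bs with
        | nil => rfl
        | cons b bs => cases b <;> rfl

theorem get_eraseAt (bs bs' : List Bool) (t : Tree) :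
    get bs' (eraseAt bs t).val = if bs' = bs then none else get bs' t := by
  induction bs generalizing t bs' with
  | nil =>
    cases t with
    | nil => simp [eraseAt]
    | node o l r =>
      simp only [eraseAt, val_bind, val_pure, get_prune]
      cases bs' with
      | nil => rfl
      | cons b bs' => cases b <;> rfl
  | cons b bs ih =>
    cases t with
    | nil => cases b <;> simp [eraseAt]
    | node o l r =>
      cases b <;> simp only [eraseAt, val_bind, val_pure, get_prune] <;> cases bs' with
      | nil => rfl
      | cons b' bs' => cases b' <;> simp [get, left, right, ih]

theorem height_insertAt_le (k : ℕ) (bs : List Bool) (t : Tree) :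
    (insertAt k bs t).val.height ≤ max t.height (bs.length + 1) := by
  induction bs generalizing t with
  | nil => cases t <;> simp [insertAt, height, left, right]
  | cons b bs ih =>
    have h0 : t.left.height ≤ t.height - 1 ∧ t.right.height ≤ t.height - 1 := by
      cases t <;> simp [height, left, right]
    have h1 := ih t.left
    have h2 := ih t.right
    cases b <;> simp only [insertAt, height, val_bind, val_pure, List.length_cons] <;> omega

theorem insertAt_ne_nil (k : ℕ) (bs : List Bool) (t : Tree) : (insertAt k bs t).val ≠ nil := by
  cases bs with
  | nil => simp [insertAt]
  | cons b bs => cases b <;> simp [insertAt]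

theorem Tight.left {t : Tree} (h : t.Tight) : t.left.Tight := by
  cases t with
  | nil => trivial
  | node o l r => exact h.2.1

theorem Tight.right {t : Tree} (h : t.Tight) : t.right.Tight := by
  cases t with
  | nil => trivial
  | node o l r => exact h.2.2

theorem tight_insertAt (k : ℕ) (bs : List Bool) {t : Tree} (h : t.Tight) :
    (insertAt k bs t).val.Tight := by
  induction bs generalizing t with
  | nil => exact ⟨Or.inl (by simp), h.left, h.right⟩
  | cons b bs ih =>
    cases b
    · exact ⟨Or.inr (Or.inl (insertAt_ne_nil _ _ _)), ih h.left, h.right⟩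
    · exact ⟨Or.inr (Or.inr (insertAt_ne_nil _ _ _)), h.left, ih h.right⟩

/-- Keys can be recovered from their paths, so distinct keys never compete for a node. -/
theorem bits_injective : Function.Injective Nat.bits := by
  have : Function.LeftInverse (fun l : List Bool => l.foldr Nat.bit 0) Nat.bits := by
    intro k
    induction k using Nat.binaryRec' with
    | zero => rfl
    | bit b k hb ih => simp only [Nat.bits_append_bit k b hb, List.foldr_cons, ih]
  exact this.injective

open Classical in
/-- The number with the given binary digits, if there is one. -/
def code (bs : List Bool) : Option ℕ :=
  if h : ∃ k : ℕ, k.bits = bs then some h.choose else none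

theorem code_eq_some {bs : List Bool} {k : ℕ} : code bs = some k ↔ k.bits = bs := by
  unfold code
  split_ifs with h
  · rw [Option.some_inj]
    constructor
    · rintro rfl; exact h.choose_spec
    · rintro rfl; exact bits_injective h.choose_spec
  · simp only [false_iff]
    exact fun hk => h ⟨k, hk⟩

/-- The order in which keys appear in search trees of height at most `D`. -/
def order (D : ℕ) : List ℕ := (paths D).filterMap code

theorem mem_paths {D : ℕ} {bs : List Bool} : bs ∈ paths D ↔ bs.length < D := by
  induction D generalizing bs with
  | zero => simp [paths]
  | succ D ih =>
    cases bs with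
    | nil => simp [paths]
    | cons b bs => cases b <;> simp [paths, ih]

theorem nodup_paths (D : ℕ) : (paths D).Nodup := by
  induction D with
  | zero => simp [paths]
  | succ D ih =>
    rw [paths, List.nodup_cons, List.nodup_append]
    refine ⟨by simp, ih.map (List.cons_injective), ih.map (List.cons_injective), ?_⟩
    intro a ha b hb
    simp only [List.mem_map] at ha hb
    obtain ⟨x, -, rfl⟩ := ha
    obtain ⟨y, -, rfl⟩ := hb
    simp

theorem nodup_order (D : ℕ) : (order D).Nodup := by
  refine (nodup_paths D).filterMap ?_
  intro a a' b hb hb'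
  rw [Option.mem_def, code_eq_some] at hb hb'
  rw [← hb, ← hb']

/-- `t` is a search tree of height at most `D` for the set of keys satisfying `P`. -/
structure Holds (D : ℕ) (t : Tree) (P : ℕ → Prop) : Prop where
  height : t.height ≤ D
  get : ∀ bs k, get bs t = some k ↔ k.bits = bs ∧ P k

-- The order of traversal is a fixed order on ℕ restricted to the stored keys, whatever the history
-- of updates. This makes a greedy pass a function of the data set.
open Classical in
theorem Holds.keys_eq {D : ℕ} {t : Tree} {P : ℕ → Prop} (h : t.Holds D P) :
    t.keys = (order D).filter (fun k => P k) := by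
  rw [keys_eq_filterMap h.height, order, List.filter_filterMap]
  congr 1
  funext bs
  ext k
  rw [h.get, Option.filter_eq_some_iff, code_eq_some]
  simp

theorem Holds.mem_keys {D : ℕ} {t : Tree} {P : ℕ → Prop} (h : t.Holds D P) (k : ℕ) :
    k ∈ t.keys ↔ P k := by
  classical
  rw [keys_eq_filterMap h.height, List.mem_filterMap]
  constructor
  · rintro ⟨bs, -, hb⟩
    exact ((h.get _ _).1 hb).2
  · intro hk
    have h1 : Tree.get k.bits t = some k := (h.get _ _).2 ⟨rfl, hk⟩
    refine ⟨k.bits, ?_, h1⟩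
    -- A path at which a key is stored is shorter than the height.
    have key : ∀ (bs : List Bool) (t : Tree), bs.length < t.height ∨ Tree.get bs t = none := by
      intro bs
      induction bs with
      | nil => intro t; cases t <;> simp [Tree.height]
      | cons b bs ih =>
        intro t
        cases t with
        | nil => simp
        | node o l r =>
          cases b
          · rcases ih l with h | h
            · left; simp only [Tree.height, List.length_cons]; omega
            · right; exact h
          · rcases ih r with h | h
            · left; simp only [Tree.height, List.length_cons]; omega
            · right; exact h
    rw [mem_paths]
    rcases key k.bits t with h2 | h2
    · exact h2.trans_le h.height
    · rw [h1] at h2; cases h2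

theorem Holds.nodup {D : ℕ} {t : Tree} {P : ℕ → Prop} (h : t.Holds D P) : t.keys.Nodup := by
  classical
  rw [h.keys_eq]
  exact (nodup_order D).filter _

theorem Holds.length_keys {D : ℕ} {t : Tree} {P : ℕ → Prop} (h : t.Holds D P) {s : Finset ℕ}
    (hs : ∀ k, P k ↔ k ∈ s) : t.keys.length = s.card := by
  rw [← List.toFinset_card_of_nodup h.nodup]
  congr 1
  ext k
  rw [List.mem_toFinset, h.mem_keys, hs]

theorem holds_nil (D : ℕ) {P : ℕ → Prop} (h : ∀ k, ¬ P k) : nil.Holds D P :=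
  ⟨Nat.zero_le _, fun bs k => by simp [h]⟩

theorem Holds.congr {D : ℕ} {t : Tree} {P Q : ℕ → Prop} (h : t.Holds D P) (hPQ : ∀ k, Q k ↔ P k) :
    t.Holds D Q :=
  ⟨h.height, fun bs k => by rw [h.get, hPQ]⟩

theorem Holds.insert {D : ℕ} {t : Tree} {P : ℕ → Prop} (h : t.Holds D P) {k : ℕ}
    (hk : k.bits.length < D) : (t.insert k).val.Holds D (fun j => j = k ∨ P j) := by
  refine ⟨(height_insertAt_le _ _ _).trans (max_le h.height hk), fun bs j => ?_⟩
  rw [Tree.insert, get_insertAt]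
  split_ifs with hb
  · rw [Option.some_inj, hb]
    constructor
    · rintro rfl; exact ⟨rfl, Or.inl rfl⟩
    · rintro ⟨h1, -⟩; exact (bits_injective h1).symm
  · rw [h.get]
    constructor
    · rintro ⟨h1, h2⟩; exact ⟨h1, Or.inr h2⟩
    · rintro ⟨h1, rfl | h2⟩
      · exact absurd h1.symm hb
      · exact ⟨h1, h2⟩

theorem height_eraseAt_le (bs : List Bool) (t : Tree) :
    (eraseAt bs t).val.height ≤ t.height := by
  have hp : ∀ (o : Option ℕ) (l r : Tree), (prune o l r).height ≤ (node o l r).height := by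
    intro o l r
    cases o <;> cases l <;> cases r <;> simp [prune, height]
  induction bs generalizing t with
  | nil => cases t with
    | nil => simp [eraseAt]
    | node o l r => exact hp none l r
  | cons b bs ih =>
    cases t with
    | nil => cases b <;> simp [eraseAt]
    | node o l r =>
      cases b
      · refine (hp o (eraseAt bs l).val r).trans ?_
        have := ih l
        simp only [height]; omega
      · refine (hp o l (eraseAt bs r).val).trans ?_
        have := ih r
        simp only [height]; omega

theorem Holds.erase {D : ℕ} {t : Tree} {P : ℕ → Prop} (h : t.Holds D P) (k : ℕ) :
    (t.erase k).val.Holds D (fun j => j ≠ k ∧ P j) := by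
  refine ⟨(height_eraseAt_le _ _).trans h.height, fun bs j => ?_⟩
  rw [Tree.erase, get_eraseAt]
  split_ifs with hb
  · simp only [false_iff]
    rintro ⟨h1, h2, -⟩
    exact h2 (bits_injective (h1.trans hb))
  · rw [h.get]
    constructor
    · rintro ⟨h1, h2⟩; exact ⟨h1, fun h3 => hb (by rw [← h1, h3]), h2⟩
    · rintro ⟨h1, -, h2⟩; exact ⟨h1, h2⟩

end Tree
end NNG

/-! ### Correctness and cost of building, insertion and deletion. -/

namespace NNG
open Timed

namespace Index

variable {d : ℕ}

/-- `S` is a well-formed data structure for the points `X 0, …, X (m - 1)` whose search trees have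
height at most `D`. -/
structure Valid (S : Index d) (α : ℝ) (D m : ℕ) (X : ℕ → Vec d) : Prop where
  next : S.next = m
  ids : S.ids.Holds D (· < m)
  ids_tight : S.ids.Tight
  pt : ∀ i < m, S.pt i = X i
  bkt : ∀ i < m, (S.bkt i).Holds D (fun j => j < m ∧ i ≠ j ∧ α ≤ inner ℝ (X i) (X j))
  bkt_tight : ∀ i < m, (S.bkt i).Tight

theorem Valid.congr {S : Index d} {α : ℝ} {D m : ℕ} {X Y : ℕ → Vec d} (h : S.Valid α D m X)
    (hXY : ∀ i < m, Y i = X i) : S.Valid α D m Y where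
  next := h.next
  ids := h.ids
  ids_tight := h.ids_tight
  pt i hi := by rw [h.pt i hi, hXY i hi]
  bkt i hi := (h.bkt i hi).congr fun j => by
    refine and_congr_right fun hj => ?_
    rw [hXY i hi, hXY j hj]
  bkt_tight := h.bkt_tight

theorem Valid.stores {S : Index d} {α : ℝ} {D m : ℕ} {X : ℕ → Vec d} (h : S.Valid α D m X) :
    S.Stores α (Finset.range m) X where
  ids i := by rw [h.ids.mem_keys, Finset.mem_range]
  pt i hi := h.pt i (Finset.mem_range.1 hi)
  bkt i hi j := by rw [(h.bkt i (Finset.mem_range.1 hi)).mem_keys, Finset.mem_range]; rfl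

theorem valid_empty (d : ℕ) (α : ℝ) (D : ℕ) (X : ℕ → Vec d) : (empty d).Valid α D 0 X where
  next := rfl
  ids := Tree.holds_nil _ (by simp)
  ids_tight := trivial
  pt i hi := absurd hi (Nat.not_lt_zero _)
  bkt i hi := absurd hi (Nat.not_lt_zero _)
  bkt_tight i hi := absurd hi (Nat.not_lt_zero _)

/-- The new buckets after comparing the point `p` with index `i` with the point with index `j`. -/
def link (α : ℝ) (p : Vec d) (pt : ℕ → Vec d) (i : ℕ) (B : ℕ → Tree) (j : ℕ) : ℕ → Tree :=
  if α ≤ inner ℝ p (pt j) then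
    Function.update (Function.update B i ((B i).insert j).val) j ((B j).insert i).val
  else B

/-- The initial contents `P` are arbitrary so that the induction on the list closes. The new index
`m` does not occur in `l`, so each step changes two different buckets. -/
theorem holds_foldl_link (α : ℝ) (p : Vec d) (pt : ℕ → Vec d) {D m : ℕ}
    (hm : ∀ k ≤ m, k.bits.length < D) (l : List ℕ) (hl : ∀ j ∈ l, j < m)
    (B : ℕ → Tree) (P : ℕ → ℕ → Prop) (hB : ∀ k ≤ m, (B k).Holds D (P k))
    (hT : ∀ k ≤ m, (B k).Tight) (k : ℕ) (hk : k ≤ m) :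
    (l.foldl (link α p pt m) B k).Holds D (fun j => P k j ∨
      (k = m ∧ j ∈ l ∧ α ≤ inner ℝ p (pt j)) ∨ (j = m ∧ k ∈ l ∧ α ≤ inner ℝ p (pt k))) ∧
    (l.foldl (link α p pt m) B k).Tight := by
  induction l generalizing B P with
  | nil => exact ⟨(hB k hk).congr (by simp), hT k hk⟩
  | cons a l ih =>
    have ha : a < m := hl a (by simp)
    have hl' : ∀ j ∈ l, j < m := fun j hj => hl j (by simp [hj])
    rw [List.foldl_cons]
    by_cases hc : α ≤ inner ℝ p (pt a)
    · have hstep : ∀ k ≤ m, (link α p pt m B a k).Holds D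
          (fun j => P k j ∨ (k = m ∧ j = a) ∨ (j = m ∧ k = a)) ∧ (link α p pt m B a k).Tight := by
        intro k hk
        rw [link, if_pos hc]
        by_cases hka : k = a
        · subst hka
          rw [Function.update_self]
          refine ⟨((hB k hk).insert (hm m le_rfl)).congr fun j => ?_, Tree.tight_insertAt _ _ (hT k hk)⟩
          simp only [ha.ne, false_and, and_true, false_or]
          exact or_comm
        · rw [Function.update_of_ne hka]
          by_cases hkm : k = m
          · subst hkm
            rw [Function.update_self]
            refine ⟨((hB k hk).insert (hm a ha.le)).congr fun j => ?_, Tree.tight_insertAt _ _ (hT k hk)⟩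
            simp only [hka, true_and, and_false, or_false]
            exact or_comm
          · rw [Function.update_of_ne hkm]
            exact ⟨(hB k hk).congr (by simp [hka, hkm]), hT k hk⟩
      obtain ⟨h1, h2⟩ := ih hl' (link α p pt m B a) _ (fun k hk => (hstep k hk).1)
        (fun k hk => (hstep k hk).2)
      refine ⟨h1.congr fun j => ?_, h2⟩
      simp only [List.mem_cons]
      constructor
      · rintro (h | ⟨h, rfl | h', h''⟩ | ⟨h, rfl | h', h''⟩) <;> tauto
      · rintro ((h | ⟨h, rfl⟩ | ⟨h, rfl⟩) | h | h) <;> tauto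
    · have : link α p pt m B a = B := by rw [link, if_neg hc]
      rw [this]
      obtain ⟨h1, h2⟩ := ih hl' B P hB hT
      refine ⟨h1.congr fun j => ?_, h2⟩
      simp only [List.mem_cons]
      constructor
      · rintro (h | ⟨h, rfl | h', h''⟩ | ⟨h, rfl | h', h''⟩) <;> tauto
      · rintro (h | h | h) <;> tauto

theorem insert_val (α : ℝ) (p : Vec d) (S : Index d) :
    (S.insert α p).val = ⟨S.next + 1, (S.ids.insert S.next).val, Function.update S.pt S.next p,
      S.ids.keys.foldl (link α p S.pt S.next) (Function.update S.bkt S.next .nil)⟩ := by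
  rw [insert]
  simp only [val_bind, val_pure, val_foldlM]
  congr 1
  change (S.ids.keys).foldl _ _ = _
  congr 1
  funext B j
  rw [dot_val, link]
  split_ifs <;> rfl

theorem Valid.insert {S : Index d} {α : ℝ} {D m : ℕ} {X Y : ℕ → Vec d} (h : S.Valid α D m X)
    {p : Vec d} (hY : ∀ i < m, Y i = X i) (hp : Y m = p) (hm : ∀ k ≤ m, k.bits.length < D) :
    (S.insert α p).val.Valid α D (m + 1) Y := by
  have hB := holds_foldl_link α p S.pt hm S.ids.keys (fun j hj => (h.ids.mem_keys j).1 hj)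
    (Function.update S.bkt m .nil) (fun i j => i < m ∧ j < m ∧ i ≠ j ∧ α ≤ inner ℝ (X i) (X j))
    (fun k hk => by
      rcases hk.eq_or_lt with rfl | hk
      · rw [Function.update_self]; exact Tree.holds_nil _ (by simp)
      · rw [Function.update_of_ne hk.ne]
        exact (h.bkt k hk).congr (by simp [hk]))
    (fun k hk => by
      rcases hk.eq_or_lt with rfl | hk
      · rw [Function.update_self]; trivial
      · rw [Function.update_of_ne hk.ne]; exact h.bkt_tight k hk)
  rw [insert_val, h.next]
  refine ⟨rfl, ?_, Tree.tight_insertAt _ _ h.ids_tight, ?_, ?_, ?_⟩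
  · exact (h.ids.insert (hm m le_rfl)).congr fun j => by omega
  · intro i hi
    rcases (Nat.lt_succ_iff.1 hi).eq_or_lt with rfl | hi
    · simp [hp]
    · simp [Function.update_of_ne hi.ne, hY i hi, h.pt i hi]
  · intro i hi
    refine (hB i (Nat.lt_succ_iff.1 hi)).1.congr fun j => ?_
    simp only [h.ids.mem_keys]
    rcases (Nat.lt_succ_iff.1 hi).eq_or_lt with rfl | hi
    · constructor
      · rintro ⟨h1, h2, h3⟩
        have hj : j < i := by omega
        refine Or.inr (Or.inl ⟨rfl, hj, ?_⟩)
        rwa [h.pt j hj, ← hY j hj, ← hp]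
      · rintro (⟨h1, -⟩ | ⟨-, h1, h2⟩ | ⟨-, h1, -⟩)
        · omega
        · refine ⟨by omega, by omega, ?_⟩
          rwa [h.pt j h1, ← hY j h1, ← hp] at h2
        · omega
    · constructor
      · rintro ⟨h1, h2, h3⟩
        rcases (Nat.lt_succ_iff.1 h1).eq_or_lt with rfl | hj
        · refine Or.inr (Or.inr ⟨rfl, hi, ?_⟩)
          rwa [h.pt i hi, ← hY i hi, ← hp, real_inner_comm]
        · refine Or.inl ⟨hi, hj, h2, ?_⟩
          rwa [← hY i hi, ← hY j hj]
      · rintro (⟨-, h1, h2, h3⟩ | ⟨h1, -⟩ | ⟨rfl, -, h1⟩)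
        · refine ⟨by omega, h2, ?_⟩
          rwa [hY i hi, hY j h1]
        · omega
        · refine ⟨by omega, by omega, ?_⟩
          rwa [h.pt i hi, ← hY i hi, ← hp, real_inner_comm] at h1
  · exact fun i hi => (hB i (Nat.lt_succ_iff.1 hi)).2

/-- Induction on the last point, since `build` folds from the left. Only indices below `n` are ever
inserted, which is why their digits bound the depth of all trees. -/
theorem valid_build (α : ℝ) {D n : ℕ} (x : Fin n → Sph d) (hn : ∀ k < n, k.bits.length < D) :
    (build α (fun i => (x i : Vec d))).Valid α D n (toArray x) := by
  have key : ∀ l : List (Vec d), (∀ k < l.length, k.bits.length < D) →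
      (l.foldl (fun S p => (insert α p S).val) (empty d)).Valid α D l.length
        (fun i => l.getD i 0) := by
    intro l
    induction l using List.reverseRecOn with
    | nil => exact fun _ => valid_empty _ _ _ _
    | append_singleton l a ih =>
      intro hl
      rw [List.foldl_append, List.length_append]
      simp only [List.length_append, List.length_singleton] at hl
      refine (ih fun k hk => hl k (by omega)).insert ?_ ?_ fun k hk => hl k (by omega)
      · intro i hi
        simp only [List.getD_eq_getElem?_getD]
        rw [List.getElem?_append_left hi]
      · simp
  have h := key (List.ofFn fun i => (x i : Vec d)) (by simpa using hn)
  rw [List.length_ofFn] at h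
  refine h.congr fun i hi => ?_
  simp [toArray, hi, List.getD_eq_getElem?_getD]

open Classical in
/-- The number of neighbors of the point with index `i`. -/
def deg (α : ℝ) (m : ℕ) (X : ℕ → Vec d) (i : ℕ) : ℕ :=
  ((Finset.range m).filter fun j => i ≠ j ∧ α ≤ inner ℝ (X i) (X j)).card

theorem Valid.length_keys {S : Index d} {α : ℝ} {D m : ℕ} {X : ℕ → Vec d} (h : S.Valid α D m X)
    {i : ℕ} (hi : i < m) : (S.bkt i).keys.length = deg α m X i :=
  (h.bkt i hi).length_keys (by simp)

theorem _root_.NNG.Tree.Holds.cells_le {D : ℕ} {t : Tree} {P : ℕ → Prop} (h : t.Holds D P)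
    (ht : t.Tight) : t.cells ≤ 3 * (t.keys.length * D) :=
  (Tree.cells_le ht).trans (Nat.mul_le_mul_left _ (Nat.mul_le_mul_left _ h.height))

theorem _root_.NNG.Tree.Holds.collect_cost_le {D : ℕ} {t : Tree} {P : ℕ → Prop} (h : t.Holds D P)
    (ht : t.Tight) : (t.collect []).cost ≤ 2 * (t.keys.length * D) + 1 := by
  have h1 := t.collect_cost []
  have h2 := h.cells_le ht
  omega

theorem Valid.insert_cost {S : Index d} {α : ℝ} {m : ℕ} {X : ℕ → Vec d}
    (h : S.Valid α (d + 1) m X) (hm : ∀ k ≤ m, k.bits.length ≤ d) (hd : 0 < d) (hm0 : 0 < m)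
    (p : Vec d) : m ≤ (S.insert α p).cost ∧ (S.insert α p).cost ≤ 100 * (d * m) := by
  have h0 : S.ids.keys.length = m := by
    rw [h.ids.length_keys (s := Finset.range m) (by simp), Finset.card_range]
  have h1 := h.ids.collect_cost_le h.ids_tight
  rw [h0] at h1
  rw [Index.insert]
  simp only [cost_bind, cost_tick, cost_pure, show (S.ids.collect []).val = S.ids.keys from rfl]
  have h2 := cost_foldlM_le (fun (B : ℕ → Tree) j => do
      let s ← dot p (S.pt j)
      tick 1
      if α ≤ s then
        let bi ← (B S.next).insert j
        let bj ← (B j).insert S.next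
        tick 2
        pure (Function.update (Function.update B S.next bi) j bj)
      else
        pure B) S.ids.keys (4 * d + 5) (fun b a ha => by
          have h3 := hm a ((h.ids.mem_keys a).1 ha).le
          have h4 := hm m le_rfl
          simp only [cost_bind, dot_cost, cost_tick]
          split_ifs
          · simp only [cost_bind, Tree.insert, Tree.insertAt_cost, cost_tick, cost_pure, h.next]
            omega
          · simp only [cost_pure]
            omega) (Function.update S.bkt S.next .nil)
  have h2' := le_cost_foldlM (fun (B : ℕ → Tree) j => do
      let s ← dot p (S.pt j)
      tick 1
      if α ≤ s then
        let bi ← (B S.next).insert j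
        let bj ← (B j).insert S.next
        tick 2
        pure (Function.update (Function.update B S.next bi) j bj)
      else
        pure B) S.ids.keys 1 (fun b a ha => by
          simp only [cost_bind, dot_cost, cost_tick]
          omega) (Function.update S.bkt S.next .nil)
  rw [h0] at h2 h2'
  have h5 : (S.ids.insert S.next).cost ≤ d + 1 := by
    rw [Tree.insert, Tree.insertAt_cost, h.next]
    exact Nat.add_le_add_right (hm m le_rfl) 1
  constructor
  · omega
  · nlinarith [Nat.mul_le_mul hd hm0, Nat.mul_le_mul_left d hm0, Nat.mul_le_mul_right m hd]

/-- The new buckets after the removal of `i` from the bucket of `j`. -/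
def unlink (i : ℕ) (B : ℕ → Tree) (j : ℕ) : ℕ → Tree :=
  Function.update B j ((B j).erase i).val

theorem holds_foldl_unlink (i : ℕ) {D m : ℕ} (l : List ℕ) (B : ℕ → Tree) (P : ℕ → ℕ → Prop)
    (hB : ∀ k < m, (B k).Holds D (P k)) (k : ℕ) (hk : k < m) :
    (l.foldl (unlink i) B k).Holds D (fun j => P k j ∧ ¬ (j = i ∧ k ∈ l)) := by
  induction l generalizing B P with
  | nil => exact (hB k hk).congr (by simp)
  | cons a l ih =>
    rw [List.foldl_cons]
    refine (ih (unlink i B a) (fun k j => P k j ∧ ¬ (j = i ∧ k = a)) ?_).congr fun j => ?_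
    · intro k hk
      by_cases hka : k = a
      · subst hka
        rw [unlink, Function.update_self]
        exact ((hB k hk).erase i).congr fun j => by tauto
      · rw [unlink, Function.update_of_ne hka]
        exact (hB k hk).congr (by simp [hka])
    · simp only [List.mem_cons]
      tauto

theorem Valid.delete_stores {S : Index d} {α : ℝ} {D m : ℕ} {X : ℕ → Vec d} (h : S.Valid α D m X)
    {i : ℕ} (hi : i < m) : (S.delete i).val.Stores α ((Finset.range m).erase i) X := by
  have hv : (S.delete i).val = ⟨S.next, (S.ids.erase i).val, S.pt,
      Function.update ((S.bkt i).keys.foldl (unlink i) S.bkt) i .nil⟩ := by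
    rw [delete]
    simp only [val_bind, val_pure, val_foldlM]
    rfl
  rw [hv]
  refine ⟨fun j => ?_, fun j hj => ?_, fun k hk j => ?_⟩
  · rw [(h.ids.erase i).mem_keys, Finset.mem_erase, Finset.mem_range]
  · exact h.pt j (Finset.mem_range.1 (Finset.mem_of_mem_erase hj))
  · rw [Finset.mem_erase, Finset.mem_range] at hk
    simp only [Function.update_of_ne hk.1]
    rw [(holds_foldl_unlink i _ S.bkt _ h.bkt k hk.2).mem_keys, (h.bkt i hi).mem_keys,
      Finset.mem_erase, Finset.mem_range]
    simp only [nearGraph]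
    constructor
    · rintro ⟨⟨h1, h2, h3⟩, h4⟩
      refine ⟨⟨?_, h1⟩, h2, h3⟩
      rintro rfl
      exact h4 ⟨rfl, hk.2, Ne.symm hk.1, by rwa [real_inner_comm]⟩
    · rintro ⟨⟨h1, h2⟩, h3, h4⟩
      exact ⟨⟨h2, h3, h4⟩, fun h5 => h1 h5.1⟩

theorem Valid.delete_cost {S : Index d} {α : ℝ} {m : ℕ} {X : ℕ → Vec d}
    (h : S.Valid α (d + 1) m X) (hm : ∀ k < m, k.bits.length ≤ d) (hd : 0 < d)
    {i : ℕ} (hi : i < m) :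
    deg α m X i ≤ (S.delete i).cost ∧ (S.delete i).cost ≤ 100 * (d * (deg α m X i + 1)) := by
  have h1 := (h.bkt i hi).collect_cost_le (h.bkt_tight i hi)
  rw [h.length_keys hi] at h1
  have h2 := cost_foldlM_le (fun (B : ℕ → Tree) j => do
      let bj ← (B j).erase i
      tick 1
      pure (Function.update B j bj)) (S.bkt i).keys (d + 2) (fun b a ha => by
        have := (b a).eraseAt_cost_le i.bits
        have := hm i hi
        simp only [cost_bind, cost_tick, cost_pure, Tree.erase]
        omega) S.bkt
  have h3 := le_cost_foldlM (fun (B : ℕ → Tree) j => do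
      let bj ← (B j).erase i
      tick 1
      pure (Function.update B j bj)) (S.bkt i).keys 1 (fun b a ha => by
        simp only [cost_bind, cost_tick, cost_pure]
        omega) S.bkt
  rw [h.length_keys hi] at h2 h3
  have h4 : (S.ids.erase i).cost ≤ d + 1 :=
    (Tree.eraseAt_cost_le _ _).trans (Nat.add_le_add_right (hm i hi) 1)
  rw [delete]
  simp only [cost_bind, cost_tick, cost_pure,
    show ((S.bkt i).collect []).val = (S.bkt i).keys from rfl]
  constructor
  · omega
  · nlinarith [Nat.mul_le_mul_right (deg α m X i) hd]

/-- The buckets dominate: a bucket takes at least three cells per neighbor, and at most 3(d + 1) by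
tightness. -/
theorem Valid.space {S : Index d} {α : ℝ} {m : ℕ} {X : ℕ → Vec d}
    (h : S.Valid α (d + 1) m X) (hd : 0 < d) (hm : 0 < m) {lo hi : ℕ}
    (hlo : ∀ i < m, lo ≤ deg α m X i) (hhi : ∀ i < m, deg α m X i ≤ hi) :
    m * lo ≤ S.space ∧ S.space ≤ 100 * (d * (m * (hi + 1))) := by
  have h0 : S.ids.keys.length = m := by
    rw [h.ids.length_keys (s := Finset.range m) (by simp), Finset.card_range]
  have h1 := h.ids.cells_le h.ids_tight
  rw [h0] at h1
  have h2 : (S.ids.keys.map fun i => d + 1 + (S.bkt i).cells).sum ≤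
      m * (d + 1 + 3 * (hi * (d + 1))) := by
    have := List.sum_le_card_nsmul (S.ids.keys.map fun i => d + 1 + (S.bkt i).cells)
      (d + 1 + 3 * (hi * (d + 1))) (by
        intro c hc
        obtain ⟨i, hi', rfl⟩ := List.mem_map.1 hc
        have hi'' := (h.ids.mem_keys i).1 hi'
        have h3 := (h.bkt i hi'').cells_le (h.bkt_tight i hi'')
        rw [h.length_keys hi''] at h3
        have h4 := Nat.mul_le_mul_right (d + 1) (hhi i hi'')
        omega)
    simpa [h0] using this
  have h3 : m * lo ≤ (S.ids.keys.map fun i => d + 1 + (S.bkt i).cells).sum := by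
    have := List.card_nsmul_le_sum (S.ids.keys.map fun i => d + 1 + (S.bkt i).cells) lo (by
        intro c hc
        obtain ⟨i, hi', rfl⟩ := List.mem_map.1 hc
        have hi'' := (h.ids.mem_keys i).1 hi'
        have h3 := (S.bkt i).le_cells
        rw [h.length_keys hi''] at h3
        have h4 := hlo i hi''
        omega)
    simpa [h0] using this
  rw [Index.space]
  refine ⟨by omega, ?_⟩
  have h4 : 1 ≤ d * m := Nat.mul_le_mul hd hm
  have h5 : m ≤ d * m := Nat.le_mul_of_pos_left m hd
  have h6 : m * hi ≤ d * (m * hi) := Nat.le_mul_of_pos_left _ hd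
  nlinarith

end Index
end NNG

/-! ### The greedy walk. -/

namespace NNG
open Timed

namespace Index

variable {d : ℕ}

/-- The better of two points in the sense of the query `q`: move from `c` to `j` if this improves
the inner product with `q` by at least `1 / d`. -/
def climb (q : Vec d) (X : ℕ → Vec d) (c j : ℕ) : ℕ :=
  if inner ℝ (X c) q + 1 / (d : ℝ) ≤ inner ℝ (X j) q then j else c

theorem climb_mono (q : Vec d) (X : ℕ → Vec d) (c j : ℕ) :
    inner ℝ (X c) q ≤ inner ℝ (X (climb q X c j)) q := by
  rw [climb]
  split_ifs with h
  · have : (0 : ℝ) ≤ 1 / d := by positivity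
    linarith
  · exact le_rfl

theorem foldl_climb_mono (q : Vec d) (X : ℕ → Vec d) (l : List ℕ) (c : ℕ) :
    inner ℝ (X c) q ≤ inner ℝ (X (l.foldl (climb q X) c)) q := by
  induction l generalizing c with
  | nil => exact le_rfl
  | cons a l ih => exact (climb_mono q X c a).trans (ih _)

/-- Right after `j` is inspected the bound holds, whether `j` was accepted or refused, and later
moves only increase the inner product. -/
theorem lt_foldl_climb (hd : 0 < d) (q : Vec d) (X : ℕ → Vec d) {l : List ℕ} {j : ℕ} (hj : j ∈ l)
    (c : ℕ) : inner ℝ (X j) q < inner ℝ (X (l.foldl (climb q X) c)) q + 1 / (d : ℝ) := by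
  induction l generalizing c with
  | nil => simp at hj
  | cons a l ih =>
    rcases List.mem_cons.1 hj with rfl | hj
    · refine lt_of_lt_of_le ?_ (add_le_add_left (foldl_climb_mono q X l _) _)
      rw [climb]
      split_ifs with h
      · have : (0 : ℝ) < 1 / d := by positivity
        linarith
      · exact not_le.1 h
    · exact ih hj _

theorem foldl_climb_mem (q : Vec d) (X : ℕ → Vec d) (l : List ℕ) (c : ℕ) :
    l.foldl (climb q X) c = c ∨ l.foldl (climb q X) c ∈ l := by
  induction l generalizing c with
  | nil => exact Or.inl rfl
  | cons a l ih =>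
    rw [List.foldl_cons, List.mem_cons]
    rcases ih (climb q X c a) with h | h
    · rw [h, climb]
      split_ifs
      · exact Or.inr (Or.inl rfl)
      · exact Or.inl rfl
    · exact Or.inr (Or.inr h)

/-- The cursor keeps its inner product in step with its index, and the flag is never reset once set;
so an unset flag means that no move took place. -/
theorem sweep_val {S : Index d} {q : Vec d} {X : ℕ → Vec d} {i : ℕ}
    (h : ∀ j ∈ (S.bkt i).keys, S.pt j = X j) :
    (S.sweep q i (inner ℝ (X i) q)).val.id = (S.bkt i).keys.foldl (climb q X) i ∧
    (S.sweep q i (inner ℝ (X i) q)).val.ip =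
      inner ℝ (X ((S.bkt i).keys.foldl (climb q X) i)) q ∧
    ((S.sweep q i (inner ℝ (X i) q)).val.progress = false →
      (S.bkt i).keys.foldl (climb q X) i = i) := by
  have key : ∀ (l : List ℕ), (∀ j ∈ l, S.pt j = X j) → ∀ (c : ℕ) (b : Bool),
      (l.foldl (fun c j => (inspect S q c j).val) ⟨c, inner ℝ (X c) q, b⟩).id =
        l.foldl (climb q X) c ∧
      (l.foldl (fun c j => (inspect S q c j).val) ⟨c, inner ℝ (X c) q, b⟩).ip =
        inner ℝ (X (l.foldl (climb q X) c)) q ∧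
      ((l.foldl (fun c j => (inspect S q c j).val) ⟨c, inner ℝ (X c) q, b⟩).progress = false →
        b = false ∧ l.foldl (climb q X) c = c) := by
    intro l
    induction l with
    | nil => exact fun _ c b => ⟨rfl, rfl, fun h => ⟨h, rfl⟩⟩
    | cons a l ih =>
      intro hl c b
      have ih := ih fun j hj => hl j (by simp [hj])
      have ha : (inspect S q ⟨c, inner ℝ (X c) q, b⟩ a).val =
          if inner ℝ (X c) q + 1 / (d : ℝ) ≤ inner ℝ (X a) q
          then ⟨a, inner ℝ (X a) q, true⟩ else ⟨c, inner ℝ (X c) q, b⟩ := by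
        rw [inspect]
        simp only [val_bind, dot_val, hl a (by simp)]
        split_ifs <;> rfl
      rw [List.foldl_cons, List.foldl_cons, ha, climb]
      split_ifs with hc
      · refine ⟨(ih a true).1, (ih a true).2.1, fun h => ?_⟩
        cases ((ih a true).2.2 h).1
      · exact ih c b
  rw [sweep]
  simp only [val_bind, val_foldlM]
  have := key (S.bkt i).keys h i false
  exact ⟨this.1, this.2.1, fun h => (this.2.2 h).2⟩

theorem Valid.sweep_cost {S : Index d} {α : ℝ} {m : ℕ} {X : ℕ → Vec d}
    (h : S.Valid α (d + 1) m X) {i : ℕ} (hi : i < m) (q : Vec d) (s : ℝ) :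
    deg α m X i ≤ (S.sweep q i s).cost ∧
      (S.sweep q i s).cost ≤ deg α m X i * (4 * d + 4) + 1 := by
  have h1 := (h.bkt i hi).collect_cost_le (h.bkt_tight i hi)
  rw [h.length_keys hi] at h1
  have h2 := cost_foldlM_le (inspect S q) (S.bkt i).keys (2 * d + 2) (fun b a ha => by
    simp only [inspect, cost_bind, dot_cost, cost_tick]
    split_ifs <;> simp only [cost_pure] <;> omega) ⟨i, s, false⟩
  have h3 := le_cost_foldlM (inspect S q) (S.bkt i).keys 1 (fun b a ha => by
    simp only [inspect, cost_bind, dot_cost, cost_tick]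
    omega) ⟨i, s, false⟩
  rw [h.length_keys hi] at h2 h3
  rw [sweep]
  simp only [cost_bind, show ((S.bkt i).collect []).val = (S.bkt i).keys from rfl]
  constructor
  · omega
  · nlinarith

/-- `j` is a neighbor of `i₀` other than the planted point. -/
def IsOrdinary (α : ℝ) (n iStar i₀ : ℕ) (X : ℕ → Vec d) (j : ℕ) : Prop :=
  (j < n ∧ i₀ ≠ j ∧ α ≤ inner ℝ (X i₀) (X j)) ∧ j ≠ iStar

open Classical in
/-- Where the first pass of the outer loop ends when the planted point is ignored. -/
def firstStop (α : ℝ) (n iStar i₀ : ℕ) (q : Vec d) (X : ℕ → Vec d) : ℕ :=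
  (Tree.order (d + 1)).foldl
    (fun c j => if IsOrdinary α n iStar i₀ X j then climb q X c j else c) i₀

/-- Ignoring the planted point changes nothing when it is not in the bucket, and the bucket is
traversed in the order `Tree.order`. -/
theorem Valid.firstStop_eq {S : Index d} {α : ℝ} {n iStar i₀ : ℕ} {X : ℕ → Vec d}
    (h : S.Valid α (d + 1) n X) (hi₀ : i₀ < n) (hs : iStar ∉ (S.bkt i₀).keys) (q : Vec d) :
    (S.bkt i₀).keys.foldl (climb q X) i₀ = firstStop α n iStar i₀ q X := by
  classical
  rw [(h.bkt i₀ hi₀).mem_keys] at hs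
  rw [(h.bkt i₀ hi₀).keys_eq, List.foldl_filter, firstStop]
  congr 1
  funext c j
  simp only [decide_eq_true_eq, IsOrdinary]
  have : (j < n ∧ i₀ ≠ j ∧ α ≤ inner ℝ (X i₀) (X j)) ↔
      ((j < n ∧ i₀ ≠ j ∧ α ≤ inner ℝ (X i₀) (X j)) ∧ j ≠ iStar) :=
    ⟨fun h => ⟨h, by rintro rfl; exact hs h⟩, fun h => h.1⟩
  simp only [← this]

/-- The pass consults only inner products among ordinary points and with `q`. The second claim holds
because the planted index is always skipped. -/
theorem firstStop_congr {α : ℝ} {n iStar i₀ : ℕ} {q : Vec d} {X Y : ℕ → Vec d}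
    (hi₀ : i₀ ≠ iStar)
    (hXY : ∀ i ≠ iStar, ∀ j ≠ iStar, (inner ℝ (X i) (X j) : ℝ) = inner ℝ (Y i) (Y j))
    (hq : ∀ i ≠ iStar, (inner ℝ (X i) q : ℝ) = inner ℝ (Y i) q) :
    firstStop α n iStar i₀ q X = firstStop α n iStar i₀ q Y ∧
      firstStop α n iStar i₀ q X ≠ iStar := by
  classical
  have key : ∀ (l : List ℕ) (c : ℕ), c ≠ iStar →
      l.foldl (fun c j => if IsOrdinary α n iStar i₀ X j then climb q X c j else c) c =
        l.foldl (fun c j => if IsOrdinary α n iStar i₀ Y j then climb q Y c j else c) c ∧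
      l.foldl (fun c j => if IsOrdinary α n iStar i₀ X j then climb q X c j else c) c ≠ iStar := by
    intro l
    induction l with
    | nil => exact fun c hc => ⟨rfl, hc⟩
    | cons a l ih =>
      intro c hc
      rw [List.foldl_cons, List.foldl_cons]
      by_cases ha : a = iStar
      · have h1 : ∀ Z : ℕ → Vec d, ¬ IsOrdinary α n iStar i₀ Z a := fun Z hZ => hZ.2 ha
        rw [if_neg (h1 X), if_neg (h1 Y)]
        exact ih c hc
      · have h1 : IsOrdinary α n iStar i₀ X a ↔ IsOrdinary α n iStar i₀ Y a := by
          rw [IsOrdinary, IsOrdinary, hXY i₀ hi₀ a ha]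
        have h2 : climb q X c a = climb q Y c a := by
          rw [climb, climb, hq c hc, hq a ha]
        simp only [h1, h2]
        refine ih _ ?_
        rw [climb]
        split_ifs <;> assumption
  exact key _ i₀ hi₀

theorem firstStop_lt {α : ℝ} {n iStar i₀ : ℕ} {q : Vec d} {X : ℕ → Vec d} (hi₀ : i₀ < n) :
    firstStop α n iStar i₀ q X < n := by
  classical
  have key : ∀ (l : List ℕ) (c : ℕ), c < n →
      l.foldl (fun c j => if IsOrdinary α n iStar i₀ X j then climb q X c j else c) c < n := by
    intro l
    induction l with
    | nil => exact fun c hc => hc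
    | cons a l ih =>
      intro c hc
      rw [List.foldl_cons]
      refine ih _ ?_
      split_ifs with h
      · rw [climb]
        split_ifs
        · exact h.1.1
        · exact hc
      · exact hc
  exact key _ i₀ hi₀

/-- A tour of at most two passes: if no point but the planted one is close to the query, the start
has a neighbor of large inner product with the query, and the end of the first pass is adjacent to
the planted point, then the tour returns the planted point. -/
theorem Valid.exists_tour {S : Index d} {α γ τ : ℝ} {n iStar i₀ hi : ℕ} {X : ℕ → Vec d} {q : Vec d}
    (h : S.Valid α (d + 1) n X) (hd : 0 < d) (hs : iStar < n) (hi₀ : i₀ < n) (hne : i₀ ≠ iStar)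
    (hγd : 1 / (d : ℝ) ≤ γ / 2) (hstar : γ ≤ inner ℝ (X iStar) q)
    (hfar : ∀ j < n, j ≠ iStar → inner ℝ (X j) q < γ / 2)
    (hstart : inner ℝ (X i₀) q < τ)
    (hstep : ∃ j < n, j ≠ i₀ ∧ α ≤ inner ℝ (X i₀) (X j) ∧ τ + 1 / (d : ℝ) ≤ inner ℝ (X j) q)
    (hlast : τ ≤ inner ℝ (X (firstStop α n iStar i₀ q X)) q →
      α ≤ inner ℝ (X (firstStop α n iStar i₀ q X)) (X iStar))
    (hdeg : ∀ i < n, deg α n X i ≤ hi) :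
    ∃ k, S.Tour q γ i₀ (some iStar) k ∧ deg α n X i₀ ≤ k ∧ k ≤ 100 * (d * (hi + 1)) := by
  have hd' : (0 : ℝ) < 1 / d := by positivity
  have hmem : ∀ {i}, i < n → ∀ j, j ∈ (S.bkt i).keys ↔
      j < n ∧ i ≠ j ∧ α ≤ inner ℝ (X i) (X j) := fun hi j => (h.bkt _ hi).mem_keys j
  have hpt : ∀ {i}, i < n → ∀ j ∈ (S.bkt i).keys, S.pt j = X j :=
    fun hi j hj => h.pt j ((hmem hi j).1 hj).1
  -- The planted point wins every pass in which it occurs: the final inner product exceeds γ - 1/d ≥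
  -- γ/2, which no other point attains.
  have hreach : ∀ i < n, i ≠ iStar → iStar ∈ (S.bkt i).keys →
      Walk S q γ i (inner ℝ (X i) q) (some iStar)
        (2 + (S.sweep q i (inner ℝ (X i) q)).cost + 1) := by
    intro i hi hie hmem'
    obtain ⟨h1, h2, h3⟩ := sweep_val (q := q) (hpt hi)
    have h4 := lt_foldl_climb hd q X hmem' i
    have h5 : (S.bkt i).keys.foldl (climb q X) i = iStar := by
      by_contra hcon
      rcases foldl_climb_mem q X (S.bkt i).keys i with h6 | h6
      · rw [h6] at h4
        have := hfar i hi hie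
        linarith
      · have := hfar _ ((hmem hi _).1 h6).1 hcon
        linarith
    rw [h5] at h1 h2 h3
    refine Walk.move ?_ ?_ ?_
    · have := hfar i hi hie
      linarith
    · rw [← Bool.not_eq_false]
      exact fun hf => hie (h3 hf).symm
    · rw [h1, h2]
      exact Walk.found hstar
  have hsp := h.pt i₀ hi₀
  have hc := h.sweep_cost hi₀ q (inner ℝ (X i₀) q)
  have hc' := Nat.mul_le_mul_right (4 * d + 4) (hdeg i₀ hi₀)
  -- If the start is adjacent to the planted point, one pass suffices; otherwise the first pass ends
  -- at `firstStop`.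
  by_cases hadj : iStar ∈ (S.bkt i₀).keys
  · refine ⟨_, ⟨2 + (S.sweep q i₀ (inner ℝ (X i₀) q)).cost + 1, ?_, rfl⟩, ?_, ?_⟩
    · rw [dot_val, hsp]
      exact hreach i₀ hi₀ hne hadj
    · omega
    · rw [dot_cost]
      nlinarith
  · obtain ⟨h1, h2, h3⟩ := sweep_val (q := q) (hpt hi₀)
    obtain ⟨j, hjn, hji, hj1, hj2⟩ := hstep
    have h4 := lt_foldl_climb hd q X ((hmem hi₀ j).2 ⟨hjn, hji.symm, hj1⟩) i₀
    rw [h.firstStop_eq hi₀ hadj q] at h1 h2 h3 h4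
    have hvn : firstStop α n iStar i₀ q X < n := firstStop_lt hi₀
    have hvs : firstStop α n iStar i₀ q X ≠ iStar :=
      (firstStop_congr (Y := X) hne (fun _ _ _ _ => rfl) (fun _ _ => rfl)).2
    set v := firstStop α n iStar i₀ q X with hv
    have h5 : τ < inner ℝ (X v) q := by linarith
    have hvadj : iStar ∈ (S.bkt v).keys := (hmem hvn _).2 ⟨hs, hvs, hlast h5.le⟩
    have hcv := h.sweep_cost hvn q (inner ℝ (X v) q)
    have hcv' := Nat.mul_le_mul_right (4 * d + 4) (hdeg v hvn)
    refine ⟨_, ⟨2 + (S.sweep q i₀ (inner ℝ (X i₀) q)).cost +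
      (2 + (S.sweep q v (inner ℝ (X v) q)).cost + 1), ?_, rfl⟩, ?_, ?_⟩
    · rw [dot_val, hsp]
      refine Walk.move ?_ ?_ ?_
      · have := hfar i₀ hi₀ hne
        linarith
      · rw [← Bool.not_eq_false]
        intro hf
        have := h3 hf
        rw [this] at h5
        linarith
      · rw [h1, h2]
        exact hreach v hvn hvs hvadj
    · omega
    · rw [dot_cost]
      nlinarith

end Index

/-! ### Deterministic conditions for a good outcome. -/

theorem toArray_apply {d n : ℕ} (x : Fin n → Sph d) (i : Fin n) :
    toArray x i = (x i : Vec d) := by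
  simp [toArray]

/-- Isolates what has to be shown about the random data; `n < 2 ^ d` bounds all tree heights by d +
1, and `h1` to `h6` convert bounds on degrees into powers of `n`. -/
theorem good_of {d n : ℕ} {α γ τ δ : ℝ} {lo hi : ℕ} {q : Sph d} {iStar i₀ : Fin n}
    {x : Fin n → Sph d} (hd : 0 < d) (hn2 : n < 2 ^ d) (hne : i₀ ≠ iStar)
    (hγd : 1 / (d : ℝ) ≤ γ / 2) (hstar : γ ≤ inner ℝ (x iStar : Vec d) (q : Vec d))
    (hfar : ∀ j ≠ iStar, inner ℝ (x j : Vec d) (q : Vec d) < γ / 2)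
    (hstart : inner ℝ (x i₀ : Vec d) (q : Vec d) < τ)
    (hstep : ∃ j ≠ i₀, α ≤ inner ℝ (x i₀ : Vec d) (x j : Vec d) ∧
      τ + 1 / (d : ℝ) ≤ inner ℝ (x j : Vec d) (q : Vec d))
    (hlast : τ ≤ inner ℝ (toArray x (Index.firstStop α n iStar i₀ q (toArray x))) (q : Vec d) →
      α ≤ inner ℝ (toArray x (Index.firstStop α n iStar i₀ q (toArray x))) (x iStar : Vec d))
    (hlo : ∀ i < n, lo ≤ Index.deg α n (toArray x) i)
    (hhi : ∀ i < n, Index.deg α n (toArray x) i ≤ hi)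
    (h1 : (n : ℝ) ^ (1 / (1 + γ ^ 2) - δ) ≤ lo)
    (h2 : (100 * (d * (hi + 1)) : ℝ) ≤ (n : ℝ) ^ (1 / (1 + γ ^ 2) + δ))
    (h3 : (n : ℝ) ^ ((2 + γ ^ 2) / (1 + γ ^ 2) - δ) ≤ n * lo)
    (h4 : (100 * (d * (n * (hi + 1))) : ℝ) ≤ (n : ℝ) ^ ((2 + γ ^ 2) / (1 + γ ^ 2) + δ))
    (h5 : (n : ℝ) ^ (1 - δ) ≤ n) (h6 : (100 * (d * n) : ℝ) ≤ (n : ℝ) ^ (1 + δ)) :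
    Good α γ δ q iStar x i₀ (Index.build α (fun i => (x i : Vec d))) := by
  have hn0 : 0 < n := i₀.pos
  have hbits : ∀ k ≤ n, k.bits.length ≤ d := fun k hk => by
    rw [Nat.size_eq_bits_len]
    exact Nat.size_le.2 (hk.trans_lt hn2)
  have hv : (Index.build α (fun i => (x i : Vec d))).Valid α (d + 1) n (toArray x) :=
    Index.valid_build α x fun k hk => Nat.lt_succ_of_le (hbits k hk.le)
  set S := Index.build α (fun i => (x i : Vec d))
  refine ⟨hv.stores, ?_, ?_, fun y => ⟨?_, ?_⟩, fun i => ⟨hv.delete_stores i.2, ?_⟩⟩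
  · obtain ⟨k, hk1, hk2, hk3⟩ := hv.exists_tour (γ := γ) (τ := τ) (q := q) hd iStar.2 i₀.2
      (fun h => hne (Fin.ext h)) hγd (by rwa [toArray_apply])
      (fun j hj hjs => by
        have := hfar ⟨j, hj⟩ (fun h => hjs (by rw [← h]))
        rwa [← toArray_apply] at this)
      (by rwa [toArray_apply])
      (by
        obtain ⟨j, hj1, hj2, hj3⟩ := hstep
        refine ⟨j, j.2, fun h => hj1 (Fin.ext h), ?_, ?_⟩
        · rwa [toArray_apply, toArray_apply]
        · rwa [toArray_apply])
      (by rwa [toArray_apply]) hhi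
    refine ⟨k, hk1, h1.trans ?_, le_trans ?_ h2⟩
    · exact_mod_cast (hlo _ i₀.2).trans hk2
    · exact_mod_cast hk3
  · have := hv.space hd hn0 hlo hhi
    exact ⟨h3.trans (by exact_mod_cast this.1), le_trans (by exact_mod_cast this.2) h4⟩
  · refine (hv.insert ?_ ?_ fun k hk => Nat.lt_succ_of_le (hbits k hk)).stores
    · intro i hi
      rw [Function.update_of_ne hi.ne]
    · rw [Function.update_self]
  · have := hv.insert_cost hbits hd hn0 (y : Vec d)
    exact ⟨h5.trans (by exact_mod_cast this.1), le_trans (by exact_mod_cast this.2) h6⟩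
  · have := hv.delete_cost (fun k hk => hbits k hk.le) hd i.2
    refine ⟨h1.trans ?_, le_trans ?_ h2⟩
    · exact_mod_cast (hlo _ i.2).trans this.1
    · have h7 : 100 * (d * (Index.deg α n (toArray x) i + 1)) ≤ 100 * (d * (hi + 1)) := by
        gcongr
        exact hhi _ i.2
      exact_mod_cast this.2.trans h7

end NNG

/-! ### Measures of spherical caps, and rotations. -/

namespace NNG

variable {d : ℕ}

theorem norm_coe_sph (x : Sph d) : ‖(x : Vec d)‖ = 1 := by
  simp

-- `toSphere` is d times the volume of the cone over a set. The factor d cancels, and cap estimates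
-- become volume estimates inside the unit ball.
open scoped Pointwise in
theorem sphereUniform_apply (hd : 0 < d) {s : Set (Sph d)} (hs : MeasurableSet s) :
    sphereUniform d s = volume (Set.Ioo (0 : ℝ) 1 • ((↑) '' s : Set (Vec d))) /
      volume (Metric.ball (0 : Vec d) 1) := by
  have hd' : (d : ENNReal) ≠ 0 := by exact_mod_cast hd.ne'
  rw [sphereUniform, Measure.smul_apply, smul_eq_mul, Measure.toSphere_apply' _ hs,
    Measure.toSphere_apply_univ, finrank_euclideanSpace_fin, ← ENNReal.div_eq_inv_mul,
    ENNReal.mul_div_mul_left _ _ hd' (by simp)]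

theorem isProbabilityMeasure_sphereUniform (hd : 0 < d) :
    IsProbabilityMeasure (sphereUniform d) := by
  have hd' : (d : ENNReal) ≠ 0 := by exact_mod_cast hd.ne'
  refine ⟨?_⟩
  rw [sphereUniform, Measure.smul_apply, smul_eq_mul, ENNReal.inv_mul_cancel]
  · rw [Measure.toSphere_apply_univ, finrank_euclideanSpace_fin]
    exact mul_ne_zero hd' (Metric.measure_ball_pos _ _ one_pos).ne'
  · rw [Measure.toSphere_apply_univ, finrank_euclideanSpace_fin]
    exact ENNReal.mul_ne_top (by simp) measure_ball_lt_top.ne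

theorem volume_ball_eq (hd : 0 < d) (c : Vec d) {r : ℝ} (hr : 0 ≤ r) :
    volume (Metric.ball c r) = ENNReal.ofReal (r ^ d) * volume (Metric.ball (0 : Vec d) 1) := by
  have : Nonempty (Fin d) := ⟨⟨0, hd⟩⟩
  rw [Measure.addHaar_ball _ _ hr, finrank_euclideanSpace_fin]

theorem sqrt_pow_le_exp (d : ℕ) (t : ℝ) : √(1 - t ^ 2) ^ d ≤ Real.exp (-(d * t ^ 2 / 2)) := by
  have h1 : √(1 - t ^ 2) ≤ Real.exp (-(t ^ 2 / 2)) := by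
    refine Real.sqrt_le_iff.2 ⟨(Real.exp_pos _).le, ?_⟩
    rw [← Real.exp_nat_mul]
    have := Real.add_one_le_exp (-(t ^ 2))
    rw [show ((2 : ℕ) : ℝ) * -(t ^ 2 / 2) = -(t ^ 2) by push_cast; ring]
    linarith
  refine (pow_le_pow_left₀ (Real.sqrt_nonneg _) h1 d).trans ?_
  rw [← Real.exp_nat_mul]
  exact Real.exp_le_exp.2 (by linarith [show (d : ℝ) * -(t ^ 2 / 2) = -(d * t ^ 2 / 2) by ring])

theorem measurable_inner_coe (u : Vec d) :
    Measurable fun x : Sph d => (inner ℝ (x : Vec d) u : ℝ) := by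
  fun_prop

open scoped Pointwise in
/-- Upper bound for the measure of a spherical cap. -/
theorem sphereUniform_cap_le (hd : 0 < d) {u : Vec d} (hu : ‖u‖ ≤ 1) {t : ℝ} (ht0 : 0 ≤ t)
    (ht1 : 2 * t ^ 2 ≤ 1) :
    sphereUniform d {x | t ≤ inner ℝ (x : Vec d) u} ≤
      ENNReal.ofReal (Real.exp (-(d * t ^ 2 / 2))) := by
  rw [sphereUniform_apply hd (measurableSet_le measurable_const (measurable_inner_coe u))]
  refine ENNReal.div_le_of_le_mul ?_
  -- The cone over the cap fits into a smaller ball. The required inequality reduces to (1 - r)(1 +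
  -- r - 2t²) > 0, whence the hypothesis 2t² ≤ 1.
  have hsub : Set.Ioo (0 : ℝ) 1 • ((↑) '' {x : Sph d | t ≤ inner ℝ (x : Vec d) u} : Set (Vec d)) ⊆
      Metric.ball (t • u) √(1 - t ^ 2) := by
    rintro _ ⟨r, ⟨hr0, hr1⟩, _, ⟨x, hx, rfl⟩, rfl⟩
    rw [Set.mem_ofPred_eq] at hx
    rw [mem_ball_iff_norm]
    refine Real.lt_sqrt_of_sq_lt ?_
    change ‖r • (x : Vec d) - t • u‖ ^ 2 < _
    rw [norm_sub_sq_real, norm_smul, norm_smul, norm_coe_sph, inner_smul_left, inner_smul_right,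
      mul_one, mul_pow, Real.norm_eq_abs, Real.norm_eq_abs, sq_abs, sq_abs]
    simp only [conj_trivial]
    have h1 : ‖u‖ ^ 2 ≤ 1 := pow_le_one₀ (norm_nonneg _) hu
    have h2 : t ^ 2 * ‖u‖ ^ 2 ≤ t ^ 2 := mul_le_of_le_one_right (sq_nonneg _) h1
    have h3 : r * t * t ≤ r * t * inner ℝ (x : Vec d) u :=
      mul_le_mul_of_nonneg_left hx (mul_nonneg hr0.le ht0)
    nlinarith [mul_pos (sub_pos.2 hr1) (show 0 < r + 1 - 2 * t ^ 2 by linarith)]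
  refine (measure_mono hsub).trans ?_
  rw [volume_ball_eq hd _ (Real.sqrt_nonneg _)]
  gcongr
  exact sqrt_pow_le_exp d t

/-- A centered half ball has at least half of the volume, a far slab has little. -/
theorem volume_half_ball (hd : 0 < d) (c p q : Vec d) {R η : ℝ} (hR0 : 0 ≤ R) (hR1 : R ≤ 1)
    (hp : ‖p‖ = 1) (hq : ‖q‖ = 1) (hη : Real.exp (-(d * η ^ 2 / 2)) ≤ 1 / 8) (hη0 : 0 ≤ η) :
    ENNReal.ofReal (R ^ d / 4) * volume (Metric.ball (0 : Vec d) 1) ≤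
      volume {z : Vec d | ‖z‖ < R ∧ inner ℝ z c ≤ 0 ∧ -η ≤ inner ℝ z p ∧ -η ≤ inner ℝ z q} := by
  set V := volume (Metric.ball (0 : Vec d) 1) with hV
  have hVtop : V ≠ ⊤ := measure_ball_lt_top.ne
  have hslab : ∀ u : Vec d, ‖u‖ = 1 → volume {z : Vec d | ‖z‖ < R ∧ inner ℝ z u < -η} ≤
      ENNReal.ofReal (R ^ d / 8) * V := by
    intro u hu
    have hsub : {z : Vec d | ‖z‖ < R ∧ inner ℝ z u < -η} ⊆
        Metric.ball (-(η • u)) (R * √(1 - η ^ 2)) := by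
      rintro z ⟨hz, hzu⟩
      rw [mem_ball_iff_norm, sub_neg_eq_add]
      have h1 : ‖z + η • u‖ ^ 2 ≤ ‖z‖ ^ 2 - η ^ 2 := by
        rw [norm_add_sq_real, norm_smul, hu, inner_smul_right, mul_one, Real.norm_eq_abs, sq_abs]
        nlinarith
      have h2 : ‖z + η • u‖ ^ 2 < R ^ 2 * (1 - η ^ 2) := by
        have h3 : ‖z‖ ^ 2 < R ^ 2 := pow_lt_pow_left₀ hz (norm_nonneg _) two_ne_zero
        have h4 : R ^ 2 ≤ 1 := pow_le_one₀ hR0 hR1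
        nlinarith [mul_nonneg (sub_nonneg.2 h4) (sq_nonneg η)]
      have h3 := Real.lt_sqrt_of_sq_lt h2
      rwa [Real.sqrt_mul (sq_nonneg R), Real.sqrt_sq hR0] at h3
    refine (measure_mono hsub).trans ?_
    rw [volume_ball_eq hd _ (mul_nonneg hR0 (Real.sqrt_nonneg _))]
    gcongr
    rw [mul_pow, div_eq_mul_one_div]
    exact mul_le_mul_of_nonneg_left ((sqrt_pow_le_exp d η).trans hη) (pow_nonneg hR0 d)
  -- `H` and `-H` cover the ball, so `H` has at least half of its volume; the two slabs remove at
  -- most an eighth each.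
  set H := {z : Vec d | ‖z‖ < R ∧ inner ℝ z c ≤ 0} with hH
  have hneg : volume (-H) = volume H := Measure.measure_neg _ _
  have hball : Metric.ball (0 : Vec d) R ⊆ H ∪ -H := by
    intro z hz
    rw [mem_ball_zero_iff] at hz
    rcases le_total (inner ℝ z c : ℝ) 0 with h | h
    · exact Or.inl ⟨hz, h⟩
    · refine Or.inr ?_
      rw [Set.mem_neg]
      exact ⟨by rwa [norm_neg], by rw [inner_neg_left]; linarith⟩
  have hhalf : ENNReal.ofReal (R ^ d) * V ≤ volume H + volume H := by
    rw [← volume_ball_eq hd 0 hR0]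
    refine (measure_mono hball).trans ((measure_union_le _ _).trans ?_)
    rw [hneg]
  set G := {z : Vec d | ‖z‖ < R ∧ inner ℝ z c ≤ 0 ∧ -η ≤ inner ℝ z p ∧ -η ≤ inner ℝ z q} with hG
  have hHG : H ⊆ G ∪ ({z : Vec d | ‖z‖ < R ∧ inner ℝ z p < -η} ∪
      {z : Vec d | ‖z‖ < R ∧ inner ℝ z q < -η}) := by
    rintro z ⟨h1, h2⟩
    by_cases h3 : -η ≤ (inner ℝ z p : ℝ)
    · by_cases h4 : -η ≤ (inner ℝ z q : ℝ)
      · exact Or.inl ⟨h1, h2, h3, h4⟩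
      · exact Or.inr (Or.inr ⟨h1, not_le.1 h4⟩)
    · exact Or.inr (Or.inl ⟨h1, not_le.1 h3⟩)
  have hsum : volume H ≤ volume G + ENNReal.ofReal (R ^ d / 4) * V := by
    refine (measure_mono hHG).trans ((measure_union_le _ _).trans ?_)
    gcongr
    refine (measure_union_le _ _).trans ((add_le_add (hslab p hp) (hslab q hq)).trans ?_)
    rw [← add_mul, ← ENNReal.ofReal_add (by positivity) (by positivity)]
    exact le_of_eq (by congr 2; ring)
  have hball_top : volume (Metric.ball (0 : Vec d) R) ≠ ⊤ := measure_ball_lt_top.ne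
  have hGtop : volume G ≠ ⊤ := ne_top_of_le_ne_top hball_top
    (measure_mono fun z hz => by rw [mem_ball_zero_iff]; exact hz.1)
  have hHtop : volume H ≠ ⊤ := ne_top_of_le_ne_top hball_top
    (measure_mono fun z hz => by rw [mem_ball_zero_iff]; exact hz.1)
  have hRd : 0 ≤ R ^ d := pow_nonneg hR0 d
  have e1 := ENNReal.toReal_mono (ENNReal.add_ne_top.2 ⟨hHtop, hHtop⟩) hhalf
  have e2 := ENNReal.toReal_mono (ENNReal.add_ne_top.2
    ⟨hGtop, ENNReal.mul_ne_top ENNReal.ofReal_ne_top hVtop⟩) hsum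
  rw [ENNReal.toReal_mul, ENNReal.toReal_ofReal hRd, ENNReal.toReal_add hHtop hHtop] at e1
  rw [ENNReal.toReal_add hGtop (ENNReal.mul_ne_top ENNReal.ofReal_ne_top hVtop),
    ENNReal.toReal_mul, ENNReal.toReal_ofReal (by positivity)] at e2
  rw [← ENNReal.toReal_le_toReal (ENNReal.mul_ne_top ENNReal.ofReal_ne_top hVtop) hGtop,
    ENNReal.toReal_mul, ENNReal.toReal_ofReal (by positivity)]
  linarith

/-- Slabs at distance 3/√d suit `volume_half_ball`, since exp(-9/2) ≤ 1/8. This is the source of the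
losses 3/√d in the cap heights below. -/
theorem exp_neg_slab_le (hd : 0 < d) : Real.exp (-(d * (3 / √d) ^ 2 / 2)) ≤ 1 / 8 := by
  have hd' : (0 : ℝ) < d := by exact_mod_cast hd
  have h1 : (d : ℝ) * (3 / √d) ^ 2 / 2 = 9 / 2 := by
    rw [div_pow, Real.sq_sqrt hd'.le]
    field_simp
    norm_num
  rw [h1, Real.exp_neg, one_div]
  refine inv_anti₀ (by norm_num) ?_
  have h2 : (8 : ℝ) ≤ Real.exp 1 ^ 4 := by
    have := Real.exp_one_gt_d9
    calc (8 : ℝ) ≤ 2 ^ 4 := by norm_num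
      _ ≤ Real.exp 1 ^ 4 := pow_le_pow_left₀ (by norm_num) (by linarith) 4
  rw [← Real.exp_nat_mul] at h2
  exact h2.trans (Real.exp_le_exp.2 (by norm_num))

/-- Lower bound for the measure of the intersection of two spherical caps. -/
theorem le_sphereUniform_caps (hd : 0 < d) {p q c : Vec d} (hp : ‖p‖ = 1) (hq : ‖q‖ = 1)
    (hc : ‖c‖ ≤ 1) {a b : ℝ} (ha : 0 < a) (hb : 0 ≤ b) (hcp : a + 3 / √d ≤ inner ℝ c p)
    (hcq : b + 3 / √d ≤ inner ℝ c q) :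
    ENNReal.ofReal (√(1 - ‖c‖ ^ 2) ^ d / 4) ≤
      sphereUniform d {x | a ≤ inner ℝ (x : Vec d) p ∧ b ≤ inner ℝ (x : Vec d) q} := by
  have hms : MeasurableSet
      {x : Sph d | a ≤ inner ℝ (x : Vec d) p ∧ b ≤ inner ℝ (x : Vec d) q} :=
    (measurableSet_le measurable_const (measurable_inner_coe p)).inter
      (measurableSet_le measurable_const (measurable_inner_coe q))
  rw [sphereUniform_apply hd hms]
  have hV0 : volume (Metric.ball (0 : Vec d) 1) ≠ 0 := (Metric.measure_ball_pos _ _ one_pos).ne'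
  have hVtop : volume (Metric.ball (0 : Vec d) 1) ≠ ⊤ := measure_ball_lt_top.ne
  rw [ENNReal.le_div_iff_mul_le (Or.inl hV0) (Or.inl hVtop)]
  have hc2 : 0 ≤ 1 - ‖c‖ ^ 2 := sub_nonneg.2 (pow_le_one₀ (norm_nonneg _) hc)
  refine (volume_half_ball hd c p q (Real.sqrt_nonneg _)
    (Real.sqrt_le_one.2 (by linarith [sq_nonneg ‖c‖])) hp hq
    (exp_neg_slab_le hd) (by positivity)).trans ?_
  -- Shift the half ball to the centre c. For y = c + z one has ‖y‖² = ‖c‖² + 2⟨z,c⟩ + ‖z‖² < 1, so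
  -- y lies in the ball, and projecting it to the sphere keeps the inner products above a and b.
  -- Positivity of a excludes y = 0.
  rw [← measure_preimage_add (volume : Measure (Vec d)) (-c)
    {z : Vec d | ‖z‖ < √(1 - ‖c‖ ^ 2) ∧ inner ℝ z c ≤ 0 ∧ -(3 / √d) ≤ inner ℝ z p ∧
      -(3 / √d) ≤ inner ℝ z q}]
  refine measure_mono ?_
  rintro y ⟨h1, h2, h3, h4⟩
  set z := -c + y with hz
  have hy : y = c + z := by rw [hz]; abel
  have hyp : a ≤ inner ℝ y p := by rw [hy, inner_add_left]; linarith
  have hyq : b ≤ inner ℝ y q := by rw [hy, inner_add_left]; linarith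
  have hy0 : y ≠ 0 := by
    rintro h
    rw [h, inner_zero_left] at hyp
    linarith
  have hynorm : 0 < ‖y‖ := norm_pos_iff.2 hy0
  have hy1 : ‖y‖ < 1 := by
    have h5 : ‖z‖ ^ 2 < 1 - ‖c‖ ^ 2 := by
      rw [← Real.sq_sqrt hc2]
      exact pow_lt_pow_left₀ h1 (norm_nonneg _) two_ne_zero
    have h6 : ‖y‖ ^ 2 < 1 ^ 2 := by
      rw [hy, norm_add_sq_real, real_inner_comm]
      linarith
    exact lt_of_pow_lt_pow_left₀ 2 zero_le_one h6
  refine ⟨‖y‖, ⟨hynorm, hy1⟩, ‖y‖⁻¹ • y,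
    ⟨⟨‖y‖⁻¹ • y, by simp [norm_smul, hynorm.ne']⟩, ⟨?_, ?_⟩, rfl⟩, ?_⟩
  · change a ≤ inner ℝ (‖y‖⁻¹ • y) p
    rw [real_inner_smul_left, ← div_eq_inv_mul, le_div_iff₀ hynorm]
    exact (mul_le_of_le_one_right ha.le hy1.le).trans hyp
  · change b ≤ inner ℝ (‖y‖⁻¹ • y) q
    rw [real_inner_smul_left, ← div_eq_inv_mul, le_div_iff₀ hynorm]
    exact (mul_le_of_le_one_right hb hy1.le).trans hyq
  · simp [smul_smul, hynorm.ne']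

/-- The action of a linear isometry on the sphere. -/
def rotate (R : Vec d ≃ₗᵢ[ℝ] Vec d) (x : Sph d) : Sph d :=
  ⟨R x, by simp⟩

theorem measurable_rotate (R : Vec d ≃ₗᵢ[ℝ] Vec d) : Measurable (rotate R) :=
  (R.continuous.measurable.comp measurable_subtype_coe).subtype_mk

-- A linear isometry preserves Lebesgue measure and maps the cone over a set to the cone over its
-- image.
open scoped Pointwise in
theorem measurePreserving_rotate (hd : 0 < d) (R : Vec d ≃ₗᵢ[ℝ] Vec d) :
    MeasurePreserving (rotate R) (sphereUniform d) (sphereUniform d) := by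
  refine ⟨measurable_rotate R, ?_⟩
  ext s hs
  rw [Measure.map_apply (measurable_rotate R) hs, sphereUniform_apply hd hs,
    sphereUniform_apply hd (measurable_rotate R hs)]
  congr 1
  rw [← R.measurePreserving.measure_preimage_equiv
    (f := R.toHomeomorph.toMeasurableEquiv) (Set.Ioo (0 : ℝ) 1 • ((↑) '' s : Set (Vec d)))]
  congr 1
  ext y
  simp only [Set.mem_smul, Set.mem_preimage, Set.mem_image]
  constructor
  · rintro ⟨r, hr, _, ⟨x, hx, rfl⟩, rfl⟩
    exact ⟨r, hr, _, ⟨rotate R x, hx, rfl⟩, (R.map_smul r (x : Vec d)).symm⟩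
  · rintro ⟨r, hr, _, ⟨x, hx, rfl⟩, hy⟩
    refine ⟨r, hr, R.symm x, ⟨rotate R.symm x, ?_, rfl⟩, ?_⟩
    · have : rotate R (rotate R.symm x) = x := Subtype.ext (R.apply_symm_apply _)
      rwa [this]
    · exact (R.symm.map_smul r (x : Vec d)).symm.trans
        ((congrArg R.symm hy).trans (R.symm_apply_apply y))

end NNG

namespace NNG

/-! ### Product measures and Chernoff bounds. -/

section Product

open Classical in
/-- The number of coordinates in `T` that lie in `A`. -/
def hits {ι Ω : Type} (T : Finset ι) (A : Set Ω) (x : ι → Ω) : ℕ := (T.filter fun j => x j ∈ A).card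

theorem hits_eq_sum {ι Ω : Type} (T : Finset ι) (A : Set Ω) :
    (fun x => (hits T A x : ℝ)) = ∑ j ∈ T, fun x : ι → Ω => A.indicator (1 : Ω → ℝ) (x j) := by
  classical
  funext x
  rw [Finset.sum_apply, hits, ← Finset.sum_boole]
  exact Finset.sum_congr rfl fun j _ => by simp [Set.indicator_apply]

theorem measurable_hits {ι Ω : Type} [MeasurableSpace Ω] (T : Finset ι) {A : Set Ω} (hA : MeasurableSet A) :
    Measurable fun x : ι → Ω => (hits T A x : ℝ) := by
  rw [hits_eq_sum]
  simp only [Finset.sum_fn]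
  exact Finset.measurable_sum T fun j _ =>
    Measurable.comp (g := A.indicator (1 : Ω → ℝ)) (measurable_one.indicator hA)
      (measurable_pi_apply j)

variable {ι Ω : Type} [Fintype ι] [MeasurableSpace Ω] (μ : ι → Measure Ω)
  [∀ i, IsProbabilityMeasure (μ i)]

/-- Resampling one coordinate independently does not change the law; this is how conditioning on a
coordinate is expressed. -/
theorem measurePreserving_update [DecidableEq ι] (i : ι) :
    MeasurePreserving (fun p : (ι → Ω) × Ω => Function.update p.1 i p.2)
      ((Measure.pi μ).prod (μ i)) (Measure.pi μ) := by
  have hm : Measurable (fun p : (ι → Ω) × Ω => Function.update p.1 i p.2) := by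
    refine measurable_pi_lambda _ fun j => ?_
    by_cases h : j = i
    · subst h
      simpa using measurable_snd
    · simp only [Function.update_of_ne h]
      exact (measurable_pi_apply j).comp measurable_fst
  refine ⟨hm, (Measure.pi_eq fun s hs => ?_).symm⟩
  rw [Measure.map_apply hm (MeasurableSet.univ_pi hs)]
  have h1 : (fun p : (ι → Ω) × Ω => Function.update p.1 i p.2) ⁻¹' Set.univ.pi s =
      (Set.univ.pi (Function.update s i Set.univ)) ×ˢ s i := by
    ext ⟨x, y⟩
    simp only [Set.mem_preimage, Set.mem_pi, Set.mem_univ, true_imp_iff, Set.mem_prod]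
    constructor
    · intro h
      refine ⟨fun j => ?_, by simpa using h i⟩
      by_cases hj : j = i
      · subst hj; simp
      · simpa [Function.update_of_ne hj] using h j
    · rintro ⟨h, h'⟩ j
      by_cases hj : j = i
      · subst hj; simpa using h'
      · simpa [Function.update_of_ne hj] using h j
  rw [h1, Measure.prod_prod, Measure.pi_pi, ← Finset.prod_erase_mul _ _ (Finset.mem_univ i),
    ← Finset.prod_erase_mul (Finset.univ) (fun j => μ j (s j)) (Finset.mem_univ i)]
  simp only [Function.update_self, measure_univ, mul_one]
  congr 1
  refine Finset.prod_congr rfl fun j hj => ?_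
  rw [Function.update_of_ne (Finset.ne_of_mem_erase hj)]

/-- To bound the probability of an event it suffices to bound it conditionally on one coordinate. -/
theorem measure_pi_le_of_forall [DecidableEq ι] (i : ι) {P : (ι → Ω) → Ω → Prop} {c : ENNReal}
    (hP : MeasurableSet {p : (ι → Ω) × Ω | P p.1 p.2})
    (hi : ∀ x y z, P (Function.update x i y) z ↔ P x z)
    (hc : ∀ z, Measure.pi μ {x | P x z} ≤ c) :
    Measure.pi μ {x | P x (x i)} ≤ c := by
  have hA : MeasurableSet {x : ι → Ω | P x (x i)} :=
    (measurable_id.prodMk (measurable_pi_apply i)) hP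
  rw [← (measurePreserving_update μ i).measure_preimage hA.nullMeasurableSet]
  have h1 : (fun p : (ι → Ω) × Ω => Function.update p.1 i p.2) ⁻¹' {x | P x (x i)} =
      {p : (ι → Ω) × Ω | P p.1 p.2} := by
    ext ⟨x, y⟩
    simp only [Set.mem_preimage, Set.mem_ofPred_eq, Function.update_self]
    exact hi x y y
  rw [h1, Measure.prod_apply_symm hP]
  calc _ ≤ ∫⁻ _, c ∂(μ i) := lintegral_mono fun z => hc z
    _ = c := by simp

/-- The count is a sum of independent indicators; the bound 1 + x ≤ exp x applies to each factor. -/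
theorem mgf_hits_le {T : Finset ι} {A : Set Ω} (hA : MeasurableSet A) (t : ℝ) :
    ProbabilityTheory.mgf (fun x => (hits T A x : ℝ)) (Measure.pi μ) t ≤
      Real.exp ((Real.exp t - 1) * ∑ j ∈ T, (μ j).real A) := by
  have hX : Measurable (A.indicator (1 : Ω → ℝ)) := measurable_one.indicator hA
  have hind := ProbabilityTheory.iIndepFun_pi (μ := μ)
    (X := fun _ => A.indicator (1 : Ω → ℝ)) fun i => hX.aemeasurable
  rw [hits_eq_sum, hind.mgf_sum fun i => hX.comp (measurable_pi_apply i), Finset.mul_sum,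
    Real.exp_sum]
  refine Finset.prod_le_prod (fun j _ => ProbabilityTheory.mgf_nonneg) fun j _ => ?_
  have h1 : ProbabilityTheory.mgf (fun x : ι → Ω => A.indicator (1 : Ω → ℝ) (x j))
      (Measure.pi μ) t = 1 + (Real.exp t - 1) * (μ j).real A := by
    have h2 : ∀ y : Ω, Real.exp (t * A.indicator (1 : Ω → ℝ) y) =
        1 + (Real.exp t - 1) * A.indicator (1 : Ω → ℝ) y := by
      intro y
      by_cases hy : y ∈ A <;> simp [hy]
    have h3 : Integrable (A.indicator (1 : Ω → ℝ)) (μ j) :=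
      (integrable_const (1 : ℝ)).indicator hA
    rw [ProbabilityTheory.mgf]
    simp only [h2]
    have h4 := integral_map (μ := Measure.pi μ) (φ := Function.eval j)
      (measurable_pi_apply j).aemeasurable
      (f := fun y => 1 + (Real.exp t - 1) * A.indicator (1 : Ω → ℝ) y)
      (hX.const_mul _ |>.const_add _).aestronglyMeasurable
    rw [(measurePreserving_eval μ j).map_eq] at h4
    refine h4.symm.trans ?_
    rw [integral_add (integrable_const _) (h3.const_mul _), integral_const_mul,
      integral_indicator_one hA]
    simp
  rw [h1, add_comm]
  exact Real.add_one_le_exp _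

theorem integrable_exp_hits (T : Finset ι) {A : Set Ω} (hA : MeasurableSet A) (t : ℝ) :
    Integrable (fun x => Real.exp (t * hits T A x)) (Measure.pi μ) := by
  classical
  refine Integrable.of_bound
    ((measurable_hits T hA).const_mul t).exp.aestronglyMeasurable (Real.exp (|t| * T.card)) ?_
  refine Eventually.of_forall fun x => ?_
  rw [Real.norm_eq_abs, Real.abs_exp]
  refine Real.exp_le_exp.2 ((le_abs_self _).trans ?_)
  rw [abs_mul, Nat.abs_cast]
  refine mul_le_mul_of_nonneg_left ?_ (abs_nonneg t)
  rw [Nat.cast_le, hits]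
  exact Finset.card_filter_le _ _

/-- Chernoff's method at t = 1, where e - 1 ≤ 2. -/
theorem measure_le_hits_le {T : Finset ι} {A : Set Ω} (hA : MeasurableSet A) {r : ℝ}
    (hr : ∀ j ∈ T, (μ j).real A ≤ r) (k : ℝ) :
    Measure.pi μ {x | k ≤ hits T A x} ≤ ENNReal.ofReal (Real.exp (2 * (T.card * r) - k)) := by
  rw [← ofReal_measureReal]
  refine ENNReal.ofReal_le_ofReal ?_
  refine (ProbabilityTheory.measure_ge_le_exp_mul_mgf k zero_le_one
    (integrable_exp_hits μ T hA 1)).trans ?_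
  refine (mul_le_mul_of_nonneg_left (mgf_hits_le μ hA 1) (Real.exp_pos _).le).trans ?_
  rw [← Real.exp_add]
  refine Real.exp_le_exp.2 ?_
  have h1 : ∑ j ∈ T, (μ j).real A ≤ T.card * r := by
    simpa using Finset.sum_le_sum hr
  have h2 : 0 ≤ ∑ j ∈ T, (μ j).real A := Finset.sum_nonneg fun _ _ => measureReal_nonneg
  have h3 := Real.exp_one_lt_d9
  nlinarith

/-- Chernoff's method at t = -1, where 1 - 1/e ≥ 1/2. -/
theorem measure_hits_le_le {T : Finset ι} {A : Set Ω} (hA : MeasurableSet A) {r : ℝ}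
    (hr : ∀ j ∈ T, r ≤ (μ j).real A) (k : ℝ) :
    Measure.pi μ {x | (hits T A x : ℝ) ≤ k} ≤
      ENNReal.ofReal (Real.exp (k - T.card * r / 2)) := by
  rw [← ofReal_measureReal]
  refine ENNReal.ofReal_le_ofReal ?_
  refine (ProbabilityTheory.measure_le_le_exp_mul_mgf k (neg_nonpos.2 zero_le_one)
    (integrable_exp_hits μ T hA (-1))).trans ?_
  refine (mul_le_mul_of_nonneg_left (mgf_hits_le μ hA (-1)) (Real.exp_pos _).le).trans ?_
  rw [← Real.exp_add]
  refine Real.exp_le_exp.2 ?_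
  have h1 : T.card * r ≤ ∑ j ∈ T, (μ j).real A := by
    simpa using Finset.sum_le_sum hr
  have h2 : 0 ≤ ∑ j ∈ T, (μ j).real A := Finset.sum_nonneg fun _ _ => measureReal_nonneg
  have h3 : Real.exp (-1) < 1 / 2 := by
    have := Real.exp_neg_one_lt_d9
    linarith
  nlinarith

end Product

/-! ### Rotational symmetry of the first pass around the query. -/

section Rotation

variable {d n : ℕ}

theorem measurable_toArray (i : ℕ) :
    Measurable fun x : Fin n → Sph d => toArray x i := by
  by_cases h : i < n
  · simp only [toArray, h, dif_pos]
    exact measurable_subtype_coe.comp (measurable_pi_apply _)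
  · simp only [toArray, h, dif_neg, not_false_eq_true]
    exact measurable_const

/-- The running index takes countably many values, so each step of the fold can be checked for one
value at a time. -/
theorem measurable_firstStop (α : ℝ) (iStar i₀ : ℕ) (q : Vec d) :
    Measurable fun x : Fin n → Sph d => Index.firstStop α n iStar i₀ q (toArray x) := by
  classical
  have key : ∀ (l : List ℕ) (c : (Fin n → Sph d) → ℕ), Measurable c →
      Measurable fun x => l.foldl (fun c j => if Index.IsOrdinary α n iStar i₀ (toArray x) j
        then Index.climb q (toArray x) c j else c) (c x) := by
    intro l
    induction l with
    | nil => exact fun c hc => hc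
    | cons a l ih =>
      intro c hc
      simp only [List.foldl_cons]
      refine ih _ ?_
      have hF : Measurable fun p : ℕ × (Fin n → Sph d) =>
          if Index.IsOrdinary α n iStar i₀ (toArray p.2) a
            then Index.climb q (toArray p.2) p.1 a else p.1 := by
        refine measurable_from_prod_countable_right fun k => ?_
        refine Measurable.ite ?_ ?_ measurable_const
        · have hin : MeasurableSet {x : Fin n → Sph d |
              α ≤ inner ℝ (toArray x i₀) (toArray x a)} :=
            measurableSet_le measurable_const
              ((measurable_toArray i₀).inner (measurable_toArray a))
          have : {x : Fin n → Sph d | Index.IsOrdinary α n iStar i₀ (toArray x) a} =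
              {x | (a < n ∧ i₀ ≠ a) ∧ a ≠ iStar} ∩
                {x | α ≤ inner ℝ (toArray x i₀) (toArray x a)} := by
            ext x
            simp only [Index.IsOrdinary, Set.mem_inter_iff, Set.mem_ofPred_eq]
            tauto
          exact this ▸ (MeasurableSet.const _).inter hin
        · simp only [Index.climb]
          exact Measurable.ite (measurableSet_le
            (((measurable_toArray k).inner measurable_const).add_const _)
            ((measurable_toArray a).inner measurable_const)) measurable_const measurable_const
      have h := hF.comp (hc.prodMk measurable_id)
      simpa only [Function.comp_def, id] using h
  simp only [Index.firstStop]
  exact key _ (fun _ => i₀) measurable_const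

/-- The point at which the first pass ends when the planted point is ignored. -/
def stopPoint (α : ℝ) (iStar i₀ : ℕ) (q : Vec d) (x : Fin n → Sph d) : Vec d :=
  toArray x (Index.firstStop α n iStar i₀ q (toArray x))

theorem norm_stopPoint_le (α : ℝ) (iStar i₀ : ℕ) (q : Vec d) (x : Fin n → Sph d) :
    ‖stopPoint α iStar i₀ q x‖ ≤ 1 := by
  simp only [stopPoint, toArray]
  split_ifs
  · exact (norm_coe_sph _).le
  · simp

theorem measurable_stopPoint (α : ℝ) (iStar i₀ : ℕ) (q : Vec d) :
    Measurable (stopPoint (n := n) α iStar i₀ q) := by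
  have hF : Measurable fun p : ℕ × (Fin n → Sph d) => toArray p.2 p.1 :=
    measurable_from_prod_countable_right fun k => measurable_toArray k
  exact hF.comp ((measurable_firstStop α iStar i₀ q).prodMk measurable_id)

/-- Around the axis `q`, the unit vector `p` can be rotated into the half plane of `w`. -/
theorem exists_rotation {p q w : Vec d} (hp : ‖p‖ = 1) (hq : ‖q‖ = 1)
    (hw : w - (inner ℝ w q : ℝ) • q ≠ 0) :
    ∃ R : Vec d ≃ₗᵢ[ℝ] Vec d, R q = q ∧ R p = (inner ℝ p q : ℝ) • q +
      (√(1 - (inner ℝ p q : ℝ) ^ 2) * ‖w - (inner ℝ w q : ℝ) • q‖⁻¹) •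
        (w - (inner ℝ w q : ℝ) • q) := by
  set w' := w - (inner ℝ w q : ℝ) • q with hw'
  set g : ℝ := inner ℝ p q with hg
  set p' := g • q + (√(1 - g ^ 2) * ‖w'‖⁻¹) • w' with hp'
  have hw0 : ‖w'‖ ≠ 0 := norm_ne_zero_iff.2 hw
  have hqq : (inner ℝ q q : ℝ) = 1 := by rw [real_inner_self_eq_norm_sq, hq, one_pow]
  have hwq : (inner ℝ w' q : ℝ) = 0 := by
    rw [hw', inner_sub_left, real_inner_smul_left, hqq, mul_one, sub_self]
  have hg1 : 0 ≤ 1 - g ^ 2 := by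
    have h1 : |g| ≤ 1 := by
      have := abs_real_inner_le_norm p q
      rwa [hp, hq, mul_one] at this
    have := (sq_le_one_iff_abs_le_one g).2 h1
    linarith
  have hp'q : (inner ℝ p' q : ℝ) = g := by
    rw [hp', inner_add_left, real_inner_smul_left, real_inner_smul_left, hqq, hwq]
    ring
  have hp'n : ‖p‖ = ‖p'‖ := by
    rw [hp, eq_comm, ← sq_eq_sq₀ (norm_nonneg _) zero_le_one, hp', norm_add_sq_real,
      real_inner_smul_left, real_inner_smul_right, real_inner_comm, hwq, norm_smul, norm_smul, hq,
      mul_one, mul_zero, mul_zero, mul_zero, add_zero, Real.norm_eq_abs, Real.norm_eq_abs, sq_abs,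
      mul_pow, sq_abs, mul_pow, Real.sq_sqrt hg1]
    field_simp
    ring
  -- The reflection exchanging p and p' does it: the two vectors have equal norms and equal inner
  -- products with q, so q lies in the mirror.
  refine ⟨(ℝ ∙ (p - p'))ᗮ.reflection, ?_, Submodule.reflection_sub hp'n⟩
  refine Submodule.reflection_mem_subspace_eq_self ?_
  rw [Submodule.mem_orthogonal_singleton_iff_inner_right, inner_sub_left, hp'q, sub_self]

/-- The complement consists of two caps of height 1/2, each of measure at most exp(-d/8) ≤ 1/4. -/
theorem half_le_sphereUniform_belt (hd : 0 < d) (hd8 : Real.exp (-(d / 8)) ≤ 1 / 4) {q : Vec d}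
    (hq : ‖q‖ = 1) :
    ENNReal.ofReal (1 / 2) ≤ sphereUniform d {w | |inner ℝ (w : Vec d) q| < 1 / 2} := by
  have := isProbabilityMeasure_sphereUniform hd
  have hcap : ∀ u : Vec d, ‖u‖ = 1 → (sphereUniform d).real {x | 1 / 2 ≤ inner ℝ (x : Vec d) u} ≤
      1 / 4 := by
    intro u hu
    have h1 := sphereUniform_cap_le hd hu.le (t := 1 / 2) (by norm_num) (by norm_num)
    refine (ENNReal.toReal_le_of_le_ofReal (Real.exp_pos _).le h1).trans (le_trans (le_of_eq ?_) hd8)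
    congr 1
    ring
  have hsub : (Set.univ : Set (Sph d)) ⊆ {w | |inner ℝ (w : Vec d) q| < 1 / 2} ∪
      ({x | 1 / 2 ≤ inner ℝ (x : Vec d) q} ∪ {x | 1 / 2 ≤ inner ℝ (x : Vec d) (-q)}) := by
    intro w _
    by_cases h : |(inner ℝ (w : Vec d) q : ℝ)| < 1 / 2
    · exact Or.inl h
    · rcases le_abs.1 (not_lt.1 h) with h | h
      · exact Or.inr (Or.inl h)
      · exact Or.inr (Or.inr (by rw [Set.mem_ofPred_eq, inner_neg_right]; exact h))
  have h1 := (measureReal_mono (μ := sphereUniform d) hsub (measure_ne_top _ _)).trans ((measureReal_union_le _ _).trans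
    (add_le_add_right (measureReal_union_le _ _) _))
  have h2 := hcap q hq
  have h3 := hcap (-q) (by rwa [norm_neg])
  rw [probReal_univ] at h1
  rw [← ofReal_measureReal]
  exact ENNReal.ofReal_le_ofReal (by linarith)

theorem norm_sub_axis_sq {q : Vec d} (hq : ‖q‖ = 1) (u : Vec d) :
    ‖u - (inner ℝ u q : ℝ) • q‖ ^ 2 = ‖u‖ ^ 2 - (inner ℝ u q : ℝ) ^ 2 := by
  rw [norm_sub_sq_real, real_inner_smul_right, norm_smul, hq, mul_one, Real.norm_eq_abs, sq_abs]
  ring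

/-- An event is unlikely if, for most directions `w`, it is at most as likely as a point depending
on the random data only being far from the hyperplane orthogonal to `w`. -/
theorem measure_le_of_forall_direction {X : Type} [MeasurableSpace X] (M : Measure X)
    [IsProbabilityMeasure M] (hd : 0 < d) (hd8 : Real.exp (-(d / 8)) ≤ 1 / 4) {q : Vec d}
    (hq : ‖q‖ = 1) {u : X → Vec d} (hu : Measurable u) (hu1 : ∀ x, ‖u x‖ ≤ 1) {B : Set X} {t : ℝ}
    (ht0 : 0 ≤ t) (ht1 : t ≤ 1)
    (hB : ∀ w : Sph d, |inner ℝ (w : Vec d) q| < 1 / 2 →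
      M B ≤ M {x | t / 2 ≤ inner ℝ (w : Vec d) (u x)}) :
    M B ≤ ENNReal.ofReal (2 * Real.exp (-(d * t ^ 2 / 8))) := by
  have hsU := isProbabilityMeasure_sphereUniform hd
  set C : Set (X × Sph d) := {z | t / 2 ≤ inner ℝ (z.2 : Vec d) (u z.1)} with hC
  have hCm : MeasurableSet C := measurableSet_le measurable_const
    ((measurable_subtype_coe.comp measurable_snd).inner (hu.comp measurable_fst))
  set D : Set (Sph d) := {w | |inner ℝ (w : Vec d) q| < 1 / 2} with hD
  have hDm : MeasurableSet D :=
    measurableSet_lt (measurable_inner_coe q).abs measurable_const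
  have hslice : ∀ x, sphereUniform d (Prod.mk x ⁻¹' C) ≤
      ENNReal.ofReal (Real.exp (-(d * t ^ 2 / 8))) := by
    intro x
    have h2 := sphereUniform_cap_le hd (hu1 x) (t := t / 2) (by linarith) (by nlinarith)
    refine le_trans h2 (le_of_eq ?_)
    congr 3
    ring
  -- Average the hypothesis over w and exchange the integrals: for fixed data the admissible w form
  -- a cap of height t/2.
  have hmain : M B * sphereUniform d D ≤ ENNReal.ofReal (Real.exp (-(d * t ^ 2 / 8))) :=
    calc M B * sphereUniform d D = ∫⁻ _ in D, M B ∂(sphereUniform d) := by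
          rw [setLIntegral_const]
      _ ≤ ∫⁻ w in D, M ((fun x => (x, w)) ⁻¹' C) ∂(sphereUniform d) :=
          setLIntegral_mono' hDm hB
      _ ≤ ∫⁻ w, M ((fun x => (x, w)) ⁻¹' C) ∂(sphereUniform d) :=
          setLIntegral_le_lintegral _ _
      _ = (M.prod (sphereUniform d)) C := (Measure.prod_apply_symm hCm).symm
      _ = ∫⁻ x, sphereUniform d (Prod.mk x ⁻¹' C) ∂M := Measure.prod_apply hCm
      _ ≤ ∫⁻ _, ENNReal.ofReal (Real.exp (-(d * t ^ 2 / 8))) ∂M := lintegral_mono hslice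
      _ = ENNReal.ofReal (Real.exp (-(d * t ^ 2 / 8))) := by simp
  have hhalf := half_le_sphereUniform_belt hd hd8 hq
  calc M B = 2 * (M B * ENNReal.ofReal (1 / 2)) := by
        rw [mul_comm, mul_assoc, ← ENNReal.ofReal_ofNat 2, ← ENNReal.ofReal_mul (by norm_num)]
        norm_num
    _ ≤ 2 * (M B * sphereUniform d D) := by gcongr
    _ ≤ 2 * ENNReal.ofReal (Real.exp (-(d * t ^ 2 / 8))) := by gcongr
    _ = _ := by rw [ENNReal.ofReal_mul (by norm_num), ENNReal.ofReal_ofNat]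

/-- Rotate the ordinary points around `q`, keeping the planted one. -/
def rotateOthers (iStar : Fin n) (R : Vec d ≃ₗᵢ[ℝ] Vec d) (x : Fin n → Sph d) (i : Fin n) : Sph d :=
  if i = iStar then x i else rotate R (x i)

theorem measurePreserving_rotateOthers (hd : 0 < d) (μ : Fin n → Measure (Sph d))
    [∀ i, IsProbabilityMeasure (μ i)] {iStar : Fin n} (hμ : ∀ j ≠ iStar, μ j = sphereUniform d)
    (R : Vec d ≃ₗᵢ[ℝ] Vec d) :
    MeasurePreserving (rotateOthers iStar R) (Measure.pi μ) (Measure.pi μ) := by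
  refine measurePreserving_pi μ μ (f := fun i y => if i = iStar then y else rotate R y) fun j => ?_
  by_cases hj : j = iStar
  · simp only [hj, if_true]
    exact MeasurePreserving.id _
  · simp only [hj, if_false, hμ j hj]
    exact measurePreserving_rotate hd R

/-- The index of the stop depends only on inner products that R preserves, and it is not the planted
index, so the point found there is rotated. -/
theorem stopPoint_rotateOthers (α : ℝ) {iStar i₀ : Fin n} (hne : i₀ ≠ iStar) {q : Vec d}
    {R : Vec d ≃ₗᵢ[ℝ] Vec d} (hR : R q = q) (x : Fin n → Sph d) :
    stopPoint α iStar i₀ q (rotateOthers iStar R x) = R (stopPoint α iStar i₀ q x) := by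
  have hY : ∀ i : ℕ, i ≠ iStar → toArray (rotateOthers iStar R x) i = R (toArray x i) := by
    intro i hi
    simp only [toArray]
    split_ifs with h
    · have h1 : (⟨i, h⟩ : Fin n) ≠ iStar := fun h2 => hi (by rw [← h2])
      simp only [rotateOthers, if_neg h1]
      rfl
    · simp
  have hcong := Index.firstStop_congr (α := α) (n := n) (iStar := iStar) (i₀ := i₀) (q := q)
    (X := toArray (rotateOthers iStar R x)) (Y := toArray x) (fun h => hne (Fin.ext h))
    (fun i hi j hj => by rw [hY i hi, hY j hj, LinearIsometryEquiv.inner_map_map])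
    (fun i hi => by
      rw [hY i hi]
      conv_lhs => rw [← hR]
      rw [LinearIsometryEquiv.inner_map_map])
  rw [stopPoint, hY _ hcong.2, hcong.1, stopPoint]

/-- If `z` is close to `q` but not to the unit vector `p` at a given angle from `q`, in the half
plane of `w`, then `z` is far from the hyperplane through `q` orthogonal to `w`. -/
theorem half_le_inner_of_rotation {p q z w w' : Vec d} (hw' : w' = w - (inner ℝ w q : ℝ) • q)
    (hw : 1 / 2 < ‖w'‖) {α γ τ t : ℝ} (hγ : 0 ≤ γ)
    (hpq : γ ≤ inner ℝ p q) (hτ : 0 ≤ τ) (ht : 0 < t) (htα : t ≤ γ * τ - α)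
    (h1 : τ ≤ inner ℝ z q)
    (h2 : inner ℝ z ((inner ℝ p q : ℝ) • q + (√(1 - (inner ℝ p q : ℝ) ^ 2) * ‖w'‖⁻¹) • w') < α) :
    t / 2 ≤ inner ℝ w (-(z - (inner ℝ z q : ℝ) • q)) := by
  rw [inner_add_right, real_inner_smul_right, real_inner_smul_right] at h2
  set g : ℝ := inner ℝ p q with hg
  set s : ℝ := inner ℝ z q with hs
  have h5 : γ * τ ≤ g * s := mul_le_mul hpq h1 hτ (hγ.trans hpq)
  have h6 : √(1 - g ^ 2) ≤ 1 := Real.sqrt_le_one.2 (by linarith [sq_nonneg g])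
  have h7 : √(1 - g ^ 2) * ‖w'‖⁻¹ * inner ℝ z w' < -t := by linarith
  -- The factor of ⟨z,w'⟩ is at most 2 because ‖w'‖ > 1/2; hence t/2.
  have h8 : (inner ℝ z w' : ℝ) < -(t / 2) := by
    by_contra hcon
    have h9 : ‖w'‖⁻¹ ≤ 2 := by
      rw [inv_le_comm₀ (by linarith) two_pos]
      linarith
    have h10 : √(1 - g ^ 2) * ‖w'‖⁻¹ ≤ 2 := by
      have := mul_le_mul h6 h9 (inv_nonneg.2 (norm_nonneg _)) zero_le_one
      linarith
    have h11 : 0 ≤ √(1 - g ^ 2) * ‖w'‖⁻¹ := by positivity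
    nlinarith
  rw [inner_neg_right, inner_sub_right, real_inner_smul_right]
  rw [hw', inner_sub_right, real_inner_smul_right, ← hs, real_inner_comm] at h8
  linarith

/-- The end of the first pass is likely to be adjacent to the planted point. -/
theorem measure_stopPoint_le (hd : 0 < d) (hd8 : Real.exp (-(d / 8)) ≤ 1 / 4)
    (μ : Fin n → Measure (Sph d)) [∀ i, IsProbabilityMeasure (μ i)] {iStar i₀ : Fin n}
    (hμ : ∀ j ≠ iStar, μ j = sphereUniform d) (hne : i₀ ≠ iStar) {p q : Vec d}
    (hp : ‖p‖ = 1) (hq : ‖q‖ = 1) {α γ τ t : ℝ}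
    (hγ : 0 ≤ γ) (hpq : γ ≤ inner ℝ p q) (hτ : 0 ≤ τ) (ht : 0 < t) (ht1 : t ≤ 1)
    (htα : t ≤ γ * τ - α) :
    Measure.pi μ {x | τ ≤ inner ℝ (stopPoint α iStar i₀ q x) q ∧
      inner ℝ (stopPoint α iStar i₀ q x) p < α} ≤
      ENNReal.ofReal (2 * Real.exp (-(d * t ^ 2 / 8))) := by
  have hvm : Measurable (stopPoint (n := n) α iStar i₀ q) := measurable_stopPoint α iStar i₀ q
  have hvi : ∀ u : Vec d, Measurable fun x : Fin n → Sph d =>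
      (inner ℝ (stopPoint α iStar i₀ q x) u : ℝ) := fun u => hvm.inner measurable_const
  have hBm : MeasurableSet {x : Fin n → Sph d | τ ≤ inner ℝ (stopPoint α iStar i₀ q x) q ∧
      inner ℝ (stopPoint α iStar i₀ q x) p < α} :=
    (measurableSet_le measurable_const (hvi q)).inter (measurableSet_lt (hvi p) measurable_const)
  refine measure_le_of_forall_direction (Measure.pi μ) hd hd8 hq
    (u := fun x => -(stopPoint α iStar i₀ q x - (inner ℝ (stopPoint α iStar i₀ q x) q : ℝ) • q))
    (hvm.sub ((hvi q).smul measurable_const)).neg (fun x => ?_) ht.le ht1 ?_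
  · rw [norm_neg]
    refine le_of_sq_le_sq ?_ zero_le_one
    rw [norm_sub_axis_sq hq, one_pow]
    have := pow_le_one₀ (n := 2) (norm_nonneg _) (norm_stopPoint_le α iStar i₀ q x)
    linarith [sq_nonneg (inner ℝ (stopPoint α iStar i₀ q x) q : ℝ)]
  · intro w hw
    have hw2 : 1 / 2 < ‖(w : Vec d) - (inner ℝ (w : Vec d) q : ℝ) • q‖ := by
      refine lt_of_pow_lt_pow_left₀ 2 (norm_nonneg _) ?_
      rw [norm_sub_axis_sq hq, norm_coe_sph]
      have h1 : (inner ℝ (w : Vec d) q : ℝ) ^ 2 < (1 / 2) ^ 2 :=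
        sq_lt_sq' (neg_lt_of_abs_lt hw) (lt_of_abs_lt hw)
      linarith
    obtain ⟨R, hRq, hRp⟩ := exists_rotation hp hq (norm_pos_iff.1 (one_half_pos.trans hw2))
    have hRq' : R.symm q = q := by
      conv_lhs => rw [← hRq]
      exact R.symm_apply_apply _
    -- Rotate the ordinary data by R⁻¹, keeping p fixed: the law is unchanged, and the condition on
    -- ⟨v,p⟩ becomes one on ⟨v,Rp⟩, where Rp lies in the half plane of w.
    rw [← (measurePreserving_rotateOthers hd μ hμ R.symm).measure_preimage hBm.nullMeasurableSet]
    refine measure_mono fun x hx => ?_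
    obtain ⟨h1, h2⟩ := hx
    rw [stopPoint_rotateOthers α hne hRq'] at h1 h2
    refine half_le_inner_of_rotation rfl hw2 hγ hpq hτ ht htα ?_ ?_
    · have h3 := R.symm.inner_map_map (stopPoint α iStar i₀ q x) q
      rw [hRq'] at h3
      rwa [h3] at h1
    · have h3 := R.symm.inner_map_map (stopPoint α iStar i₀ q x) (R p)
      rw [R.symm_apply_apply] at h3
      rwa [← hRp, ← h3]

end Rotation

end NNG

/-! ### Probabilities of the bad events. -/

namespace NNG

theorem measurable_hits_prod {ι Ω : Type} [MeasurableSpace Ω] (T : Finset ι) {A : Ω → Set Ω}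
    (hA : MeasurableSet {p : Ω × Ω | p.1 ∈ A p.2}) :
    Measurable fun p : (ι → Ω) × Ω => (hits T (A p.2) p.1 : ℝ) := by
  classical
  have h1 : (fun p : (ι → Ω) × Ω => (hits T (A p.2) p.1 : ℝ)) =
      fun p => ∑ j ∈ T, {p : Ω × Ω | p.1 ∈ A p.2}.indicator (1 : Ω × Ω → ℝ) (p.1 j, p.2) := by
    funext p
    rw [hits, ← Finset.sum_boole]
    exact Finset.sum_congr rfl fun j _ => by simp [Set.indicator_apply]
  rw [h1]
  exact Finset.measurable_fun_sum T fun j _ =>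
    Measurable.comp (g := {p : Ω × Ω | p.1 ∈ A p.2}.indicator (1 : Ω × Ω → ℝ))
      (measurable_one.indicator hA)
      (((measurable_pi_apply j).comp measurable_fst).prodMk measurable_snd)

theorem hits_update {ι Ω : Type} [DecidableEq ι] {T : Finset ι} {i : ι} (hi : i ∉ T) (A : Set Ω)
    (x : ι → Ω) (y : Ω) : hits T A (Function.update x i y) = hits T A x := by
  classical
  rw [hits, hits]
  congr 1
  refine Finset.filter_congr fun j hj => ?_
  rw [Function.update_of_ne]
  rintro rfl
  exact hi hj

theorem hits_eq_zero {ι Ω : Type} {T : Finset ι} {A : Set Ω} {x : ι → Ω} :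
    hits T A x = 0 ↔ ∀ j ∈ T, x j ∉ A := by
  classical
  rw [hits, Finset.card_eq_zero, Finset.filter_eq_empty_iff]

variable {d n : ℕ}

/-- The ordinary points other than the one with index `i`. -/
def others (iStar i : Fin n) : Finset (Fin n) := (Finset.univ.erase i).erase iStar

theorem mem_others {iStar i j : Fin n} : j ∈ others iStar i ↔ j ≠ iStar ∧ j ≠ i := by
  simp [others]

theorem card_others_le (iStar i : Fin n) : (others iStar i).card ≤ n :=
  (Finset.card_le_univ _).trans_eq (Fintype.card_fin n)

theorem le_card_others (iStar i : Fin n) : (n : ℝ) - 2 ≤ (others iStar i).card := by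
  have h1 := Finset.pred_card_le_card_erase (s := Finset.univ.erase i) (a := iStar)
  have h2 := Finset.pred_card_le_card_erase (s := (Finset.univ : Finset (Fin n))) (a := i)
  rw [Finset.card_univ, Fintype.card_fin] at h2
  have h3 : n ≤ (others iStar i).card + 2 := by
    rw [others]
    omega
  have h4 : (n : ℝ) ≤ (others iStar i).card + 2 := by exact_mod_cast h3
  linarith

theorem hits_le_deg (α : ℝ) (iStar i : Fin n) (x : Fin n → Sph d) :
    hits (others iStar i) {z : Sph d | α ≤ inner ℝ (z : Vec d) (x i : Vec d)} x ≤
      Index.deg α n (toArray x) i := by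
  classical
  rw [hits, Index.deg]
  refine Finset.card_le_card_of_injOn (fun j => (j : ℕ)) ?_ (fun a _ b _ h => Fin.ext h)
  intro j hj
  simp only [Finset.coe_filter, Set.mem_ofPred_eq, mem_others] at hj
  simp only [Finset.coe_filter, Set.mem_ofPred_eq, Finset.mem_range, toArray_apply]
  exact ⟨j.2, fun h => hj.1.2 (Fin.ext h.symm), by rw [real_inner_comm]; exact hj.2⟩

/-- The extra 1 accounts for the planted point, which `others` leaves out. -/
theorem deg_le_hits (α : ℝ) (iStar i : Fin n) (x : Fin n → Sph d) :
    Index.deg α n (toArray x) i ≤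
      hits (others iStar i) {z : Sph d | α ≤ inner ℝ (z : Vec d) (x i : Vec d)} x + 1 := by
  classical
  rw [hits, Index.deg]
  refine le_trans ?_ (Finset.card_insert_le iStar _)
  refine Finset.card_le_card_of_surjOn (fun j : Fin n => (j : ℕ)) ?_
  intro j hj
  simp only [Finset.coe_filter, Set.mem_ofPred_eq, Finset.mem_range] at hj
  obtain ⟨hjn, hij, hj⟩ := hj
  refine ⟨⟨j, hjn⟩, ?_, rfl⟩
  rw [Finset.mem_coe, Finset.mem_insert, Finset.mem_filter, mem_others]
  by_cases h : (⟨j, hjn⟩ : Fin n) = iStar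
  · exact Or.inl h
  · refine Or.inr ⟨⟨h, fun h => hij (by rw [← h])⟩, ?_⟩
    have h2 := toArray_apply x ⟨j, hjn⟩
    rw [toArray_apply, h2, real_inner_comm] at hj
    exact hj

theorem measurableSet_capRel (α : ℝ) :
    MeasurableSet {p : Sph d × Sph d | α ≤ inner ℝ (p.1 : Vec d) (p.2 : Vec d)} :=
  measurableSet_le measurable_const
    ((measurable_subtype_coe.comp measurable_fst).inner (measurable_subtype_coe.comp measurable_snd))

theorem measurableSet_cap (α : ℝ) (u : Vec d) :
    MeasurableSet {z : Sph d | α ≤ inner ℝ (z : Vec d) u} :=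
  measurableSet_le measurable_const (measurable_inner_coe u)

/-- The law of the data set. -/
def dataLaw (iStar : Fin n) (pStar : Sph d) (i : Fin n) : Measure (Sph d) :=
  if i = iStar then Measure.dirac pStar else sphereUniform d

theorem dataLaw_of_ne {iStar : Fin n} (pStar : Sph d) {j : Fin n} (hj : j ≠ iStar) :
    dataLaw iStar pStar j = sphereUniform d := if_neg hj

theorem isProbabilityMeasure_dataLaw (hd : 0 < d) (iStar : Fin n) (pStar : Sph d) (i : Fin n) :
    IsProbabilityMeasure (dataLaw iStar pStar i) := by
  rw [dataLaw]
  split_ifs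
  · infer_instance
  · exact isProbabilityMeasure_sphereUniform hd

theorem measure_planted_ne (hd : 0 < d) (iStar : Fin n) (pStar : Sph d) :
    Measure.pi (dataLaw iStar pStar) {x | x iStar ≠ pStar} = 0 := by
  have := isProbabilityMeasure_dataLaw hd iStar pStar
  have h1 : MeasurableSet ({pStar}ᶜ : Set (Sph d)) := (measurableSet_singleton _).compl
  have h2 := (measurePreserving_eval (dataLaw iStar pStar) iStar).measure_preimage
    h1.nullMeasurableSet
  rw [dataLaw, if_pos rfl, Measure.dirac_apply' _ h1] at h2
  simp only [Set.mem_compl_iff, Set.mem_singleton_iff, not_true_eq_false, not_false_eq_true,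
    Set.indicator_of_notMem] at h2
  exact h2

theorem measure_cap_coord (hd : 0 < d) {iStar : Fin n} (pStar : Sph d) {j : Fin n}
    (hj : j ≠ iStar) {u : Vec d} (hu : ‖u‖ = 1) {t : ℝ} (ht0 : 0 ≤ t) (ht1 : 2 * t ^ 2 ≤ 1) :
    Measure.pi (dataLaw iStar pStar) {x | t ≤ inner ℝ (x j : Vec d) u} ≤
      ENNReal.ofReal (Real.exp (-(d * t ^ 2 / 2))) := by
  have := isProbabilityMeasure_dataLaw hd iStar pStar
  have h2 := (measurePreserving_eval (dataLaw iStar pStar) j).measure_preimage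
    (measurableSet_cap t u).nullMeasurableSet
  rw [dataLaw_of_ne pStar hj] at h2
  exact h2.le.trans (sphereUniform_cap_le hd hu.le ht0 ht1)

theorem measure_exists_cap (hd : 0 < d) (iStar : Fin n) (pStar : Sph d)
    {u : Vec d} (hu : ‖u‖ = 1) {t : ℝ} (ht0 : 0 ≤ t) (ht1 : 2 * t ^ 2 ≤ 1) :
    Measure.pi (dataLaw iStar pStar) {x | ∃ j ≠ iStar, t ≤ inner ℝ (x j : Vec d) u} ≤
      ENNReal.ofReal (n * Real.exp (-(d * t ^ 2 / 2))) := by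
  have h1 : {x : Fin n → Sph d | ∃ j ≠ iStar, t ≤ inner ℝ (x j : Vec d) u} ⊆
      ⋃ j ∈ Finset.univ.erase iStar, {x | t ≤ inner ℝ (x j : Vec d) u} := by
    rintro x ⟨j, hj, hx⟩
    simp only [Set.mem_iUnion]
    exact ⟨j, Finset.mem_erase.2 ⟨hj, Finset.mem_univ _⟩, hx⟩
  refine (measure_mono h1).trans ((measure_biUnion_finset_le _ _).trans ?_)
  refine (Finset.sum_le_sum fun j hj => measure_cap_coord hd pStar (Finset.ne_of_mem_erase hj)
    hu ht0 ht1).trans ?_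
  rw [Finset.sum_const, nsmul_eq_mul, ENNReal.ofReal_mul (by positivity), ENNReal.ofReal_natCast]
  gcongr
  exact (Finset.card_le_univ _).trans_eq (Fintype.card_fin n)

theorem measure_abs_cap (hd : 0 < d) {iStar : Fin n} (pStar : Sph d) {j : Fin n}
    (hj : j ≠ iStar) {u : Vec d} (hu : ‖u‖ = 1) {t : ℝ} (ht0 : 0 ≤ t) (ht1 : 2 * t ^ 2 ≤ 1) :
    Measure.pi (dataLaw iStar pStar) {x | t ≤ |inner ℝ (x j : Vec d) u|} ≤
      ENNReal.ofReal (2 * Real.exp (-(d * t ^ 2 / 2))) := by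
  have h1 : {x : Fin n → Sph d | t ≤ |inner ℝ (x j : Vec d) u|} ⊆
      {x | t ≤ inner ℝ (x j : Vec d) u} ∪ {x | t ≤ inner ℝ (x j : Vec d) (-u)} := by
    intro x hx
    have hx' : t ≤ |(inner ℝ (x j : Vec d) u : ℝ)| := hx
    rcases le_abs.1 hx' with h | h
    · exact Or.inl h
    · exact Or.inr (by rw [Set.mem_ofPred_eq, inner_neg_right]; exact h)
  refine (measure_mono h1).trans ((measure_union_le _ _).trans ?_)
  refine (add_le_add (measure_cap_coord hd pStar hj hu ht0 ht1)
    (measure_cap_coord hd pStar hj (u := -u) (by rwa [norm_neg]) ht0 ht1)).trans ?_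
  rw [two_mul, ENNReal.ofReal_add (Real.exp_pos _).le (Real.exp_pos _).le]

/-- Given the start z, the other ordinary points remain independent and uniform. There are at least
n - 2 of them, so the expected number of suitable ones is at least (n - 2)r, and the lower tail at 0
applies. -/
theorem measure_no_step (hd : 0 < d) {iStar i₀ : Fin n} (pStar : Sph d) (q : Vec d)
    {α τ τ' r : ℝ} (hr : 0 ≤ r) (hstep : ∀ z : Sph d, |inner ℝ (z : Vec d) q| < τ →
      r ≤ (sphereUniform d).real
        {y | α ≤ inner ℝ (y : Vec d) (z : Vec d) ∧ τ' ≤ inner ℝ (y : Vec d) q}) :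
    Measure.pi (dataLaw iStar pStar) {x | |inner ℝ (x i₀ : Vec d) q| < τ ∧
      ∀ j ∈ others iStar i₀, ¬ (α ≤ inner ℝ (x j : Vec d) (x i₀ : Vec d) ∧
        τ' ≤ inner ℝ (x j : Vec d) q)} ≤
      ENNReal.ofReal (Real.exp (-((n - 2) * r / 2))) := by
  classical
  have := isProbabilityMeasure_dataLaw hd iStar pStar
  have hA : MeasurableSet {p : Sph d × Sph d | p.1 ∈ {y : Sph d |
      α ≤ inner ℝ (y : Vec d) (p.2 : Vec d) ∧ τ' ≤ inner ℝ (y : Vec d) q}} :=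
    (measurableSet_capRel α).inter (measurable_fst (measurableSet_cap τ' q))
  have h1 := measure_pi_le_of_forall (dataLaw iStar pStar) i₀
    (P := fun x z => |inner ℝ (z : Vec d) q| < τ ∧ (hits (others iStar i₀) {y : Sph d |
      α ≤ inner ℝ (y : Vec d) (z : Vec d) ∧ τ' ≤ inner ℝ (y : Vec d) q} x : ℝ) ≤ 0)
    (c := ENNReal.ofReal (Real.exp (-((n - 2) * r / 2))))
    ((measurable_snd (measurableSet_lt (measurable_inner_coe q).abs measurable_const)).inter
      (measurableSet_le (measurable_hits_prod (others iStar i₀)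
        (A := fun z => {y : Sph d | α ≤ inner ℝ (y : Vec d) (z : Vec d) ∧
          τ' ≤ inner ℝ (y : Vec d) q}) hA) measurable_const))
    (fun x y z => by rw [hits_update (by simp [mem_others])])
    (fun z => by
      by_cases hz : |(inner ℝ (z : Vec d) q : ℝ)| < τ
      · have h2 := measure_hits_le_le (dataLaw iStar pStar) (T := others iStar i₀)
          (A := {y : Sph d | α ≤ inner ℝ (y : Vec d) (z : Vec d) ∧ τ' ≤ inner ℝ (y : Vec d) q})
          ((measurableSet_cap α (z : Vec d)).inter (measurableSet_cap τ' q)) (r := r)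
          (fun j hj => by rw [dataLaw_of_ne pStar (mem_others.1 hj).1]; exact hstep z hz) 0
        refine (measure_mono fun x hx => hx.2).trans (h2.trans ?_)
        refine ENNReal.ofReal_le_ofReal (Real.exp_le_exp.2 ?_)
        have := mul_le_mul_of_nonneg_right (le_card_others iStar i₀) hr
        linarith
      · refine le_trans (le_of_eq ?_) (zero_le)
        refine measure_mono_null (fun x hx => ?_) measure_empty
        exact hz hx.1)
  refine (measure_mono fun x hx => ?_).trans h1
  refine ⟨hx.1, le_of_eq ?_⟩
  rw [Nat.cast_eq_zero, hits_eq_zero]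
  exact fun j hj => hx.2 j hj

/-- Conditioning on the point `i` covers the planted point too: the cap bound holds about every
centre, and only other ordinary points are counted. -/
theorem measure_deg_lt (hd : 0 < d) (iStar i : Fin n) (pStar : Sph d) {α r : ℝ} (hr : 0 ≤ r)
    (hcap : ∀ z : Sph d, r ≤ (sphereUniform d).real {y | α ≤ inner ℝ (y : Vec d) (z : Vec d)})
    (lo : ℕ) :
    Measure.pi (dataLaw iStar pStar) {x | Index.deg α n (toArray x) i < lo} ≤
      ENNReal.ofReal (Real.exp (lo - (n - 2) * r / 2)) := by
  have := isProbabilityMeasure_dataLaw hd iStar pStar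
  have h1 := measure_pi_le_of_forall (dataLaw iStar pStar) i
    (P := fun x z => (hits (others iStar i) {y : Sph d |
      α ≤ inner ℝ (y : Vec d) (z : Vec d)} x : ℝ) ≤ lo)
    (c := ENNReal.ofReal (Real.exp (lo - (n - 2) * r / 2)))
    (measurableSet_le (measurable_hits_prod (others iStar i)
        (A := fun z => {y : Sph d | α ≤ inner ℝ (y : Vec d) (z : Vec d)})
        (measurableSet_capRel α)) measurable_const)
    (fun x y z => by rw [hits_update (by simp [mem_others])])
    (fun z => by
      have h2 := measure_hits_le_le (dataLaw iStar pStar) (T := others iStar i)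
        (measurableSet_cap α (z : Vec d)) (r := r)
        (fun j hj => by rw [dataLaw_of_ne pStar (mem_others.1 hj).1]; exact hcap z) lo
      refine h2.trans (ENNReal.ofReal_le_ofReal (Real.exp_le_exp.2 ?_))
      have := mul_le_mul_of_nonneg_right (le_card_others iStar i) hr
      linarith)
  refine (measure_mono fun x hx => ?_).trans h1
  exact_mod_cast (hits_le_deg α iStar i x).trans (le_of_lt hx)

theorem measure_lt_deg (hd : 0 < d) (iStar i : Fin n) (pStar : Sph d) {α r : ℝ} (hr : 0 ≤ r)
    (hcap : ∀ z : Sph d, (sphereUniform d).real {y | α ≤ inner ℝ (y : Vec d) (z : Vec d)} ≤ r)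
    (hi : ℕ) :
    Measure.pi (dataLaw iStar pStar) {x | hi < Index.deg α n (toArray x) i} ≤
      ENNReal.ofReal (Real.exp (2 * (n * r) - hi)) := by
  have := isProbabilityMeasure_dataLaw hd iStar pStar
  have h1 := measure_pi_le_of_forall (dataLaw iStar pStar) i
    (P := fun x z => (hi : ℝ) ≤ (hits (others iStar i) {y : Sph d |
      α ≤ inner ℝ (y : Vec d) (z : Vec d)} x : ℝ))
    (c := ENNReal.ofReal (Real.exp (2 * (n * r) - hi)))
    (measurableSet_le measurable_const (measurable_hits_prod (others iStar i)
        (A := fun z => {y : Sph d | α ≤ inner ℝ (y : Vec d) (z : Vec d)})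
        (measurableSet_capRel α)))
    (fun x y z => by rw [hits_update (by simp [mem_others])])
    (fun z => by
      have h2 := measure_le_hits_le (dataLaw iStar pStar) (T := others iStar i)
        (measurableSet_cap α (z : Vec d)) (r := r)
        (fun j hj => by rw [dataLaw_of_ne pStar (mem_others.1 hj).1]; exact hcap z) hi
      refine h2.trans (ENNReal.ofReal_le_ofReal (Real.exp_le_exp.2 ?_))
      have h3 : ((others iStar i).card : ℝ) ≤ n := by exact_mod_cast card_others_le iStar i
      have := mul_le_mul_of_nonneg_right h3 hr
      linarith)
  refine (measure_mono fun x hx => ?_).trans h1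
  have h3 := deg_le_hits α iStar i x
  have h4 : hi < Index.deg α n (toArray x) i := hx
  have h5 : hi ≤ hits (others iStar i) {y : Sph d | α ≤ inner ℝ (y : Vec d) (x i : Vec d)} x := by
    omega
  exact_mod_cast h5

theorem measure_exists_deg (hd : 0 < d) (iStar : Fin n) (pStar : Sph d) {α r r' : ℝ} (hr : 0 ≤ r)
    (hr' : 0 ≤ r')
    (hcap : ∀ z : Sph d, r ≤ (sphereUniform d).real {y | α ≤ inner ℝ (y : Vec d) (z : Vec d)})
    (hcap' : ∀ z : Sph d, (sphereUniform d).real {y | α ≤ inner ℝ (y : Vec d) (z : Vec d)} ≤ r')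
    (lo hi : ℕ) :
    Measure.pi (dataLaw iStar pStar) {x | ∃ i : Fin n, Index.deg α n (toArray x) i < lo ∨
      hi < Index.deg α n (toArray x) i} ≤
      ENNReal.ofReal (n * (Real.exp (lo - (n - 2) * r / 2) + Real.exp (2 * (n * r') - hi))) := by
  have h1 : {x : Fin n → Sph d | ∃ i : Fin n, Index.deg α n (toArray x) i < lo ∨
      hi < Index.deg α n (toArray x) i} ⊆
      ⋃ i ∈ (Finset.univ : Finset (Fin n)), ({x | Index.deg α n (toArray x) i < lo} ∪
        {x | hi < Index.deg α n (toArray x) i}) := by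
    rintro x ⟨i, hi⟩
    simp only [Set.mem_iUnion]
    exact ⟨i, Finset.mem_univ i, hi⟩
  refine (measure_mono h1).trans ((measure_biUnion_finset_le _ _).trans ?_)
  refine (Finset.sum_le_sum fun i _ => (measure_union_le _ _).trans (add_le_add
    (measure_deg_lt hd iStar i pStar hr hcap lo) (measure_lt_deg hd iStar i pStar hr' hcap' hi))).trans
    (le_of_eq ?_)
  rw [Finset.sum_const, nsmul_eq_mul, ENNReal.ofReal_mul (by positivity), ENNReal.ofReal_natCast,
    ENNReal.ofReal_add (Real.exp_pos _).le (Real.exp_pos _).le, Finset.card_univ, Fintype.card_fin]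

/-- An event depending on the random start is unlikely if it is unlikely for all but one start. -/
theorem instanceMeasure_le (hd : 0 < d) (iStar : Fin n) (pStar : Sph d)
    (s : Set ((Fin n → Sph d) × Fin n)) {c : ℝ} (hc : 0 ≤ c)
    (hs : ∀ i₀ ≠ iStar, Measure.pi (dataLaw iStar pStar) {x | (x, i₀) ∈ s} ≤ ENNReal.ofReal c) :
    instanceMeasure d n iStar pStar s ≤ ENNReal.ofReal (1 / n + c) := by
  have := isProbabilityMeasure_dataLaw hd iStar pStar
  have hn : 0 < n := iStar.pos
  have hν : ∀ i : Fin n, ProbabilityTheory.uniformOn (Set.univ : Set (Fin n)) {i} =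
      ENNReal.ofReal (1 / n) := by
    intro i
    rw [ProbabilityTheory.uniformOn_univ, Measure.count_singleton, Fintype.card_fin,
      ENNReal.ofReal_div_of_pos (by exact_mod_cast hn), ENNReal.ofReal_one, ENNReal.ofReal_natCast]
  have h1 : s ⊆ ⋃ i ∈ (Finset.univ : Finset (Fin n)), {x | (x, i) ∈ s} ×ˢ {i} := by
    rintro ⟨x, i⟩ hx
    simp only [Set.mem_iUnion]
    exact ⟨i, Finset.mem_univ i, hx, rfl⟩
  change ((Measure.pi (dataLaw iStar pStar)).prod _) s ≤ _
  refine (measure_mono h1).trans ((measure_biUnion_finset_le _ _).trans ?_)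
  -- A start at the planted point is written off with conditional probability 1; it accounts for the
  -- term 1/n.
  have h2 : ∀ i ∈ (Finset.univ : Finset (Fin n)),
      ((Measure.pi (dataLaw iStar pStar)).prod (ProbabilityTheory.uniformOn Set.univ))
        ({x | (x, i) ∈ s} ×ˢ {i}) ≤ ENNReal.ofReal (1 / n * ((if i = iStar then 1 else 0) + c)) := by
    intro i _
    rw [Measure.prod_prod, hν, mul_comm, ENNReal.ofReal_mul (by positivity)]
    gcongr
    by_cases h : i = iStar
    · rw [if_pos h]
      refine prob_le_one.trans ?_
      rw [← ENNReal.ofReal_one]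
      exact ENNReal.ofReal_le_ofReal (by linarith)
    · rw [if_neg h, zero_add]
      exact hs i h
  refine (Finset.sum_le_sum h2).trans ?_
  rw [← ENNReal.ofReal_sum_of_nonneg fun i _ => by split_ifs <;> positivity]
  refine ENNReal.ofReal_le_ofReal (le_of_eq ?_)
  rw [← Finset.mul_sum, Finset.sum_add_distrib, Finset.sum_ite_eq' Finset.univ iStar,
    if_pos (Finset.mem_univ _), Finset.sum_const, Finset.card_univ, Fintype.card_fin, nsmul_eq_mul]
  have : (n : ℝ) ≠ 0 := by exact_mod_cast hn.ne'
  field_simp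

/-- The probability that something goes wrong, in terms of the measures of caps. -/
theorem instanceMeasure_not_good_le (hd : 0 < d) (hd8 : Real.exp (-(d / 8)) ≤ 1 / 4)
    (hn2 : n < 2 ^ d) (iStar : Fin n) (pStar q : Sph d) {α γ τ t δ r r' r₀ : ℝ} {lo hi : ℕ}
    (hγ0 : 0 < γ) (hγ1 : γ < 1) (hγd : 1 / (d : ℝ) ≤ γ / 2)
    (hpq : γ ≤ inner ℝ (pStar : Vec d) (q : Vec d))
    (hτ0 : 0 ≤ τ) (hτ1 : 2 * τ ^ 2 ≤ 1) (ht : 0 < t) (ht1 : t ≤ 1) (htα : t ≤ γ * τ - α)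
    (hr : 0 ≤ r) (hr' : 0 ≤ r') (hr₀ : 0 ≤ r₀)
    (hcap : ∀ z : Sph d, r ≤ (sphereUniform d).real {y | α ≤ inner ℝ (y : Vec d) (z : Vec d)})
    (hcap' : ∀ z : Sph d, (sphereUniform d).real {y | α ≤ inner ℝ (y : Vec d) (z : Vec d)} ≤ r')
    (hstep : ∀ z : Sph d, |inner ℝ (z : Vec d) (q : Vec d)| < τ →
      r₀ ≤ (sphereUniform d).real {y | α ≤ inner ℝ (y : Vec d) (z : Vec d) ∧
        τ + 1 / (d : ℝ) ≤ inner ℝ (y : Vec d) (q : Vec d)})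
    (h1 : (n : ℝ) ^ (1 / (1 + γ ^ 2) - δ) ≤ lo)
    (h2 : (100 * (d * (hi + 1)) : ℝ) ≤ (n : ℝ) ^ (1 / (1 + γ ^ 2) + δ))
    (h3 : (n : ℝ) ^ ((2 + γ ^ 2) / (1 + γ ^ 2) - δ) ≤ n * lo)
    (h4 : (100 * (d * (n * (hi + 1))) : ℝ) ≤ (n : ℝ) ^ ((2 + γ ^ 2) / (1 + γ ^ 2) + δ))
    (h5 : (n : ℝ) ^ (1 - δ) ≤ n) (h6 : (100 * (d * n) : ℝ) ≤ (n : ℝ) ^ (1 + δ)) :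
    instanceMeasure d n iStar pStar
        {ω | ¬ Good α γ δ q iStar ω.1 ω.2 (Index.build α (fun i => (ω.1 i : Vec d)))} ≤
      ENNReal.ofReal (1 / n + (n * Real.exp (-(d * (γ / 2) ^ 2 / 2)) +
        (2 * Real.exp (-(d * τ ^ 2 / 2)) + (Real.exp (-((n - 2) * r₀ / 2)) +
        (2 * Real.exp (-(d * t ^ 2 / 8)) + n * (Real.exp (lo - (n - 2) * r / 2) +
          Real.exp (2 * (n * r') - hi))))))) := by
  have := isProbabilityMeasure_dataLaw hd iStar pStar
  refine instanceMeasure_le hd iStar pStar _ (by positivity) fun i₀ hi₀ => ?_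
  -- The bad events: a misplaced planted point (null), another point near q, a start not nearly
  -- orthogonal to q, no improving neighbor, a first stop not adjacent to the planted point, an
  -- abnormal degree.
  have hsub : {x : Fin n → Sph d | (x, i₀) ∈
      {ω : (Fin n → Sph d) × Fin n | ¬ Good α γ δ q iStar ω.1 ω.2
        (Index.build α (fun i => (ω.1 i : Vec d)))}} ⊆
      {x | x iStar ≠ pStar} ∪ ({x | ∃ j ≠ iStar, γ / 2 ≤ inner ℝ (x j : Vec d) (q : Vec d)} ∪
      ({x | τ ≤ |inner ℝ (x i₀ : Vec d) (q : Vec d)|} ∪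
      ({x | |inner ℝ (x i₀ : Vec d) (q : Vec d)| < τ ∧
        ∀ j ∈ others iStar i₀, ¬ (α ≤ inner ℝ (x j : Vec d) (x i₀ : Vec d) ∧
          τ + 1 / (d : ℝ) ≤ inner ℝ (x j : Vec d) (q : Vec d))} ∪
      ({x | τ ≤ inner ℝ (stopPoint α iStar i₀ q x) (q : Vec d) ∧
        inner ℝ (stopPoint α iStar i₀ q x) (pStar : Vec d) < α} ∪
      {x | ∃ i : Fin n, Index.deg α n (toArray x) i < lo ∨
        hi < Index.deg α n (toArray x) i})))) := by
    intro x hx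
    by_contra hcon
    simp only [Set.mem_union, not_or, Set.mem_ofPred_eq] at hcon
    obtain ⟨e0, e1, e2, e3, e4, e5⟩ := hcon
    push Not at e0 e1 e2 e3 e4 e5
    refine hx (good_of (τ := τ) hd hn2 hi₀ hγd (by change γ ≤ inner ℝ (x iStar : Vec d) (q : Vec d); rw [e0]; exact hpq) e1 (lt_of_abs_lt e2) ?_ ?_
      (fun i hi => (e5 ⟨i, hi⟩).1) (fun i hi => (e5 ⟨i, hi⟩).2) h1 h2 h3 h4 h5 h6)
    · obtain ⟨j, hj, hj1, hj2⟩ := e3 e2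
      exact ⟨j, (mem_others.1 hj).2, by rwa [real_inner_comm], hj2⟩
    · change _ → α ≤ inner ℝ _ (x iStar : Vec d)
      rw [e0]
      exact e4
  refine (measure_mono hsub).trans ?_
  refine (measure_union_le _ _).trans ?_
  rw [measure_planted_ne hd, zero_add]
  have hq := norm_coe_sph q
  have b1 := measure_exists_cap hd iStar pStar hq (t := γ / 2) (by linarith) (by nlinarith)
  have b2 := measure_abs_cap hd pStar hi₀ hq hτ0 hτ1
  have b3 := measure_no_step hd (i₀ := i₀) (iStar := iStar) pStar (q : Vec d) (α := α) hr₀ hstep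
  have b4 := measure_stopPoint_le hd hd8 (dataLaw iStar pStar)
    (fun j hj => dataLaw_of_ne pStar hj) hi₀ (norm_coe_sph pStar) hq hγ0.le hpq hτ0 ht ht1 htα
  have b5 := measure_exists_deg hd iStar pStar hr hr' hcap hcap' lo hi
  rw [ENNReal.ofReal_add (by positivity) (by positivity),
    ENNReal.ofReal_add (by positivity) (by positivity),
    ENNReal.ofReal_add (by positivity) (by positivity),
    ENNReal.ofReal_add (by positivity) (by positivity)]
  exact (measure_union_le _ _).trans (add_le_add b1 ((measure_union_le _ _).trans (add_le_add b2
    ((measure_union_le _ _).trans (add_le_add b3 ((measure_union_le _ _).trans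
      (add_le_add b4 b5)))))))

end NNG

/-! ### Cap measures as powers of n. -/

namespace NNG

variable {d n : ℕ}

/-- Equivalently √(1 - μ²)^d = 1/n: caps of height μ have measure about 1/n. -/
theorem one_sub_mu_sq (hd : 0 < d) (hn : 0 < n) :
    1 - mu d n ^ 2 = Real.exp (-(2 * Real.log n / d)) := by
  have hn' : (0 : ℝ) < n := by exact_mod_cast hn
  have h1 : (n : ℝ) ^ (-2 / (d : ℝ)) = Real.exp (-(2 * Real.log n / d)) := by
    rw [Real.rpow_def_of_pos hn']
    congr 1
    ring
  have h2 : Real.exp (-(2 * Real.log n / d)) ≤ 1 := by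
    rw [Real.exp_le_one_iff, neg_nonpos]
    have := Real.log_natCast_nonneg n
    positivity
  rw [mu, h1, Real.sq_sqrt (by linarith)]
  ring

theorem mu_nonneg (d n : ℕ) : 0 ≤ mu d n := Real.sqrt_nonneg _

theorem mu_le (hd : 0 < d) (hn : 0 < n) : mu d n ≤ √(2 * Real.log n / d) := by
  refine Real.le_sqrt_of_sq_le ?_
  have h1 := one_sub_mu_sq hd hn
  have h2 := Real.add_one_le_exp (-(2 * Real.log n / d))
  linarith

/-- From exp(-y) ≤ 1 - y + y² at y = 2 log n / d; it shows that dμ² is nearly 2 log n. -/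
theorem le_mul_mu_sq (hd : 0 < d) (hn : 0 < n) :
    2 * Real.log n * (1 - 2 * (Real.log n / d)) ≤ d * mu d n ^ 2 := by
  have hd' : (0 : ℝ) < d := by exact_mod_cast hd
  have hL : 0 ≤ Real.log n := Real.log_natCast_nonneg n
  have h1 := one_sub_mu_sq hd hn
  set y := 2 * Real.log n / d with hy
  have hy0 : 0 ≤ y := by positivity
  have h2 : Real.exp (-y) ≤ 1 - y + y ^ 2 := by
    rw [Real.exp_neg]
    have h3 := Real.add_one_le_exp y
    have h4 : (Real.exp y)⁻¹ ≤ (y + 1)⁻¹ := inv_anti₀ (by linarith) h3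
    refine h4.trans ?_
    rw [inv_le_iff_one_le_mul₀ (by linarith)]
    nlinarith [pow_nonneg hy0 3]
  have h5 : y * (1 - y) ≤ mu d n ^ 2 := by nlinarith
  have h6 := mul_le_mul_of_nonneg_left h5 hd'.le
  refine le_trans (le_of_eq ?_) h6
  rw [hy]
  field_simp

/-- Caps at height `√ρ μ` have measure about `n ^ (-ρ)`. -/
theorem exp_le_sqrt_pow (hd : 0 < d) (hn : 0 < n) {ρ c : ℝ} (hρ0 : 0 ≤ ρ) (hρ1 : ρ ≤ 1)
    (hc : c ^ 2 ≤ ρ * mu d n ^ 2) :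
    Real.exp (-(ρ * Real.log n)) ≤ √(1 - c ^ 2) ^ d := by
  have hd' : (0 : ℝ) < d := by exact_mod_cast hd
  have h1 := one_sub_mu_sq hd hn
  -- Bernoulli's inequality for exponents in [0,1]: (1 - μ²)^ρ ≤ 1 - ρμ² ≤ 1 - c².
  have h2 := rpow_one_add_le_one_add_mul_self (s := -mu d n ^ 2)
    (by linarith [Real.exp_pos (-(2 * Real.log n / d))]) hρ0 hρ1
  rw [← sub_eq_add_neg, h1, ← Real.exp_mul] at h2
  have h3 : Real.exp (-(ρ * Real.log n / d)) ≤ √(1 - c ^ 2) := by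
    refine Real.le_sqrt_of_sq_le ?_
    rw [← Real.exp_nat_mul]
    refine le_trans (le_of_eq ?_) (h2.trans (by linarith))
    congr 1
    push_cast
    ring
  refine le_trans (le_of_eq ?_) (pow_le_pow_left₀ (Real.exp_pos _).le h3 d)
  rw [← Real.exp_nat_mul]
  congr 1
  field_simp

theorem le_cap_measure (hd : 0 < d) (hn : 0 < n) {α ρ : ℝ} (hα : 0 < α) (hρ0 : 0 ≤ ρ) (hρ1 : ρ ≤ 1)
    (hc : (α + 3 / √d) ^ 2 ≤ ρ * mu d n ^ 2) (z : Sph d) :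
    Real.exp (-(ρ * Real.log n)) / 4 ≤
      (sphereUniform d).real {y | α ≤ inner ℝ (y : Vec d) (z : Vec d)} := by
  have := isProbabilityMeasure_sphereUniform hd
  have hz := norm_coe_sph z
  have h0 : 0 ≤ α + 3 / √d := by positivity
  have hmu : mu d n ^ 2 ≤ 1 := by
    linarith [one_sub_mu_sq hd hn, Real.exp_pos (-(2 * Real.log n / d))]
  have hnorm : ‖(α + 3 / √d) • (z : Vec d)‖ = α + 3 / √d := by
    rw [norm_smul, hz, mul_one, Real.norm_of_nonneg h0]
  have hin : (inner ℝ ((α + 3 / √d) • (z : Vec d)) (z : Vec d) : ℝ) = α + 3 / √d := by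
    rw [real_inner_smul_left, real_inner_self_eq_norm_sq, hz]
    ring
  have h1 := le_sphereUniform_caps hd hz hz (c := (α + 3 / √d) • (z : Vec d))
    (by
      rw [hnorm]
      refine le_of_sq_le_sq ?_ zero_le_one
      rw [one_pow]
      nlinarith [sq_nonneg (mu d n)]) hα hα.le hin.ge hin.ge
  simp only [and_self] at h1
  rw [hnorm, ← ofReal_measureReal, ENNReal.ofReal_le_ofReal_iff measureReal_nonneg] at h1
  have h2 := exp_le_sqrt_pow hd hn hρ0 hρ1 hc
  linarith

theorem cap_measure_le (hd : 0 < d) {α : ℝ} (hα : 0 ≤ α) (hα1 : 2 * α ^ 2 ≤ 1) (z : Sph d) :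
    (sphereUniform d).real {y | α ≤ inner ℝ (y : Vec d) (z : Vec d)} ≤
      Real.exp (-(d * α ^ 2 / 2)) :=
  ENNReal.toReal_le_of_le_ofReal (Real.exp_pos _).le
    (sphereUniform_cap_le hd (norm_coe_sph z).le hα hα1)

/-- The centre for `le_sphereUniform_caps` is c = az + bq. Since z and q are only nearly orthogonal,
the inner products lose at most bs₀ and as₀, and ‖c‖² gains at most 2abs₀. -/
theorem le_caps_measure (hd : 0 < d) (hn : 0 < n) {a b α τ' s₀ ρ : ℝ} (hα : 0 < α) (hτ' : 0 ≤ τ')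
    (hρ0 : 0 ≤ ρ) (hρ1 : ρ ≤ 1) (ha : 0 ≤ a) (hb : 0 ≤ b)
    (h1 : α + 3 / √d + b * s₀ ≤ a) (h2 : τ' + 3 / √d + a * s₀ ≤ b)
    (hc : a ^ 2 + b ^ 2 + 2 * (a * b * s₀) ≤ ρ * mu d n ^ 2)
    (z q : Sph d) (hs : |(inner ℝ (z : Vec d) (q : Vec d) : ℝ)| < s₀) :
    Real.exp (-(ρ * Real.log n)) / 4 ≤ (sphereUniform d).real
      {y | α ≤ inner ℝ (y : Vec d) (z : Vec d) ∧ τ' ≤ inner ℝ (y : Vec d) (q : Vec d)} := by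
  have := isProbabilityMeasure_sphereUniform hd
  have hz := norm_coe_sph z
  have hq := norm_coe_sph q
  have hmu : mu d n ^ 2 ≤ 1 := by
    linarith [one_sub_mu_sq hd hn, Real.exp_pos (-(2 * Real.log n / d))]
  set s : ℝ := inner ℝ (z : Vec d) (q : Vec d) with hsdef
  have hs1 : s ≤ s₀ := (le_abs_self s).trans hs.le
  have hs2 : -s₀ ≤ s := (neg_lt_of_abs_lt hs).le
  set c : Vec d := a • (z : Vec d) + b • (q : Vec d) with hcdef
  have hcz : (inner ℝ c (z : Vec d) : ℝ) = a + b * s := by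
    rw [hcdef, inner_add_left, real_inner_smul_left, real_inner_smul_left,
      real_inner_self_eq_norm_sq, hz, real_inner_comm, ← hsdef]
    ring
  have hcq : (inner ℝ c (q : Vec d) : ℝ) = a * s + b := by
    rw [hcdef, inner_add_left, real_inner_smul_left, real_inner_smul_left,
      real_inner_self_eq_norm_sq, hq, ← hsdef]
    ring
  have hcn : ‖c‖ ^ 2 ≤ ρ * mu d n ^ 2 := by
    refine le_trans ?_ hc
    rw [hcdef, norm_add_sq_real, norm_smul, norm_smul, hz, hq, real_inner_smul_left,
      real_inner_smul_right, ← hsdef, mul_one, mul_one, Real.norm_eq_abs, Real.norm_eq_abs, sq_abs,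
      sq_abs]
    have := mul_le_mul_of_nonneg_left hs1 (mul_nonneg ha hb)
    nlinarith
  have h3 := le_sphereUniform_caps hd hz hq (c := c)
    (by
      refine le_of_sq_le_sq ?_ zero_le_one
      rw [one_pow]
      nlinarith [sq_nonneg (mu d n)]) hα hτ'
    (by rw [hcz]; nlinarith [mul_le_mul_of_nonneg_left hs2 hb])
    (by rw [hcq]; nlinarith [mul_le_mul_of_nonneg_left hs2 ha])
  rw [← ofReal_measureReal, ENNReal.ofReal_le_ofReal_iff measureReal_nonneg] at h3
  have h4 := exp_le_sqrt_pow hd hn hρ0 hρ1 hcn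
  linarith

/-- A point close to the query up to `σ μ` has neighbors that are still closer, if `ε` is large
compared to the lower order terms. -/
theorem le_step_measure (hd : 0 < d) (hn : 0 < n) {a₀ σ ε α : ℝ} (ha₀ : 0 ≤ a₀) (ha₀1 : a₀ ≤ 1)
    (hσ : 0 ≤ σ) (hσ1 : σ ≤ 1)
    (haσ : a₀ ^ 2 + σ ^ 2 = 1) (hε0 : 0 < ε) (hε : 8 * ε < a₀)
    (hα : α = (a₀ - ε) * mu d n) (hμ : 0 < mu d n)
    (hb : 4 / √d + 8 * mu d n ^ 2 ≤ ε ^ 2 * mu d n) (q z : Sph d)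
    (hz : |(inner ℝ (z : Vec d) (q : Vec d) : ℝ)| < σ * mu d n) :
    Real.exp (-((1 - a₀ * ε) * Real.log n)) / 4 ≤ (sphereUniform d).real
      {y | α ≤ inner ℝ (y : Vec d) (z : Vec d) ∧
        σ * mu d n + 1 / (d : ℝ) ≤ inner ℝ (y : Vec d) (q : Vec d)} := by
  set μ := mu d n with hμdef
  have hε1 : ε ≤ 1 / 8 := by linarith
  have hd1 : (1 : ℝ) / d ≤ 1 / √d := by
    have h1 : (1 : ℝ) ≤ d := by exact_mod_cast hd
    refine one_div_le_one_div_of_le (by positivity) ?_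
    rw [Real.sqrt_le_left (by positivity)]
    nlinarith
  have h3d : 4 / √d = 3 / √d + 1 / √d := by ring
  have hd0 : (0 : ℝ) ≤ 3 / √d := by positivity
  have hd0' : (0 : ℝ) ≤ 1 / (d : ℝ) := by positivity
  have hE : ε ^ 2 ≤ 1 / 64 := by nlinarith
  -- The extra ε²μ in both coefficients pays for 4/√d and for the cross terms of order μ². The
  -- squares still sum to at most (1 - a₀ε)μ², because -2a₀ε dominates the terms of order ε² when 8ε
  -- < a₀.
  refine le_caps_measure hd hn (a := (a₀ - ε + ε ^ 2) * μ) (b := (σ + ε ^ 2) * μ)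
    (s₀ := σ * μ) (by rw [hα]; exact mul_pos (by linarith) hμ) (by positivity)
    (by nlinarith) (by nlinarith) (mul_nonneg (by nlinarith) hμ.le) (by positivity) ?_ ?_ ?_ z q hz
  · have h1 : (σ + ε ^ 2) * σ ≤ 8 := by nlinarith
    have h2 := mul_le_mul_of_nonneg_right h1 (sq_nonneg μ)
    rw [hα, show (σ + ε ^ 2) * μ * (σ * μ) = (σ + ε ^ 2) * σ * μ ^ 2 by ring, add_mul (a₀ - ε)]
    linarith [one_div_nonneg.2 (Real.sqrt_nonneg d)]
  · have h0 : 0 ≤ a₀ - ε + ε ^ 2 := by nlinarith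
    have h1 : (a₀ - ε + ε ^ 2) * σ ≤ 8 := by nlinarith
    have h2 := mul_le_mul_of_nonneg_right h1 (sq_nonneg μ)
    rw [show (a₀ - ε + ε ^ 2) * μ * (σ * μ) = (a₀ - ε + ε ^ 2) * σ * μ ^ 2 by ring, add_mul σ]
    linarith
  · have h0 : 0 ≤ a₀ - ε + ε ^ 2 := by nlinarith
    have h1 : (a₀ - ε + ε ^ 2) * (σ + ε ^ 2) * σ ≤ 4 := by
      have h2 : (a₀ - ε + ε ^ 2) ≤ 2 := by nlinarith
      have h3 : (σ + ε ^ 2) ≤ 2 := by nlinarith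
      have h4 : (a₀ - ε + ε ^ 2) * (σ + ε ^ 2) ≤ 2 * 2 :=
        mul_le_mul h2 h3 (by positivity) (by norm_num)
      have h5 : 0 ≤ (a₀ - ε + ε ^ 2) * (σ + ε ^ 2) := mul_nonneg h0 (by positivity)
      nlinarith
    have h8 : 8 * μ ≤ ε ^ 2 := by
      have h4 : (0 : ℝ) ≤ 4 / √d := by positivity
      have h5 : 8 * μ * μ ≤ ε ^ 2 * μ := by nlinarith
      exact le_of_mul_le_mul_right h5 hμ
    have h6 : (a₀ - ε + ε ^ 2) ^ 2 + (σ + ε ^ 2) ^ 2 + ε ^ 2 ≤ 1 - a₀ * ε := by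
      have e1 : ε ^ 2 * (a₀ - ε) ≤ ε ^ 2 * 1 := mul_le_mul_of_nonneg_left (by linarith) (sq_nonneg ε)
      have e2 : ε ^ 2 * σ ≤ ε ^ 2 * 1 := mul_le_mul_of_nonneg_left hσ1 (sq_nonneg ε)
      have e3 : ε ^ 2 * ε ^ 2 ≤ ε ^ 2 * (1 / 64) := mul_le_mul_of_nonneg_left hE (sq_nonneg ε)
      have e4 : 8 * ε * ε ≤ a₀ * ε := mul_le_mul_of_nonneg_right hε.le hε0.le
      nlinarith
    have h7 := mul_le_mul_of_nonneg_right h6 (sq_nonneg μ)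
    have h9 : 2 * ((a₀ - ε + ε ^ 2) * μ * ((σ + ε ^ 2) * μ) * (σ * μ)) ≤ ε ^ 2 * μ ^ 2 := by
      have e1 := mul_le_mul_of_nonneg_right h1 (pow_nonneg hμ.le 3)
      have e2 := mul_le_mul_of_nonneg_right h8 (sq_nonneg μ)
      rw [show 2 * ((a₀ - ε + ε ^ 2) * μ * ((σ + ε ^ 2) * μ) * (σ * μ)) =
        2 * ((a₀ - ε + ε ^ 2) * (σ + ε ^ 2) * σ * μ ^ 3) by ring]
      linarith [show 8 * μ * μ ^ 2 = 2 * (4 * μ ^ 3) by ring]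
    rw [mul_pow, mul_pow]
    linarith [add_mul ((a₀ - ε + ε ^ 2) ^ 2 + (σ + ε ^ 2) ^ 2) (ε ^ 2) (μ ^ 2),
      add_mul ((a₀ - ε + ε ^ 2) ^ 2) ((σ + ε ^ 2) ^ 2) (μ ^ 2)]

end NNG

/-! ### Choice of parameters in a fixed dimension. -/

namespace NNG

/-- exp(cL) ≥ (cL/2)², and a quadratic beats a linear term. -/
theorem sub_exp_le {k c L : ℝ} (hk : 0 < k) (hc : 0 < c) (hL1 : 1 ≤ L) (hL : 16 / (k * c ^ 2) ≤ L) :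
    L + 2 - k * Real.exp (c * L) ≤ -L := by
  have h1 : Real.exp (c * L) = Real.exp (c * L / 2) ^ 2 := by
    rw [← Real.exp_nat_mul]
    congr 1
    push_cast
    ring
  have h2 := Real.add_one_le_exp (c * L / 2)
  have h3 : (c * L / 2) ^ 2 ≤ Real.exp (c * L / 2) ^ 2 := by
    have : 0 ≤ c * L / 2 := by positivity
    exact pow_le_pow_left₀ this (by linarith) 2
  rw [div_le_iff₀ (by positivity)] at hL
  have h4 : 16 * L ≤ L * (k * c ^ 2) * L := mul_le_mul_of_nonneg_right hL (by linarith)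
  have h5 := mul_le_mul_of_nonneg_left h3 hk.le
  rw [← h1] at h5
  have h6 : k * (c * L / 2) ^ 2 = L * (k * c ^ 2) * L / 4 := by ring
  linarith

/-- With M = exp((E - D)L) ≥ 1 the exponent (N - 2)r/2 is at least M exp(DL)/16, far above lo ≤ M +
1; the surplus also pays for the union bound over N points. -/
theorem mul_exp_lower_tail_le {L E D δ' N r lo : ℝ} (hDE : D ≤ E)
    (hN : Real.exp L = N) (hN4 : 4 ≤ N) (hr : r = Real.exp (-((1 - E) * L)) / 4)
    (hL : 0 ≤ L)
    (hlo : lo ≤ Real.exp ((E - D) * L) + 1)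
    (hy : 16 ≤ Real.exp (D * L)) (hδ : Real.exp (L + 2 - 1 / 16 * Real.exp (D * L)) ≤ δ') :
    N * Real.exp (lo - (N - 2) * r / 2) ≤ δ' := by
  rw [← hN, ← Real.exp_add]
  refine le_trans (Real.exp_le_exp.2 ?_) hδ
  set M := Real.exp ((E - D) * L) with hM
  have hM1 : 1 ≤ M := Real.one_le_exp (mul_nonneg (sub_nonneg.2 hDE) hL)
  have h1 : Real.exp L * r = M * Real.exp (D * L) / 4 := by
    rw [hr, hM, ← Real.exp_add, ← mul_div_assoc, ← Real.exp_add]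
    congr 2
    ring
  have hr0 : 0 ≤ r := by rw [hr]; positivity
  have h2 : Real.exp L / 2 * r ≤ (Real.exp L - 2) * r :=
    mul_le_mul_of_nonneg_right (by linarith) hr0
  have h3 : 1 * (Real.exp (D * L) / 16 - 1) ≤ M * (Real.exp (D * L) / 16 - 1) :=
    mul_le_mul_of_nonneg_right hM1 (by linarith)
  nlinarith

/-- With M = exp((E + D)L) ≥ 1, the threshold is at least M exp(DL) while twice the mean is at most
2M. -/
theorem mul_exp_upper_tail_le {L E D δ' N r hi : ℝ} (hD : 0 < D) (hE : 0 ≤ E) (hL : 0 ≤ L)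
    (hN : Real.exp L = N) (hr : N * r ≤ Real.exp ((E + D) * L))
    (hhi : Real.exp ((E + 2 * D) * L) ≤ hi)
    (hz : 2 ≤ Real.exp (D * L)) (hδ : Real.exp (L + 2 - 1 * Real.exp (D * L)) ≤ δ') :
    N * Real.exp (2 * (N * r) - hi) ≤ δ' := by
  rw [← hN, ← Real.exp_add]
  rw [← hN] at hr
  refine le_trans (Real.exp_le_exp.2 ?_) hδ
  set M := Real.exp ((E + D) * L) with hM
  have hM1 : 1 ≤ M := Real.one_le_exp (by positivity)
  have h1 : Real.exp ((E + 2 * D) * L) = M * Real.exp (D * L) := by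
    rw [hM, ← Real.exp_add]
    congr 1
    ring
  rw [h1] at hhi
  have h3 : 1 * (Real.exp (D * L) - 2) ≤ M * (Real.exp (D * L) - 2) :=
    mul_le_mul_of_nonneg_right hM1 (by linarith)
  linarith

set_option maxHeartbeats 800000 in
/-- The bound in a fixed dimension, under explicit conditions on the parameters. -/
theorem instanceMeasure_not_good_le_of_large {d n : ℕ} {γ δ D a₀ σ ε α L : ℝ}
    (hd : 0 < d) (hn4 : 4 ≤ n) (hLn : L = Real.log n) (hd8 : Real.exp (-(d / 8)) ≤ 1 / 4)
    (hn2 : n < 2 ^ d) (hγ0 : 0 < γ) (hγ1 : γ < 1) (hγd : 1 / (d : ℝ) ≤ γ / 2)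
    (ha₀ : 0 < a₀) (hσ : 0 < σ) (haσ : a₀ ^ 2 + σ ^ 2 = 1) (hγσ : γ * σ = a₀)
    (hσe : σ ^ 2 = 1 / (1 + γ ^ 2))
    (hε0 : 0 < ε) (hε : 8 * ε < a₀) (hLd : L / d ≤ 1 / 4) (hLγ : L ≤ d * γ ^ 2 / 16)
    (hεb : 4 / √L + 8 * √(2 * L / d) ≤ ε ^ 2)
    (hD : 0 < D) (hDδ : 2 * D ≤ δ) (hDσ : D ≤ σ ^ 2) (hDε : 2 * ε + 2 * (L / d) ≤ D / 2)
    (hdD : 300 * (d : ℝ) ≤ Real.exp (D * L)) (hy : 16 ≤ Real.exp (D / 2 * L))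
    (c0 : 1 / (n : ℝ) ≤ δ / 8) (c1 : Real.exp (-(d * γ ^ 2 / 16)) ≤ δ / 8)
    (c2 : 2 * Real.exp (-(σ ^ 2 * L / 2)) ≤ δ / 8) (c3 : Real.exp (-(a₀ * √L / 4)) ≤ δ / 8)
    (c4 : 2 * Real.exp (-(√L / 2)) ≤ δ / 8)
    (c5 : Real.exp (L + 2 - 1 / 16 * Real.exp (D * L)) ≤ δ / 8)
    (c6 : Real.exp (L + 2 - 1 * Real.exp (D / 2 * L)) ≤ δ / 8)
    (hα : α = (a₀ - ε) * mu d n) (iStar : Fin n) (pStar q : Sph d)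
    (hpq : γ ≤ inner ℝ (pStar : Vec d) (q : Vec d)) :
    instanceMeasure d n iStar pStar
        {ω | ¬ Good α γ δ q iStar ω.1 ω.2 (Index.build α (fun i => (ω.1 i : Vec d)))} ≤
      ENNReal.ofReal δ := by
  have hn : 0 < n := by omega
  have hn' : (0 : ℝ) < n := by exact_mod_cast hn
  have hn4' : (4 : ℝ) ≤ n := by exact_mod_cast hn4
  have hd' : (0 : ℝ) < d := by exact_mod_cast hd
  have hexpL : Real.exp L = n := by rw [hLn, Real.exp_log hn']
  have hrpow : ∀ y : ℝ, (n : ℝ) ^ y = Real.exp (y * L) := fun y => by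
    rw [Real.rpow_def_of_pos hn', hLn, mul_comm]
  have hL0 : 0 < L := by
    rw [hLn]
    exact Real.log_pos (by linarith)
  have ha₀1 : a₀ ≤ 1 := by
    refine le_of_sq_le_sq ?_ zero_le_one
    linarith [sq_nonneg σ]
  have hσ1 : σ ≤ 1 := by
    refine le_of_sq_le_sq ?_ zero_le_one
    linarith [sq_nonneg a₀]
  have hLd0 : 0 ≤ L / d := by positivity
  set μ := mu d n with hμdef
  have hμ0 : 0 ≤ μ := mu_nonneg d n
  have hμle : μ ≤ √(2 * L / d) := by rw [hLn]; exact mu_le hd hn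
  have hμ2 : μ ^ 2 ≤ 1 / 2 := by
    have h1 : μ ^ 2 ≤ 2 * L / d := by
      refine (pow_le_pow_left₀ hμ0 hμle 2).trans_eq (Real.sq_sqrt (by positivity))
    have h2 : 2 * L / d = 2 * (L / d) := by ring
    linarith
  have hdμ : 2 * L * (1 - 2 * (L / d)) ≤ d * μ ^ 2 := by rw [hLn]; exact le_mul_mu_sq hd hn
  have hdμL : L ≤ d * μ ^ 2 := by
    have : 2 * L * (1 / 2) ≤ 2 * L * (1 - 2 * (L / d)) :=
      mul_le_mul_of_nonneg_left (by linarith) (by linarith)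
    linarith
  have hμpos : 0 < μ := by
    rcases hμ0.eq_or_lt with h | h
    · rw [← h] at hdμL
      norm_num at hdμL
      linarith
    · exact h
  have hsL : 0 < √L := Real.sqrt_pos.2 hL0
  have hsLL : √L * √L = L := Real.mul_self_sqrt hL0.le
  have hεL : 4 * √L ≤ ε ^ 2 * L := by
    have h1 : 4 / √L ≤ ε ^ 2 := by
      have : 0 ≤ √(2 * L / d) := Real.sqrt_nonneg _
      linarith
    rw [div_le_iff₀ hsL] at h1
    have h2 := mul_le_mul_of_nonneg_right h1 hsL.le
    rwa [mul_assoc, hsLL] at h2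
  -- This is `hεb` multiplied by μ, using √L ≤ μ√d and μ ≤ √(2L/d).
  have hb : 4 / √d + 8 * μ ^ 2 ≤ ε ^ 2 * μ := by
    have h1 : 4 / √d ≤ 4 / √L * μ := by
      rw [div_mul_eq_mul_div, div_le_div_iff₀ (by positivity) hsL]
      have h2 : √L ≤ μ * √d := by
        refine Real.sqrt_le_iff.2 ⟨by positivity, ?_⟩
        rw [mul_pow, Real.sq_sqrt hd'.le]
        linarith
      linarith
    have h2 : 8 * μ ^ 2 ≤ 8 * √(2 * L / d) * μ := by
      rw [pow_two, ← mul_assoc]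
      exact mul_le_mul_of_nonneg_right (by linarith) hμ0
    have h3 := mul_le_mul_of_nonneg_right hεb hμ0
    linarith
  have hε1 : ε ≤ 1 / 8 := by linarith
  have hεε : ε ^ 2 ≤ ε := by
    rw [pow_two]
    exact mul_le_of_le_one_left hε0.le (by linarith)
  have hα0 : 0 < α := by rw [hα]; exact mul_pos (by linarith) hμpos
  have hlow : (α + 3 / √d) ^ 2 ≤ a₀ ^ 2 * μ ^ 2 := by
    rw [← mul_pow]
    refine pow_le_pow_left₀ (by positivity) ?_ 2
    have h1 : 4 / √d = 3 / √d + 1 / √d := by ring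
    have h2 : 0 ≤ 1 / √d := by positivity
    have h3 : ε ^ 2 * μ ≤ ε * μ := mul_le_mul_of_nonneg_right hεε hμ0
    have h4 : 0 ≤ 8 * μ ^ 2 := by positivity
    rw [hα, sub_mul]
    linarith
  have hασ : (a₀ - ε) ^ 2 ≤ 1 := pow_le_one₀ (by linarith) (by linarith)
  have hup : (n : ℝ) * Real.exp (-(d * α ^ 2 / 2)) ≤ Real.exp ((σ ^ 2 + D / 2) * L) := by
    rw [← hexpL, ← Real.exp_add]
    refine Real.exp_le_exp.2 ?_
    have h1 : (a₀ - ε) ^ 2 * (2 * L * (1 - 2 * (L / d))) ≤ (a₀ - ε) ^ 2 * (d * μ ^ 2) :=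
      mul_le_mul_of_nonneg_left hdμ (sq_nonneg _)
    have h2 : (1 - σ ^ 2 - D / 2) ≤ (a₀ - ε) ^ 2 * (1 - 2 * (L / d)) := by
      have h3 : (a₀ - ε) ^ 2 * (2 * (L / d)) ≤ 1 * (2 * (L / d)) :=
        mul_le_mul_of_nonneg_right hασ (by positivity)
      have h4 : a₀ * ε ≤ 1 * ε := mul_le_mul_of_nonneg_right ha₀1 hε0.le
      rw [mul_sub, mul_one, show (a₀ - ε) ^ 2 = a₀ ^ 2 - 2 * (a₀ * ε) + ε ^ 2 by ring] at *
      linarith [sq_nonneg ε]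
    have h3 := mul_le_mul_of_nonneg_right h2 hL0.le
    rw [hα, mul_pow]
    linarith
  -- One D of the exponent error δ ≥ 2D is spent on the degrees; another absorbs the factor 300d.
  set lo := ⌈Real.exp ((σ ^ 2 - D) * L)⌉₊ with hlo
  set hi := ⌈Real.exp ((σ ^ 2 + D) * L)⌉₊ with hhi
  have hlo1 : Real.exp ((σ ^ 2 - D) * L) ≤ lo := Nat.le_ceil _
  have hlo2 : (lo : ℝ) ≤ Real.exp ((σ ^ 2 - D) * L) + 1 :=
    (Nat.ceil_lt_add_one (Real.exp_pos _).le).le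
  have hhi1 : Real.exp ((σ ^ 2 + D) * L) ≤ hi := Nat.le_ceil _
  have hhi2 : (hi : ℝ) ≤ Real.exp ((σ ^ 2 + D) * L) + 1 :=
    (Nat.ceil_lt_add_one (Real.exp_pos _).le).le
  have g1 : (n : ℝ) ^ (1 / (1 + γ ^ 2) - δ) ≤ lo := by
    rw [hrpow, ← hσe]
    refine le_trans (Real.exp_le_exp.2 ?_) hlo1
    exact mul_le_mul_of_nonneg_right (by linarith) hL0.le
  have g2 : (100 * (d * (hi + 1)) : ℝ) ≤ (n : ℝ) ^ (1 / (1 + γ ^ 2) + δ) := by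
    rw [hrpow, ← hσe]
    have h1 : Real.exp (D * L) * Real.exp ((σ ^ 2 + D) * L) ≤ Real.exp ((σ ^ 2 + δ) * L) := by
      rw [← Real.exp_add]
      refine Real.exp_le_exp.2 ?_
      rw [← add_mul]
      exact mul_le_mul_of_nonneg_right (by linarith) hL0.le
    have h2 : 1 ≤ Real.exp ((σ ^ 2 + D) * L) := Real.one_le_exp (by positivity)
    have h3 : (hi : ℝ) + 1 ≤ 3 * Real.exp ((σ ^ 2 + D) * L) := by linarith
    have h4 := mul_le_mul_of_nonneg_left h3 hd'.le
    have h5 := mul_le_mul_of_nonneg_right hdD (Real.exp_pos ((σ ^ 2 + D) * L)).le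
    linarith
  have hexp : (2 + γ ^ 2) / (1 + γ ^ 2) = 1 + 1 / (1 + γ ^ 2) := by
    have : (1 + γ ^ 2) ≠ 0 := by positivity
    field_simp
    ring
  have g3 : (n : ℝ) ^ ((2 + γ ^ 2) / (1 + γ ^ 2) - δ) ≤ n * lo := by
    rw [hexp, add_sub_assoc, Real.rpow_add hn', Real.rpow_one]
    exact mul_le_mul_of_nonneg_left g1 hn'.le
  have g4 : (100 * (d * (n * (hi + 1))) : ℝ) ≤ (n : ℝ) ^ ((2 + γ ^ 2) / (1 + γ ^ 2) + δ) := by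
    rw [hexp, add_assoc, Real.rpow_add hn', Real.rpow_one]
    refine le_trans (le_of_eq ?_) (mul_le_mul_of_nonneg_left g2 hn'.le)
    ring
  have hδ : 0 < δ := by linarith
  have g5 : (n : ℝ) ^ (1 - δ) ≤ n := by
    conv_rhs => rw [← Real.rpow_one (n : ℝ)]
    exact Real.rpow_le_rpow_of_exponent_le (by linarith) (by linarith)
  have g6 : (100 * (d * n) : ℝ) ≤ (n : ℝ) ^ (1 + δ) := by
    rw [Real.rpow_add hn', Real.rpow_one, hrpow]
    have h1 : Real.exp (D * L) ≤ Real.exp (δ * L) :=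
      Real.exp_le_exp.2 (mul_le_mul_of_nonneg_right (by linarith) hL0.le)
    have h2 : 100 * (d : ℝ) ≤ Real.exp (δ * L) := by linarith
    have h3 := mul_le_mul_of_nonneg_right h2 hn'.le
    linarith
  have hτ2 : (σ * μ) ^ 2 ≤ 1 / 2 := by
    rw [mul_pow]
    have : σ ^ 2 ≤ 1 := by linarith [sq_nonneg a₀]
    exact (mul_le_of_le_one_left (sq_nonneg μ) this).trans hμ2
  have hα2 : α ^ 2 ≤ 1 / 2 := by
    rw [hα, mul_pow]
    exact (mul_le_of_le_one_left (sq_nonneg μ) hασ).trans hμ2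
  have hμ1 : μ ≤ 1 := le_of_sq_le_sq (by linarith) zero_le_one
  -- For τ = σμ the margin γτ - α is exactly εμ, because γσ = a₀; so t = εμ.
  have hmain := instanceMeasure_not_good_le hd hd8 hn2 iStar pStar q (α := α) (γ := γ)
    (τ := σ * μ) (t := ε * μ) (δ := δ) (r := Real.exp (-(a₀ ^ 2 * L)) / 4)
    (r' := Real.exp (-(d * α ^ 2 / 2))) (r₀ := Real.exp (-((1 - a₀ * ε) * L)) / 4)
    (lo := lo) (hi := hi) hγ0 hγ1 hγd hpq (by positivity) (by linarith) (by positivity)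
    (mul_le_one₀ (by linarith) hμ0 hμ1) (by rw [hα, ← mul_assoc, hγσ]; linarith [sub_mul a₀ ε μ]) (by positivity)
    (by positivity) (by positivity)
    (fun z => by
      rw [hLn]
      exact le_cap_measure hd hn hα0 (sq_nonneg a₀) (by linarith [sq_nonneg σ]) hlow z)
    (fun z => cap_measure_le hd hα0.le (by linarith) z)
    (fun z hz => by
      rw [hLn]
      exact le_step_measure hd hn ha₀.le ha₀1 hσ.le hσ1 haσ hε0 hε hα hμpos hb q z hz)
    g1 g2 g3 g4 g5 g6
  refine hmain.trans (ENNReal.ofReal_le_ofReal ?_)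
  have t1 : (n : ℝ) * Real.exp (-(d * (γ / 2) ^ 2 / 2)) ≤ δ / 8 := by
    rw [← hexpL, ← Real.exp_add]
    refine le_trans (Real.exp_le_exp.2 ?_) c1
    rw [div_pow]
    linarith
  have t2 : 2 * Real.exp (-(d * (σ * μ) ^ 2 / 2)) ≤ δ / 8 := by
    refine le_trans (mul_le_mul_of_nonneg_left (Real.exp_le_exp.2 ?_) two_pos.le) c2
    have := mul_le_mul_of_nonneg_left hdμL (sq_nonneg σ)
    rw [mul_pow]
    linarith
  -- Here n·n^(-(1-a₀ε)) = exp(a₀εL) ≥ a₀εL ≥ 4a₀√L.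
  have t3 : Real.exp (-(((n : ℝ) - 2) * (Real.exp (-((1 - a₀ * ε) * L)) / 4) / 2)) ≤ δ / 8 := by
    refine le_trans (Real.exp_le_exp.2 ?_) c3
    set r₀ := Real.exp (-((1 - a₀ * ε) * L)) with hr₀
    have h1 : (n : ℝ) * r₀ = Real.exp (a₀ * ε * L) := by
      rw [hr₀, ← hexpL, ← Real.exp_add]
      congr 1
      ring
    have h2 := Real.add_one_le_exp (a₀ * ε * L)
    have h3 : (n : ℝ) / 2 * r₀ ≤ (n - 2) * r₀ :=
      mul_le_mul_of_nonneg_right (by linarith) (Real.exp_pos _).le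
    have h4 : 4 * √L ≤ ε * L := by
      refine hεL.trans (mul_le_mul_of_nonneg_right hεε hL0.le)
    have h5 := mul_le_mul_of_nonneg_left h4 ha₀.le
    linarith
  have t4 : 2 * Real.exp (-(d * (ε * μ) ^ 2 / 8)) ≤ δ / 8 := by
    refine le_trans (mul_le_mul_of_nonneg_left (Real.exp_le_exp.2 ?_) two_pos.le) c4
    have := mul_le_mul_of_nonneg_left hdμL (sq_nonneg ε)
    rw [mul_pow]
    linarith
  have t5 := mul_exp_lower_tail_le (r := Real.exp (-(a₀ ^ 2 * L)) / 4) hDσ hexpL hn4'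
    (by rw [show a₀ ^ 2 = 1 - σ ^ 2 by linarith]) hL0.le hlo2
    (hy.trans (Real.exp_le_exp.2 (mul_le_mul_of_nonneg_right (by linarith) hL0.le))) c5
  have t6 := mul_exp_upper_tail_le (E := σ ^ 2) (hi := (hi : ℝ)) (half_pos hD) (sq_nonneg σ) hL0.le hexpL hup
    (by rw [show σ ^ 2 + 2 * (D / 2) = σ ^ 2 + D by ring]; exact hhi1) (by linarith) c6
  -- Seven terms, each at most δ/8.
  rw [mul_add]
  linarith

end NNG

/-! ### Asymptotics and the final theorem. -/

namespace NNG

/-- The slack in the inner product threshold: small, but large compared to the lower order terms. -/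
def slack (n : ℕ → ℕ) (d : ℕ) : ℝ :=
  √(4 / √(Real.log (n d)) + 8 * √(2 * Real.log (n d) / d)) + 1 / ((d : ℝ) + 1)

/-- The summand 1/(d + 1) is there for this: the square root vanishes when log (n d) = 0. -/
theorem slack_pos (n : ℕ → ℕ) (d : ℕ) : 0 < slack n d := by
  rw [slack]
  positivity

/-- The first term yields ε²L ≥ 4√L and beats losses of order 1/√d; the second beats errors of
relative order μ. -/
theorem le_slack_sq (n : ℕ → ℕ) (d : ℕ) :
    4 / √(Real.log (n d)) + 8 * √(2 * Real.log (n d) / d) ≤ slack n d ^ 2 := by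
  have h0 : 0 ≤ 4 / √(Real.log (n d)) + 8 * √(2 * Real.log (n d) / d) := by positivity
  refine (Real.sq_sqrt h0).symm.le.trans (pow_le_pow_left₀ (Real.sqrt_nonneg _) ?_ 2)
  rw [slack]
  have : (0 : ℝ) ≤ 1 / ((d : ℝ) + 1) := by positivity
  linarith

theorem tendsto_log_of_dim {n : ℕ → ℕ}
    (hdim : (fun d : ℕ => Real.log d) =o[atTop] (fun d : ℕ => Real.log (n d))) :
    Tendsto (fun d => Real.log (n d)) atTop atTop := by
  have h1 : Tendsto (fun d : ℕ => Real.log d) atTop atTop :=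
    Real.tendsto_log_atTop.comp tendsto_natCast_atTop_atTop
  refine tendsto_atTop_mono' _ ?_ h1
  filter_upwards [hdim.def one_pos] with d hd
  rw [one_mul, Real.norm_of_nonneg (Real.log_natCast_nonneg _),
    Real.norm_of_nonneg (Real.log_natCast_nonneg _)] at hd
  exact hd

theorem tendsto_slack {n : ℕ → ℕ}
    (hL : Tendsto (fun d => Real.log (n d)) atTop atTop)
    (hLd : Tendsto (fun d => Real.log (n d) / d) atTop (𝓝 0)) :
    Tendsto (slack n) atTop (𝓝 0) := by
  have h1 : Tendsto (fun d => 4 / √(Real.log (n d))) atTop (𝓝 0) :=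
    (Real.tendsto_sqrt_atTop.comp hL).const_div_atTop 4
  have h2 : Tendsto (fun d => 8 * √(2 * Real.log (n d) / d)) atTop (𝓝 0) := by
    have h3 : Tendsto (fun d => 8 * √(2 * (Real.log (n d) / d))) atTop (𝓝 (8 * √(2 * 0))) :=
      ((hLd.const_mul 2).sqrt).const_mul 8
    simpa [mul_div_assoc] using h3
  have h4 : Tendsto (fun d => √(4 / √(Real.log (n d)) + 8 * √(2 * Real.log (n d) / d))) atTop
      (𝓝 0) := by
    simpa using (h1.add h2).sqrt
  have h5 := h4.add (tendsto_one_div_add_atTop_nhds_zero_nat (𝕜 := ℝ))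
  rwa [add_zero] at h5

theorem eventually_mul_exp_neg_le {η c : ℝ} (hη : 0 < η) (hc : 0 < c) (k : ℝ) {f : ℕ → ℝ}
    (hf : Tendsto f atTop atTop) : ∀ᶠ d in atTop, k * Real.exp (-(c * f d)) ≤ η := by
  have h1 : Tendsto (fun d => k * Real.exp (-(c * f d))) atTop (𝓝 (k * 0)) :=
    (Real.tendsto_exp_neg_atTop_nhds_zero.comp (hf.const_mul_atTop hc)).const_mul k
  rw [mul_zero] at h1
  exact h1.eventually_le_const hη

theorem eventually_exp_sub_exp_le {η k c : ℝ} (hη : 0 < η) (hk : 0 < k) (hc : 0 < c) {f : ℕ → ℝ}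
    (hf : Tendsto f atTop atTop) :
    ∀ᶠ d in atTop, Real.exp (f d + 2 - k * Real.exp (c * f d)) ≤ η := by
  filter_upwards [hf.eventually_ge_atTop 1, hf.eventually_ge_atTop (16 / (k * c ^ 2)),
    eventually_mul_exp_neg_le hη one_pos 1 hf] with d h1 h2 h3
  refine le_trans (Real.exp_le_exp.2 (sub_exp_le hk hc h1 h2)) ?_
  simpa using h3

end NNG

end

theorem mainTheorem4
    (γ : ℝ) (hγ0 : 0 < γ) (hγ1 : γ < 1)
    (n : ℕ → ℕ)
    (hsparse : (fun d : ℕ => Real.log (n d)) =o[atTop] (fun d : ℕ => (d : ℝ)))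
    (hdim : (fun d : ℕ => Real.log d) =o[atTop] (fun d : ℕ => Real.log (n d))) :
    ∃ ε₀ : ℕ → ℝ, (∀ d, 0 < ε₀ d) ∧ Tendsto ε₀ atTop (𝓝 0) ∧
      ∀ ε : ℕ → ℝ, Tendsto ε atTop (𝓝 0) → (∀ᶠ d in atTop, ε₀ d ≤ ε d) →
        ∀ δ : ℝ, 0 < δ → ∀ᶠ d : ℕ in atTop,
          ∀ (α : ℝ), α = (√(γ ^ 2 / (1 + γ ^ 2)) - ε d) * NNG.mu d (n d) →
          ∀ (iStar : Fin (n d)) (pStar q : NNG.Sph d),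
            γ ≤ inner ℝ (pStar : NNG.Vec d) (q : NNG.Vec d) →
            NNG.instanceMeasure d (n d) iStar pStar
                {ω | ¬ NNG.Good α γ δ q iStar ω.1 ω.2
                  (NNG.Index.build α (fun i => (ω.1 i : NNG.Vec d)))}
              ≤ ENNReal.ofReal δ := by
  have hL := NNG.tendsto_log_of_dim hdim
  have hLd : Tendsto (fun d => Real.log (n d) / d) atTop (𝓝 0) := hsparse.tendsto_div_nhds_zero
  refine ⟨NNG.slack n, NNG.slack_pos n, NNG.tendsto_slack hL hLd, ?_⟩
  intro ε hε hε₀ δ hδ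
  have hγ2 : 0 < 1 + γ ^ 2 := by positivity
  set a₀ := √(γ ^ 2 / (1 + γ ^ 2)) with ha₀def
  set σ := √(1 / (1 + γ ^ 2)) with hσdef
  have ha₀ : 0 < a₀ := Real.sqrt_pos.2 (by positivity)
  have hσ : 0 < σ := Real.sqrt_pos.2 (by positivity)
  have ha₀2 : a₀ ^ 2 = γ ^ 2 / (1 + γ ^ 2) := Real.sq_sqrt (by positivity)
  have hσ2 : σ ^ 2 = 1 / (1 + γ ^ 2) := Real.sq_sqrt (by positivity)
  have haσ : a₀ ^ 2 + σ ^ 2 = 1 := by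
    rw [ha₀2, hσ2, ← add_div, add_comm, div_self hγ2.ne']
  have hγσ : γ * σ = a₀ := by
    rw [ha₀def, hσdef, Real.sqrt_div zero_le_one, Real.sqrt_div (sq_nonneg γ),
      Real.sqrt_sq hγ0.le, Real.sqrt_one, mul_one_div]
  -- Capping D at σ² keeps the exponent σ² - D of the lower degree bound nonnegative.
  set D := min (δ / 2) (σ ^ 2) with hD
  have hD0 : 0 < D := lt_min (half_pos hδ) (by positivity)
  have hDδ : 2 * D ≤ δ := by linarith [min_le_left (δ / 2) (σ ^ 2)]
  have hδ8 : 0 < δ / 8 := by positivity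
  have hcast : Tendsto (fun d : ℕ => (d : ℝ)) atTop atTop := tendsto_natCast_atTop_atTop
  have hsqrt : Tendsto (fun d => √(Real.log (n d))) atTop atTop :=
    Real.tendsto_sqrt_atTop.comp hL
  have hεLd : Tendsto (fun d => 2 * ε d + 2 * (Real.log (n d) / d)) atTop (𝓝 0) := by
    simpa using (hε.const_mul 2).add (hLd.const_mul 2)
  have hdL : Tendsto (fun d : ℕ => Real.log d / Real.log (n d)) atTop (𝓝 0) :=
    hdim.tendsto_div_nhds_zero
  have hinv : Tendsto (fun d : ℕ => 1 / (d : ℝ)) atTop (𝓝 0) := tendsto_const_div_atTop_nhds_zero_nat 1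
  -- The conditions on d involve only γ, n, ε and δ; hence the uniformity in the planted point, its
  -- position and the query.
  filter_upwards [hε₀, eventually_gt_atTop 0, hL.eventually_ge_atTop (Real.log 4),
    NNG.eventually_mul_exp_neg_le (show (0 : ℝ) < 1 / 4 by norm_num)
      (show (0 : ℝ) < 1 / 8 by norm_num) 1 hcast,
    hLd.eventually_lt_const (Real.log_pos one_lt_two),
    hinv.eventually_le_const (half_pos hγ0),
    hε.eventually_lt_const (show (0 : ℝ) < a₀ / 8 by positivity),
    hLd.eventually_le_const (show (0 : ℝ) < 1 / 4 by norm_num),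
    hLd.eventually_le_const (show (0 : ℝ) < γ ^ 2 / 16 by positivity),
    hεLd.eventually_le_const (half_pos hD0),
    hdL.eventually_le_const (half_pos hD0),
    hL.eventually_ge_atTop (Real.log 300 / (D / 2)),
    hL.eventually_ge_atTop (Real.log (8 / δ)),
    NNG.eventually_mul_exp_neg_le hδ8 (show 0 < γ ^ 2 / 16 by positivity) 1 hcast,
    NNG.eventually_mul_exp_neg_le hδ8 (show 0 < σ ^ 2 / 2 by positivity) 2 hL,
    NNG.eventually_mul_exp_neg_le hδ8 (show 0 < a₀ / 4 by positivity) 1 hsqrt,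
    NNG.eventually_mul_exp_neg_le hδ8 one_half_pos 2 hsqrt,
    NNG.eventually_exp_sub_exp_le hδ8 (show (0 : ℝ) < 1 / 16 by norm_num) hD0 hL,
    NNG.eventually_exp_sub_exp_le hδ8 one_pos (half_pos hD0) hL]
    with d e1 hd e3 e4 e5 e6 e7 e8 e9 e10 e11 e12 e13 e14 e15 e16 e17 e18 e19
  intro α hα iStar pStar q hpq
  have hd' : (0 : ℝ) < d := by exact_mod_cast hd
  have hn : 0 < n d := iStar.pos
  have hn' : (0 : ℝ) < n d := by exact_mod_cast hn
  have hL0 : 0 < Real.log (n d) := (Real.log_pos (by norm_num)).trans_le e3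
  have h300 : 300 ≤ Real.exp (D / 2 * Real.log (n d)) := by
    rw [div_le_iff₀ (half_pos hD0)] at e12
    rw [← Real.exp_log (show (0 : ℝ) < 300 by norm_num)]
    exact Real.exp_le_exp.2 (by linarith)
  have hεsq : NNG.slack n d ^ 2 ≤ ε d ^ 2 := pow_le_pow_left₀ (NNG.slack_pos n d).le e1 2
  refine NNG.instanceMeasure_not_good_le_of_large (L := Real.log (n d)) (D := D) (a₀ := a₀) (σ := σ)
    (ε := ε d) hd ?_ rfl ?_ ?_ hγ0 hγ1 e6 ha₀ hσ haσ hγσ hσ2 ((NNG.slack_pos n d).trans_le e1)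
    (by linarith) e8 ?_ ((NNG.le_slack_sq n d).trans hεsq) hD0 hDδ (min_le_right _ _) e10 ?_
    (by linarith) ?_ ?_ ?_ ?_ ?_ e18 e19 hα iStar pStar q hpq
  · have h := (Real.log_le_log_iff (by norm_num) hn').1 e3
    exact_mod_cast h
  · rw [one_mul] at e4
    refine le_trans (le_of_eq ?_) e4
    congr 1
    ring
  · rw [div_lt_iff₀ hd'] at e5
    have h1 : Real.log (n d) < Real.log ((2 : ℝ) ^ d) := by
      rw [Real.log_pow]
      linarith
    have h2 := (Real.log_lt_log_iff hn' (by positivity)).1 h1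
    exact_mod_cast h2
  · rw [div_le_iff₀ hd'] at e9
    linarith
  · rw [div_le_iff₀ hL0] at e11
    have h1 : (d : ℝ) ≤ Real.exp (D / 2 * Real.log (n d)) := by
      rw [← Real.log_le_iff_le_exp hd']
      exact e11
    -- One half of D absorbs the constant 300, the other the factor d, by log d = o(log n).
    have h2 : Real.exp (D * Real.log (n d)) =
        Real.exp (D / 2 * Real.log (n d)) * Real.exp (D / 2 * Real.log (n d)) := by
      rw [← Real.exp_add]
      congr 1
      ring
    rw [h2]
    exact mul_le_mul h300 h1 hd'.le (Real.exp_pos _).le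
  · have h := (Real.log_le_log_iff (by positivity) hn').1 e13
    rw [div_le_iff₀ hδ] at h
    rw [div_le_iff₀ hn']
    linarith
  · rw [one_mul] at e14
    refine le_trans (le_of_eq ?_) e14
    congr 1
    ring
  · refine le_trans (le_of_eq ?_) e15
    congr 2
    ring
  · rw [one_mul] at e16
    refine le_trans (le_of_eq ?_) e16
    congr 1
    ring
  · refine le_trans (le_of_eq ?_) e17
    congr 2
    ring
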